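/- Let $F$ be a field of characteristic zero (for example a local field of characteristic zero). A quadratic space over a field is a finite-dimensional vector space with a non-degenerate symmetric bilinear form. A symmetric pair over $F$ is a triple $(G,H,\theta)$, where $G$ is an algebraic group over $F$, $\theta$ is an automorphism of $G$ with $\theta^2=1$, and $H=G^\theta$; put $s(g)=g\,\theta(g^{-1})$. For $\varepsilon\in G(F)$ of order $2$, $(G,G_\varepsilon)$ denotes the symmetric pair with involution $x\mapsto\varepsilon x\varepsilon$. A descendant of $(G,H,\theta)$ is a symmetric pair $(G_x,H_x,\theta|_{G_x})$, where $x=s(g)$ for some $g\in G(F)$ such that the double coset $HgH$ is Zariski closed in $G$, and $G_x,H_x$ are the centralizers of $x$ in $G$ and $H$. **Theorem.** Let $(V,B)$ be a quadratic space over $F$ and let $\varepsilon\in O(V)$ be an element of order $2$. Then every descendant of the pair $(O(V),O(V)_\varepsilon)$ is isomorphic, as a symmetric pair over $F$, to a finite product of pairs of the following types: (i) $(GL(W),O(W))$, with involution the inverse transpose, for some quadratic space $W$ over some finite field extension $F'$ of $F$; (ii) $(U(W_E),O(W))$ for some quadratic space $W$ over some finite field extension $F'$ of $F$ and some quadratic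 field extension $E$ of $F'$; here $W_E=W\otimes_{F'}E$ carries the hermitian form that extends the form of $W$, and the involution of $U(W_E)$ is conjugation by the semilinear map $\mathrm{id}\otimes\tau$, with $\tau$ the non-trivial element of $\mathrm{Gal}(E/F')$; (iii) $(O(W),O(W)_{\varepsilon'})$ for some quadratic space $W$ over $F$ and some element $\varepsilon'\in O(W)$ of order $2$. In (i) and (ii) the groups over $F'$ are regarded as groups over $F$ by restriction of scalars. -/

import Mathlib

open scoped TensorProduct

universe u

/-! ## Group functors and symmetric pairs -/

/-- A group functor over a field `K` (an algebraic group over `K`, seen through its functor of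
points): a group `pts R` of points with values in every commutative `K`-algebra `R`,
functorially in `R`. -/
structure GroupFunctor (K : Type u) [Field K] where
  pts : ∀ (R : Type u) [CommRing R] [Algebra K R], Type u
  grp : ∀ (R : Type u) [CommRing R] [Algebra K R], Group (pts R)
  map : ∀ {R S : Type u} [CommRing R] [Algebra K R] [CommRing S] [Algebra K S],
    (R →ₐ[K] S) → (pts R →* pts S)
  map_id : ∀ (R : Type u) [CommRing R] [Algebra K R] (g : pts R), map (AlgHom.id K R) g = g
  map_comp : ∀ {R S T : Type u} [CommRing R] [Algebra K R] [CommRing S] [Algebra K S]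
    [CommRing T] [Algebra K T] (f' : S →ₐ[K] T) (f : R →ₐ[K] S) (g : pts R),
    map (f'.comp f) g = map f' (map f g)

attribute [instance] GroupFunctor.grp

/-- The data of a symmetric pair `(G, H, θ)` over `K`: a group functor `G` with an
automorphism `θ` such that `θ² = 1`. The subgroup `H = G^θ` is `SymPair.H`. -/
structure SymPair (K : Type u) [Field K] where
  G : GroupFunctor K
  θ : ∀ (R : Type u) [CommRing R] [Algebra K R], G.pts R →* G.pts R
  θ_θ : ∀ (R : Type u) [CommRing R] [Algebra K R] (g : G.pts R), θ R (θ R g) = g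
  θ_map : ∀ {R S : Type u} [CommRing R] [Algebra K R] [CommRing S] [Algebra K S]
    (f : R →ₐ[K] S) (g : G.pts R), θ S (G.map f g) = G.map f (θ R g)

namespace SymPair

variable {K : Type u} [Field K]

/-- The points of the subgroup `H = G^θ`. -/
def H (P : SymPair K) (R : Type u) [CommRing R] [Algebra K R] : Subgroup (P.G.pts R) where
  carrier := {g | P.θ R g = g}
  mul_mem' := by
    intro a b ha hb
    simp only [Set.mem_ofPred_eq] at ha hb ⊢
    rw [map_mul, ha, hb]
  one_mem' := map_one _
  inv_mem' := by
    intro a ha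
    simp only [Set.mem_ofPred_eq] at ha ⊢
    rw [map_inv, ha]

/-- The anti-involution `σ(g) = θ(g⁻¹)`. -/
def σ (P : SymPair K) (R : Type u) [CommRing R] [Algebra K R] (g : P.G.pts R) : P.G.pts R :=
  P.θ R g⁻¹

/-- The symmetrization map `s(g) = g σ(g)`. -/
def s (P : SymPair K) (R : Type u) [CommRing R] [Algebra K R] (g : P.G.pts R) : P.G.pts R :=
  g * P.σ R g

theorem σ_s (P : SymPair K) (R : Type u) [CommRing R] [Algebra K R] (g : P.G.pts R) :
    P.σ R (P.s R g) = P.s R g := by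
  simp [s, σ, P.θ_θ]

/-- An isomorphism of symmetric pairs `(G, H, θ) ≅ (G', H', θ')`: a natural isomorphism of group
functors that intertwines the involutions (hence carries `H = G^θ` onto `H' = G'^θ'`). -/
structure Iso (P Q : SymPair K) where
  toEquiv : ∀ (R : Type u) [CommRing R] [Algebra K R], P.G.pts R ≃* Q.G.pts R
  map_comm : ∀ {R S : Type u} [CommRing R] [Algebra K R] [CommRing S] [Algebra K S]
    (f : R →ₐ[K] S) (g : P.G.pts R), toEquiv S (P.G.map f g) = Q.G.map f (toEquiv R g)
  θ_comm : ∀ (R : Type u) [CommRing R] [Algebra K R] (g : P.G.pts R),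
    toEquiv R (P.θ R g) = Q.θ R (toEquiv R g)

/-- The product of a finite family of symmetric pairs. -/
def prod {n : ℕ} (P : Fin n → SymPair K) : SymPair K where
  G :=
    { pts := fun R _ _ => ∀ i, (P i).G.pts R
      grp := fun R _ _ => Pi.group
      map := fun f =>
        { toFun := fun g i => (P i).G.map f (g i)
          map_one' := by funext i; exact map_one _
          map_mul' := by intro a b; funext i; exact map_mul _ _ _ }
      map_id := by intro R _ _ g; funext i; exact (P i).G.map_id R (g i)
      map_comp := by
        intro R S T _ _ _ _ _ _ f' f g
        funext i
        exact (P i).G.map_comp f' f (g i) }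
  θ := fun R _ _ =>
    { toFun := fun g i => (P i).θ R (g i)
      map_one' := by funext i; exact map_one _
      map_mul' := by intro a b; funext i; exact map_mul _ _ _ }
  θ_θ := by intro R _ _ g; funext i; exact (P i).θ_θ R (g i)
  θ_map := by intro R S _ _ _ _ f g; funext i; exact (P i).θ_map f (g i)

/-- The symmetric pair `(G, G_ε)` attached to an element `ε ∈ G(K)` of order `2`: the
involution is `x ↦ ε x ε`. -/
def ofElement (G : GroupFunctor K) (ε : G.pts K) (hε : orderOf ε = 2) : SymPair K where
  G := G
  θ := fun R _ _ =>
    { toFun := fun g => G.map (Algebra.ofId K R) ε * g * G.map (Algebra.ofId K R) ε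
      map_one' := by
        rw [mul_one, ← pow_two, ← map_pow, orderOf_dvd_iff_pow_eq_one.1 hε.dvd, map_one]
      map_mul' := by
        intro a b
        have h : G.map (Algebra.ofId K R) ε * G.map (Algebra.ofId K R) ε = 1 := by
          rw [← pow_two, ← map_pow, orderOf_dvd_iff_pow_eq_one.1 hε.dvd, map_one]
        calc _ = G.map (Algebra.ofId K R) ε * a * 1 * b * G.map (Algebra.ofId K R) ε := by
              simp only [mul_one, mul_assoc]
          _ = _ := by rw [← h]; simp only [mul_assoc] }
  θ_θ := by
    intro R _ _ g
    have h : G.map (Algebra.ofId K R) ε * G.map (Algebra.ofId K R) ε = 1 := by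
      rw [← pow_two, ← map_pow, orderOf_dvd_iff_pow_eq_one.1 hε.dvd, map_one]
    change G.map (Algebra.ofId K R) ε * (G.map (Algebra.ofId K R) ε * g *
      G.map (Algebra.ofId K R) ε) * G.map (Algebra.ofId K R) ε = g
    calc _ = (G.map (Algebra.ofId K R) ε * G.map (Algebra.ofId K R) ε) * g *
          (G.map (Algebra.ofId K R) ε * G.map (Algebra.ofId K R) ε) := by
            simp only [mul_assoc]
      _ = g := by rw [h, one_mul, mul_one]
  θ_map := by
    intro R S _ _ _ _ f g
    have h : G.map (Algebra.ofId K S) ε = G.map f (G.map (Algebra.ofId K R) ε) := by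
      rw [← G.map_comp]
      congr 2
      exact Subsingleton.elim _ _
    change G.map (Algebra.ofId K S) ε * G.map f g * G.map (Algebra.ofId K S) ε =
      G.map f (G.map (Algebra.ofId K R) ε * g * G.map (Algebra.ofId K R) ε)
    rw [h, map_mul, map_mul]

/-- For `x ∈ G(K)` with `σ(x) = x`, the symmetric pair `(G_x, H_x, θ|_{G_x})`, where `G_x` is the
centralizer of `x`. -/
def centralizer (P : SymPair K) (x : P.G.pts K) (hx : P.σ K x = x) : SymPair K where
  G :=
    { pts := fun R _ _ => Subgroup.centralizer {P.G.map (Algebra.ofId K R) x}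
      grp := fun _ _ _ => inferInstance
      map := fun {R S} _ _ _ _ f =>
        ((P.G.map f).comp (Subgroup.subtype _)).codRestrict _ (by
          intro g
          have h : P.G.map (Algebra.ofId K S) x = P.G.map f (P.G.map (Algebra.ofId K R) x) := by
            rw [← P.G.map_comp]
            congr 2
            exact Subsingleton.elim _ _
          have hg := Subgroup.mem_centralizer_singleton_iff.1 g.2
          rw [Subgroup.mem_centralizer_singleton_iff]
          change P.G.map f g.1 * _ = _ * P.G.map f g.1
          rw [h, ← map_mul, ← map_mul, hg])
      map_id := by
        intro R _ _ g
        exact Subtype.ext (P.G.map_id R g.1)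
      map_comp := by
        intro R S T _ _ _ _ _ _ f' f g
        exact Subtype.ext (P.G.map_comp f' f g.1) }
  θ := fun R _ _ =>
    ((P.θ R).comp (Subgroup.subtype _)).codRestrict _ (by
      intro g
      have h : P.θ R (P.G.map (Algebra.ofId K R) x) = (P.G.map (Algebra.ofId K R) x)⁻¹ := by
        rw [P.θ_map, ← map_inv]
        congr 1
        have := hx
        unfold σ at this
        rw [map_inv] at this
        rw [← this, inv_inv, this]
      have hg := Subgroup.mem_centralizer_singleton_iff.1 g.2
      have hg' := congrArg (P.θ R) hg
      rw [map_mul, map_mul, h] at hg'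
      rw [Subgroup.mem_centralizer_singleton_iff]
      change P.θ R g.1 * _ = _ * P.θ R g.1
      exact (Commute.inv_right_iff (a := P.θ R g.1)).1 hg')
  θ_θ := by
    intro R _ _ g
    exact Subtype.ext (P.θ_θ R g.1)
  θ_map := by
    intro R S _ _ _ _ f g
    exact Subtype.ext (P.θ_map f g.1)

/-- Restriction of scalars along a field extension `K / F`: the pair `(G_{K/F}, H_{K/F})`, whose
`R`-points are the points of `(G, H)` in `K ⊗[F] R`. -/
def res (F : Type u) [Field F] [Algebra F K] (P : SymPair K) : SymPair F where
  G :=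
    { pts := fun R _ _ => P.G.pts (K ⊗[F] R)
      grp := fun _ _ _ => inferInstance
      map := fun f => P.G.map (Algebra.TensorProduct.map (AlgHom.id K K) f)
      map_id := by
        intro R _ _ g
        rw [show Algebra.TensorProduct.map (AlgHom.id K K) (AlgHom.id F R) =
          AlgHom.id K (K ⊗[F] R) from Algebra.TensorProduct.map_id]
        exact P.G.map_id _ g
      map_comp := by
        intro R S T _ _ _ _ _ _ f' f g
        rw [← P.G.map_comp, ← Algebra.TensorProduct.map_comp, AlgHom.comp_id] }
  θ := fun R _ _ => P.θ (K ⊗[F] R)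
  θ_θ := fun R _ _ g => P.θ_θ (K ⊗[F] R) g
  θ_map := fun f g => P.θ_map _ g

end SymPair

/-! ## Zariski closed sets of geometric points, and descendants -/

/-- A regular function on the base change of `G` to an algebraic closure of `K`, i.e. a morphism
from it to the affine line: a natural map `G(A) → A` for `A` ranging over the
algebras over the algebraic closure. -/
structure RegularFunction {K : Type u} [Field K] (G : GroupFunctor K) where
  eval : ∀ (A : Type u) [CommRing A] [Algebra K A] [Algebra (AlgebraicClosure K) A]
    [IsScalarTower K (AlgebraicClosure K) A], G.pts A → A
  eval_map : ∀ {A A' : Type u} [CommRing A] [Algebra K A] [Algebra (AlgebraicClosure K) A]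
    [IsScalarTower K (AlgebraicClosure K) A] [CommRing A'] [Algebra K A']
    [Algebra (AlgebraicClosure K) A'] [IsScalarTower K (AlgebraicClosure K) A']
    (f : A →ₐ[AlgebraicClosure K] A') (g : G.pts A),
    eval A' (G.map (f.restrictScalars K) g) = f (eval A g)

/-- Zariski closed sets of geometric points of `G`: the sets of common zeros of
families of regular functions. -/
def IsZariskiClosed {K : Type u} [Field K] (G : GroupFunctor K)
    (Z : Set (G.pts (AlgebraicClosure K))) : Prop :=
  ∃ T : Set (RegularFunction G), Z = {y | ∀ φ ∈ T, φ.eval (AlgebraicClosure K) y = 0}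

namespace SymPair

variable {K : Type u} [Field K]

/-- The geometric points of the double coset `H g H`, for `g ∈ G(K)`. -/
def doubleCoset (P : SymPair K) (g : P.G.pts K) : Set (P.G.pts (AlgebraicClosure K)) :=
  {y | ∃ h₁ ∈ P.H (AlgebraicClosure K), ∃ h₂ ∈ P.H (AlgebraicClosure K),
    y = h₁ * P.G.map (Algebra.ofId K (AlgebraicClosure K)) g * h₂}

/-- `D` is a descendant of `P = (G, H, θ)`: there is `g ∈ G(K)` such that `H g H` is closed and
`D = (G_x, H_x, θ|_{G_x})` with `x = s(g)`. -/
def IsDescendant (P D : SymPair K) : Prop :=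
  ∃ g : P.G.pts K, IsZariskiClosed P.G (P.doubleCoset g) ∧
    D = P.centralizer (P.s K g) (P.σ_s K g)

end SymPair

/-! ## The groups `GL(W)`, `O(W)`, `U(W_E)` -/

section GroupsOfForms

variable {K : Type u} [Field K] {W : Type u} [AddCommGroup W] [Module K W]

/-- Extension of scalars of an endomorphism of `R ⊗ W` along a homomorphism `R → S`: the `S`-linear
endomorphism of `S ⊗ W` that agrees with it on the image of `R ⊗ W`
(see `extendEnd_rTensor`). -/
noncomputable def extendEnd {R S : Type u} [CommRing R] [Algebra K R] [CommRing S] [Algebra K S]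
    (f : R →ₐ[K] S) (φ : Module.End R (R ⊗[K] W)) : Module.End S (S ⊗[K] W) :=
  LinearMap.liftBaseChange S
    ((f.toLinearMap.rTensor W) ∘ₗ (φ.restrictScalars K) ∘ₗ (TensorProduct.mk K R W 1))

theorem rTensor_smul {R S : Type u} [CommRing R] [Algebra K R] [CommRing S] [Algebra K S]
    (f : R →ₐ[K] S) (r : R) (z : R ⊗[K] W) :
    f.toLinearMap.rTensor W (r • z) = f r • f.toLinearMap.rTensor W z := by
  induction z with
  | zero => simp
  | tmul a w => simp [TensorProduct.smul_tmul']
  | add x y hx hy => simp only [smul_add, map_add, hx, hy]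

theorem extendEnd_tmul {R S : Type u} [CommRing R] [Algebra K R] [CommRing S] [Algebra K S]
    (f : R →ₐ[K] S) (φ : Module.End R (R ⊗[K] W)) (a : S) (w : W) :
    extendEnd f φ (a ⊗ₜ w) = a • f.toLinearMap.rTensor W (φ (1 ⊗ₜ w)) := by
  simp [extendEnd]

theorem extendEnd_rTensor {R S : Type u} [CommRing R] [Algebra K R] [CommRing S] [Algebra K S]
    (f : R →ₐ[K] S) (φ : Module.End R (R ⊗[K] W)) (z : R ⊗[K] W) :
    extendEnd f φ (f.toLinearMap.rTensor W z) = f.toLinearMap.rTensor W (φ z) := by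
  induction z with
  | zero => simp
  | add x y hx hy => simp only [map_add, hx, hy]
  | tmul a w =>
    have h : a ⊗ₜ[K] w = a • ((1 : R) ⊗ₜ[K] w) := by simp [TensorProduct.smul_tmul']
    rw [LinearMap.rTensor_tmul, extendEnd_tmul, h, map_smul, rTensor_smul]
    rfl

theorem end_ext {S : Type u} [CommRing S] [Algebra K S] {φ ψ : Module.End S (S ⊗[K] W)}
    (h : ∀ w : W, φ (1 ⊗ₜ w) = ψ (1 ⊗ₜ w)) : φ = ψ := by
  ext w
  exact h w

theorem extendEnd_one {R S : Type u} [CommRing R] [Algebra K R] [CommRing S] [Algebra K S]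
    (f : R →ₐ[K] S) : extendEnd (W := W) f 1 = 1 := by
  refine end_ext fun w => ?_
  simp [extendEnd_tmul]

theorem extendEnd_mul {R S : Type u} [CommRing R] [Algebra K R] [CommRing S] [Algebra K S]
    (f : R →ₐ[K] S) (φ ψ : Module.End R (R ⊗[K] W)) :
    extendEnd f (φ * ψ) = extendEnd f φ * extendEnd f ψ := by
  refine end_ext fun w => ?_
  simp [extendEnd_tmul, extendEnd_rTensor]

/-- Extension of scalars of automorphisms of `R ⊗ W` along a homomorphism `R → S`. -/
noncomputable def extendGL {R S : Type u} [CommRing R] [Algebra K R] [CommRing S] [Algebra K S]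
    (f : R →ₐ[K] S) : LinearMap.GeneralLinearGroup R (R ⊗[K] W) →*
      LinearMap.GeneralLinearGroup S (S ⊗[K] W) :=
  Units.map
    { toFun := extendEnd f
      map_one' := extendEnd_one f
      map_mul' := extendEnd_mul f }

theorem extendGL_rTensor {R S : Type u} [CommRing R] [Algebra K R] [CommRing S]
    [Algebra K S] (f : R →ₐ[K] S) (g : LinearMap.GeneralLinearGroup R (R ⊗[K] W))
    (z : R ⊗[K] W) :
    (extendGL f g).1 (f.toLinearMap.rTensor W z) = f.toLinearMap.rTensor W (g.1 z) :=
  extendEnd_rTensor f g.1 z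

theorem extendGL_id {R : Type u} [CommRing R] [Algebra K R]
    (g : LinearMap.GeneralLinearGroup R (R ⊗[K] W)) : extendGL (AlgHom.id K R) g = g := by
  refine Units.ext (end_ext fun w => ?_)
  change extendEnd _ _ _ = _
  simp [extendEnd_tmul]

theorem extendGL_comp {R S T : Type u} [CommRing R] [Algebra K R] [CommRing S] [Algebra K S]
    [CommRing T] [Algebra K T] (f' : S →ₐ[K] T) (f : R →ₐ[K] S)
    (g : LinearMap.GeneralLinearGroup R (R ⊗[K] W)) :
    extendGL (f'.comp f) g = extendGL f' (extendGL f g) := by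
  refine Units.ext (end_ext fun w => ?_)
  change extendEnd _ _ _ = extendEnd f' (extendEnd f _) _
  simp only [extendEnd_tmul, one_smul]
  rw [show (f'.comp f).toLinearMap = f'.toLinearMap ∘ₗ f.toLinearMap from rfl,
    LinearMap.rTensor_comp]
  rfl

theorem gl_apply_inv_apply {R M : Type u} [CommRing R] [AddCommGroup M] [Module R M]
    (g : LinearMap.GeneralLinearGroup R M) (x : M) : g.1 ((g⁻¹).1 x) = x := by
  rw [← Module.End.mul_apply, Units.mul_inv, Module.End.one_apply]

theorem gl_inv_apply_apply {R M : Type u} [CommRing R] [AddCommGroup M] [Module R M]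
    (g : LinearMap.GeneralLinearGroup R M) (x : M) : (g⁻¹).1 (g.1 x) = x := by
  rw [← Module.End.mul_apply, Units.inv_mul, Module.End.one_apply]

variable (K W) in
/-- The algebraic group `GL(W)`: its `R`-points are the `R`-linear automorphisms
of `R ⊗ W`. -/
noncomputable def generalLinearGroup : GroupFunctor K where
  pts := fun R _ _ => LinearMap.GeneralLinearGroup R (R ⊗[K] W)
  grp := fun _ _ _ => inferInstance
  map := fun f => extendGL f
  map_id := fun _ _ _ g => extendGL_id g
  map_comp := fun f' f g => extendGL_comp f' f g

theorem baseChange_rTensor (B : LinearMap.BilinForm K W) {R S : Type u} [CommRing R] [Algebra K R]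
    [CommRing S] [Algebra K S] (f : R →ₐ[K] S) (x y : R ⊗[K] W) :
    B.baseChange S (f.toLinearMap.rTensor W x) (f.toLinearMap.rTensor W y) =
      f (B.baseChange R x y) := by
  induction x with
  | zero => simp
  | add x x' hx hx' => simp only [map_add, LinearMap.add_apply, hx, hx']
  | tmul a w =>
    induction y with
    | zero => simp
    | add y y' hy hy' => simp only [map_add, hy, hy']
    | tmul b w' => simp

theorem baseChange_comm (B : LinearMap.BilinForm K W) (hs : B.IsSymm) (R : Type u) [CommRing R]
    [Algebra K R] (x y : R ⊗[K] W) : B.baseChange R x y = B.baseChange R y x := by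
  induction x with
  | zero => simp
  | add x x' hx hx' => simp only [map_add, LinearMap.add_apply, hx, hx']
  | tmul a w =>
    induction y with
    | zero => simp
    | add y y' hy hy' => simp only [map_add, LinearMap.add_apply, hy, hy']
    | tmul b w' => simp [hs.eq w w', mul_comm]

/-- A relation `B(g' x, g y) = B(x, y)` is preserved by extension of scalars. -/
theorem extendGL_preserves (B : LinearMap.BilinForm K W) {R S : Type u} [CommRing R]
    [Algebra K R] [CommRing S] [Algebra K S] (f : R →ₐ[K] S)
    (g' g : LinearMap.GeneralLinearGroup R (R ⊗[K] W))
    (h : ∀ x y, B.baseChange R (g'.1 x) (g.1 y) = B.baseChange R x y) (x y : S ⊗[K] W) :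
    B.baseChange S ((extendGL f g').1 x) ((extendGL f g).1 y) = B.baseChange S x y := by
  have key : (B.baseChange S).comp (extendGL f g').1 (extendGL f g).1 = B.baseChange S := by
    ext w w'
    have h1 : ∀ w : W, (1 : S) ⊗ₜ[K] w = f.toLinearMap.rTensor W (1 ⊗ₜ w) := by
      intro w; simp
    change B.baseChange S ((extendGL f g').1 (1 ⊗ₜ w)) ((extendGL f g).1 (1 ⊗ₜ w')) =
      B.baseChange S (1 ⊗ₜ w) (1 ⊗ₜ w')
    rw [h1, h1, extendGL_rTensor, extendGL_rTensor, baseChange_rTensor, baseChange_rTensor, h]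
  exact LinearMap.congr_fun₂ key x y

/-- The `R`-points of `O(W)`, for a space `W` with a bilinear form `B`: the `R`-linear
automorphisms of `R ⊗ W` that preserve the `R`-bilinear extension of `B`. -/
def orthogonalPoints (B : LinearMap.BilinForm K W) (R : Type u) [CommRing R] [Algebra K R] :
    Subgroup (LinearMap.GeneralLinearGroup R (R ⊗[K] W)) where
  carrier := {g | ∀ x y, B.baseChange R (g.1 x) (g.1 y) = B.baseChange R x y}
  mul_mem' := by
    intro a b ha hb x y
    exact (ha _ _).trans (hb x y)
  one_mem' := fun x y => rfl
  inv_mem' := by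
    intro a ha x y
    have h := ha ((a⁻¹).1 x) ((a⁻¹).1 y)
    rw [gl_apply_inv_apply, gl_apply_inv_apply] at h
    exact h.symm

/-- The algebraic group `O(W)` of a space `W` with a bilinear form `B`. -/
noncomputable def orthogonalGroup (B : LinearMap.BilinForm K W) : GroupFunctor K where
  pts := fun R _ _ => orthogonalPoints B R
  grp := fun _ _ _ => inferInstance
  map := fun f => ((extendGL f).comp (Subgroup.subtype _)).codRestrict _
    fun g => extendGL_preserves B f g.1 g.1 g.2
  map_id := fun _ _ _ g => Subtype.ext (extendGL_id g.1)
  map_comp := fun f' f g => Subtype.ext (extendGL_comp f' f g.1)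

/-! ### The pair `(GL(W), O(W))` -/

variable [FiniteDimensional K W]

/-- The isomorphism of `R ⊗ W` with its dual given by the `R`-bilinear extension of a
non-degenerate form `B`. -/
noncomputable def dualEquiv (B : LinearMap.BilinForm K W) (hB : B.Nondegenerate)
    (R : Type u) [CommRing R] [Algebra K R] :
    (R ⊗[K] W) ≃ₗ[R] Module.Dual R (R ⊗[K] W) :=
  (LinearEquiv.baseChange K R _ _ (B.toDual hB)) ≪≫ₗ
    (TensorProduct.isBaseChange K W R).toDualBaseChange

theorem dualEquiv_apply (B : LinearMap.BilinForm K W) (hB : B.Nondegenerate)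
    (R : Type u) [CommRing R] [Algebra K R] (x y : R ⊗[K] W) :
    dualEquiv B hB R x y = B.baseChange R x y := by
  have h : (dualEquiv B hB R).toLinearMap = B.baseChange R := by
    ext w w'
    change (TensorProduct.isBaseChange K W R).toDualBaseChange
      ((1 : R) ⊗ₜ[K] (B.toDual hB w)) (TensorProduct.mk K R W 1 w') = _
    rw [IsBaseChange.toDualBaseChange_tmul]
    simp [LinearMap.BilinForm.toDual_def, Algebra.algebraMap_eq_smul_one]
  exact LinearMap.congr_fun₂ h x y

/-- The inverse transpose of `g` with respect to `B`, characterized by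
`B(invTranspose g x, g y) = B(x, y)`: see `invTranspose_spec` and `invTranspose_unique`. -/
noncomputable def invTranspose (B : LinearMap.BilinForm K W) (hB : B.Nondegenerate)
    (R : Type u) [CommRing R] [Algebra K R] :
    LinearMap.GeneralLinearGroup R (R ⊗[K] W) →* LinearMap.GeneralLinearGroup R (R ⊗[K] W) where
  toFun g :=
    { val := (dualEquiv B hB R).symm.toLinearMap ∘ₗ (g⁻¹).1.dualMap ∘ₗ
        (dualEquiv B hB R).toLinearMap
      inv := (dualEquiv B hB R).symm.toLinearMap ∘ₗ g.1.dualMap ∘ₗ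
        (dualEquiv B hB R).toLinearMap
      val_inv := by
        refine LinearMap.ext fun x => (dualEquiv B hB R).injective (LinearMap.ext fun y => ?_)
        simp [Module.End.mul_apply, -Units.val_inv_eq_inv_val, gl_apply_inv_apply]
      inv_val := by
        refine LinearMap.ext fun x => (dualEquiv B hB R).injective (LinearMap.ext fun y => ?_)
        simp [Module.End.mul_apply, gl_inv_apply_apply] }
  map_one' := by
    refine Units.ext (LinearMap.ext fun x =>
      (dualEquiv B hB R).injective (LinearMap.ext fun y => ?_))
    simp
  map_mul' := by
    intro a b
    refine Units.ext (LinearMap.ext fun x =>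
      (dualEquiv B hB R).injective (LinearMap.ext fun y => ?_))
    simp

theorem invTranspose_spec (B : LinearMap.BilinForm K W) (hB : B.Nondegenerate)
    (R : Type u) [CommRing R] [Algebra K R] (g : LinearMap.GeneralLinearGroup R (R ⊗[K] W))
    (x y : R ⊗[K] W) :
    B.baseChange R ((invTranspose B hB R g).1 x) (g.1 y) = B.baseChange R x y := by
  rw [← dualEquiv_apply B hB, ← dualEquiv_apply B hB]
  change dualEquiv B hB R ((dualEquiv B hB R).symm ((g⁻¹).1.dualMap (dualEquiv B hB R x)))
    (g.1 y) = _
  rw [LinearEquiv.apply_symm_apply, LinearMap.dualMap_apply, gl_inv_apply_apply]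

theorem invTranspose_unique (B : LinearMap.BilinForm K W) (hB : B.Nondegenerate)
    (R : Type u) [CommRing R] [Algebra K R] (g g' : LinearMap.GeneralLinearGroup R (R ⊗[K] W))
    (h : ∀ x y, B.baseChange R (g'.1 x) (g.1 y) = B.baseChange R x y) :
    invTranspose B hB R g = g' := by
  refine Units.ext (LinearMap.ext fun x =>
    (dualEquiv B hB R).injective (LinearMap.ext fun y => ?_))
  obtain ⟨z, rfl⟩ : ∃ z, g.1 z = y := ⟨(g⁻¹).1 y, gl_apply_inv_apply g y⟩
  rw [dualEquiv_apply, dualEquiv_apply, invTranspose_spec, h]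

theorem invTranspose_invTranspose (B : LinearMap.BilinForm K W) (hs : B.IsSymm)
    (hB : B.Nondegenerate) (R : Type u) [CommRing R] [Algebra K R]
    (g : LinearMap.GeneralLinearGroup R (R ⊗[K] W)) :
    invTranspose B hB R (invTranspose B hB R g) = g := by
  apply invTranspose_unique
  intro x y
  rw [baseChange_comm B hs, invTranspose_spec, baseChange_comm B hs]

/-- The symmetric pair `(GL(W), O(W))` of a quadratic space `(W, B)`: the involution is
the inverse transpose with respect to `B`. -/
noncomputable def pairGLO (B : LinearMap.BilinForm K W) (hs : B.IsSymm) (hB : B.Nondegenerate) :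
    SymPair K where
  G := generalLinearGroup K W
  θ := fun R _ _ => invTranspose B hB R
  θ_θ := fun R _ _ g => invTranspose_invTranspose B hs hB R g
  θ_map := by
    intro R S _ _ _ _ f g
    apply invTranspose_unique
    exact extendGL_preserves B f _ _ (invTranspose_spec B hB R g)

/-- The fixed points of the involution of `pairGLO` are the points of `O(W)`. -/
theorem mem_pairGLO_H (B : LinearMap.BilinForm K W) (hs : B.IsSymm) (hB : B.Nondegenerate)
    (R : Type u) [CommRing R] [Algebra K R] (g : LinearMap.GeneralLinearGroup R (R ⊗[K] W)) :
    (show (pairGLO B hs hB).G.pts R from g) ∈ (pairGLO B hs hB).H R ↔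
      g ∈ orthogonalPoints B R := by
  constructor
  · intro h x y
    have h' : invTranspose B hB R g = g := h
    conv_lhs => rw [← h']
    conv_lhs => enter [2]; rw [h']
    exact invTranspose_spec B hB R g x y
  · intro h
    exact invTranspose_unique B hB R g g h

end GroupsOfForms

/-! ### The pair `(U(W_E), O(W))` -/

section Unitary

variable {K : Type u} [Field K] {E : Type u} [Field E] [Algebra K E]

/-- The automorphism `τ ⊗ id` of `E ⊗ R`. -/
noncomputable def conjHom (τ : E ≃ₐ[K] E) (R : Type u) [CommRing R] [Algebra K R] :
    (E ⊗[K] R) →ₐ[K] (E ⊗[K] R) :=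
  Algebra.TensorProduct.map (τ : E →ₐ[K] E) (AlgHom.id K R)

variable {W : Type u} [AddCommGroup W] [Module K W]

/-- The hermitian extension of `B` to `(E ⊗ R) ⊗ W = W_E ⊗ R`: it is additive in both variables
and sends `(a ⊗ v, b ⊗ w)` to `a · τ(b) · B(v, w)`. -/
noncomputable def hermExt (B : LinearMap.BilinForm K W) (τ : E ≃ₐ[K] E)
    (R : Type u) [CommRing R] [Algebra K R] (x y : (E ⊗[K] R) ⊗[K] W) : E ⊗[K] R :=
  B.baseChange (E ⊗[K] R) x ((conjHom τ R).toLinearMap.rTensor W y)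

theorem hermExt_tmul (B : LinearMap.BilinForm K W) (τ : E ≃ₐ[K] E)
    (R : Type u) [CommRing R] [Algebra K R] (a b : E ⊗[K] R) (v w : W) :
    hermExt B τ R (a ⊗ₜ v) (b ⊗ₜ w) = B v w • (a * conjHom τ R b) := by
  simp [hermExt]

/-- The `R`-points of `U(W_E)`, for a space `W` over `K` with a bilinear form `B` and a quadratic
extension `E / K` with non-trivial automorphism `τ`: the `E ⊗ R`-linear automorphisms of
`(E ⊗ R) ⊗ W = W_E ⊗ R` that preserve the hermitian extension of `B`. -/
def unitaryPoints (B : LinearMap.BilinForm K W) (τ : E ≃ₐ[K] E) (R : Type u) [CommRing R]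
    [Algebra K R] : Subgroup (LinearMap.GeneralLinearGroup (E ⊗[K] R) ((E ⊗[K] R) ⊗[K] W)) where
  carrier := {g | ∀ x y, hermExt B τ R (g.1 x) (g.1 y) = hermExt B τ R x y}
  mul_mem' := by
    intro a b ha hb x y
    exact (ha _ _).trans (hb x y)
  one_mem' := fun x y => rfl
  inv_mem' := by
    intro a ha x y
    have h := ha ((a⁻¹).1 x) ((a⁻¹).1 y)
    rw [gl_apply_inv_apply, gl_apply_inv_apply] at h
    exact h.symm

/-- Unitarity is preserved by extension of scalars along any homomorphism that commutes with the
conjugations. -/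
theorem extendGL_mem_unitaryPoints (B : LinearMap.BilinForm K W) (τ : E ≃ₐ[K] E)
    {R S : Type u} [CommRing R] [Algebra K R] [CommRing S] [Algebra K S]
    (F : (E ⊗[K] R) →ₐ[K] (E ⊗[K] S)) (hF : (conjHom τ S).comp F = F.comp (conjHom τ R))
    {g : LinearMap.GeneralLinearGroup (E ⊗[K] R) ((E ⊗[K] R) ⊗[K] W)}
    (hg : g ∈ unitaryPoints B τ R) : extendGL F g ∈ unitaryPoints B τ S := by
  have hc : ∀ z : (E ⊗[K] R) ⊗[K] W, (conjHom τ S).toLinearMap.rTensor W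
      (F.toLinearMap.rTensor W z) =
      F.toLinearMap.rTensor W ((conjHom τ R).toLinearMap.rTensor W z) := by
    intro z
    have := congrArg AlgHom.toLinearMap hF
    rw [← LinearMap.comp_apply, ← LinearMap.comp_apply, ← LinearMap.rTensor_comp,
      ← LinearMap.rTensor_comp]
    exact congrArg (fun l => LinearMap.rTensor W l z) this
  have hh : ∀ z z' : (E ⊗[K] R) ⊗[K] W, hermExt B τ S (F.toLinearMap.rTensor W z)
      (F.toLinearMap.rTensor W z') = F (hermExt B τ R z z') := by
    intro z z'
    unfold hermExt
    rw [hc, baseChange_rTensor]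
  have h1 : ∀ w : W, (1 : E ⊗[K] S) ⊗ₜ[K] w = F.toLinearMap.rTensor W (1 ⊗ₜ w) := by
    intro w; simp
  have h2 : ∀ (a : E ⊗[K] S) (w : W), a ⊗ₜ[K] w = a • ((1 : E ⊗[K] S) ⊗ₜ[K] w) := by
    intro a w; simp [TensorProduct.smul_tmul']
  have hadd : ∀ x y y', hermExt B τ S x (y + y') = hermExt B τ S x y + hermExt B τ S x y' := by
    intro x y y'; simp [hermExt]
  have hadd' : ∀ x x' y, hermExt B τ S (x + x') y = hermExt B τ S x y + hermExt B τ S x' y := by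
    intro x x' y; simp [hermExt]
  have hsmul : ∀ a b x y, hermExt B τ S (a • x) (b • y) =
      a * (conjHom τ S b * hermExt B τ S x y) := by
    intro a b x y
    unfold hermExt
    rw [rTensor_smul]
    simp only [map_smul, LinearMap.smul_apply, smul_eq_mul]
    exact mul_left_comm _ _ _
  intro x y
  induction x with
  | zero => simp [hermExt]
  | add x x' hx hx' => rw [map_add, hadd', hadd', hx, hx']
  | tmul a v =>
    induction y with
    | zero => simp [hermExt]
    | add y y' hy hy' => rw [map_add, hadd, hadd, hy, hy']
    | tmul b w =>
      rw [h2 a, h2 b, map_smul, map_smul, hsmul, hsmul, h1, h1, extendGL_rTensor,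
        extendGL_rTensor, hh, hh, hg]

/-- The algebraic group `U(W_E)` over `K`. -/
noncomputable def unitaryGroup (B : LinearMap.BilinForm K W) (τ : E ≃ₐ[K] E) : GroupFunctor K where
  pts := fun R _ _ => unitaryPoints B τ R
  grp := fun _ _ _ => inferInstance
  map := fun f => ((extendGL (Algebra.TensorProduct.map (AlgHom.id K E) f)).comp
    (Subgroup.subtype _)).codRestrict _ fun g => extendGL_mem_unitaryPoints B τ _
      (by ext <;> simp [conjHom]) g.2
  map_id := by
    intro R _ _ g
    refine Subtype.ext ?_
    change extendGL (Algebra.TensorProduct.map (AlgHom.id K E) (AlgHom.id K R)) g.1 = g.1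
    rw [Algebra.TensorProduct.map_id]
    exact extendGL_id g.1
  map_comp := by
    intro R S T _ _ _ _ _ _ f' f g
    refine Subtype.ext ?_
    change extendGL (Algebra.TensorProduct.map (AlgHom.id K E) (f'.comp f)) g.1
      = extendGL _ (extendGL _ g.1)
    rw [← extendGL_comp, ← Algebra.TensorProduct.map_comp, AlgHom.comp_id]

/-- The symmetric pair `(U(W_E), O(W))`: the involution sends `g` to its conjugate by the
semilinear automorphism `τ ⊗ id` of `W_E`, so that the fixed points are the automorphisms that
come from `O(W)`. -/
noncomputable def pairUO (B : LinearMap.BilinForm K W) (τ : E ≃ₐ[K] E) (hτ : ∀ a, τ (τ a) = a) :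
    SymPair K where
  G := unitaryGroup B τ
  θ := fun R _ _ => ((extendGL (conjHom τ R)).comp (Subgroup.subtype _)).codRestrict _
    fun g => extendGL_mem_unitaryPoints B τ _ rfl g.2
  θ_θ := by
    intro R _ _ g
    refine Subtype.ext ?_
    change extendGL _ (extendGL _ g.1) = g.1
    rw [← extendGL_comp]
    have : (conjHom τ R).comp (conjHom τ R) = AlgHom.id K (E ⊗[K] R) := by
      ext <;> simp [conjHom, hτ]
    rw [this]
    exact extendGL_id g.1
  θ_map := by
    intro R S _ _ _ _ f g
    refine Subtype.ext ?_
    change extendGL _ (extendGL _ g.1) = extendGL _ (extendGL _ g.1)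
    rw [← extendGL_comp, ← extendGL_comp]
    congr 2
    ext <;> simp [conjHom]

/-- The involution of `pairUO` is conjugation by the semilinear automorphism `τ ⊗ id`. -/
theorem pairUO_θ_apply (B : LinearMap.BilinForm K W) (τ : E ≃ₐ[K] E) (hτ : ∀ a, τ (τ a) = a)
    (R : Type u) [CommRing R] [Algebra K R] (g : unitaryPoints B τ R)
    (z : (E ⊗[K] R) ⊗[K] W) :
    ((pairUO B τ hτ).θ R g : unitaryPoints B τ R).1.1 ((conjHom τ R).toLinearMap.rTensor W z) =
      (conjHom τ R).toLinearMap.rTensor W (g.1.1 z) :=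
  extendGL_rTensor (conjHom τ R) g.1 z

end Unitary

/-! ## The three types of pairs -/

/-- The pairs over `F` of the three types `(GL(W), O(W))`, `(U(W_E), O(W))`, `(O(W), O(W)_ε)`. The
first two are regarded over `F` by restriction of scalars. -/
inductive IsFactor (F : Type u) [Field F] : SymPair F → Prop
  | glO (F' : Type u) [Field F'] [Algebra F F'] [FiniteDimensional F F']
      (W : Type u) [AddCommGroup W] [Module F' W] [FiniteDimensional F' W]
      (B : LinearMap.BilinForm F' W) (hs : B.IsSymm) (hB : B.Nondegenerate) :
      IsFactor F ((pairGLO B hs hB).res F)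
  | uO (F' : Type u) [Field F'] [Algebra F F'] [FiniteDimensional F F']
      (E : Type u) [Field E] [Algebra F' E] (hE : Module.finrank F' E = 2)
      (τ : E ≃ₐ[F'] E) (hτ1 : τ ≠ AlgEquiv.refl) (hτ2 : ∀ a, τ (τ a) = a)
      (W : Type u) [AddCommGroup W] [Module F' W] [FiniteDimensional F' W]
      (B : LinearMap.BilinForm F' W) (hs : B.IsSymm) (hB : B.Nondegenerate) :
      IsFactor F ((pairUO B τ hτ2).res F)
  | oO (W : Type u) [AddCommGroup W] [Module F W] [FiniteDimensional F W]
      (B : LinearMap.BilinForm F W) (hs : B.IsSymm) (hB : B.Nondegenerate)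
      (ε : (orthogonalGroup B).pts F) (hε : orderOf ε = 2) :
      IsFactor F (SymPair.ofElement (orthogonalGroup B) ε hε)

/-! Write `x = g ε g⁻¹ ε` for the symmetrization of `g`; it lies in `O(V)` and `ε x ε = x⁻¹`. The
proof combines two facts: a closed double coset forces `x` to be semisimple, and the centralizer of
a semisimple such `x` splits into blocks of the three types.

Semisimplicity (`exists_degeneration`, `isSemisimple_s_of_isZariskiClosed`). Over the algebraic
closure the Jordan decomposition of `x` can be written `x = s y²` with `s` semisimple and `y = (1 +
M)/(1 - M)`, where `M` is nilpotent, skew-adjoint, commutes with `s`, and `ε M ε = -M`. Put `a = y⁻¹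
g`, so that `a ε a⁻¹ ε = s`. The curve `y_c a` with `y_c = (1 + c M)/(1 - c M)` joins `a` (at `c =
0`) to `g` (at `c = 1`). For `c ≠ 0` some isometry `h` commutes with `ε` and `s` and satisfies `h M
h⁻¹ = c M`; then `y_c a = h g (a⁻¹ h⁻¹ a)` lies in `H g H`. If `H g H` is closed it contains `a`,
and then `x` is conjugate to `s`. The isometry comes from `Module.End.exists_isometry_conj_eq_smul`:
there is `D` with `[D, M] = M` commuting with `s` and `ε`, a polynomial `P` in `D` rescales `M` by
`c`, and a polar decomposition `P = h S` makes it isometric.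

Splitting (`InvolutionDatum.exists_iso_prod`). The operator `T = x + x⁻¹` is self-adjoint, commutes
with `ε` and `x`, and is semisimple. Hence `V` is the orthogonal sum of the kernels of the
irreducible factors of its minimal polynomial, and the pair is the corresponding product. On one
block `T` generates a field `K`, and `B` is the trace of a `K`-bilinear form; let `t` be the element
of `K` by which `T` acts. If `t = ±2` then `x = ±1` and the centralizer is the full orthogonal
group. Otherwise `ξ = x - x⁻¹` has the same centralizer over `K`, anticommutes with `ε`, and `ξ² =
d` with `d = t² - 4 ≠ 0`. If `d` is a square, the two eigenspaces of `ξ` are isotropic and exchanged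
by `ε`, which gives `GL(W)` with the inverse transpose (`SymPair.Iso.toGL`). If not, `V` is `K(√d) ⊗
V^ε` with a hermitian form, which gives the unitary group (`SymPair.Iso.toUnitaryOfSq`).

Both `x` and `ξ` have their `ε`-conjugate as adjoint. `InvolutionDatum` retains just this property,
so that one pair `centralizerPair`, depending only on the algebra generated by the endomorphism and
its adjoint, serves throughout. -/

/-! ### Linear algebra: square roots, commutators and Jordan decompositions. -/

open Polynomial in
theorem Polynomial.dvd_prod_X_sub_C_roots_pow {k : Type*} [Field k] [IsAlgClosed k] [DecidableEq k]
    {m : k[X]} (hm : m ≠ 0) : m ∣ (∏ μ ∈ m.roots.toFinset, (X - C μ)) ^ m.natDegree := by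
  have hs := IsAlgClosed.splits m
  -- Each root, counted with multiplicity, uses up one factor of the power, so the total number of
  -- roots is a sufficient exponent.
  have key : ∀ s : Multiset k, s ≤ m.roots →
      (s.map fun a => X - C a).prod ∣ (∏ μ ∈ m.roots.toFinset, (X - C μ)) ^ s.card := by
    intro s
    induction s using Multiset.induction with
    | empty => simp
    | cons a s ih =>
      intro h
      rw [Multiset.map_cons, Multiset.prod_cons, Multiset.card_cons, pow_succ, mul_comm]
      refine mul_dvd_mul (ih ((Multiset.le_cons_self s a).trans h)) ?_
      exact Finset.dvd_prod_of_mem _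
        (Multiset.mem_toFinset.2 (Multiset.mem_of_le h (Multiset.mem_cons_self a s)))
  have h1 := key m.roots le_rfl
  rw [← hs.natDegree_eq_card_roots] at h1
  conv_lhs => rw [hs.eq_prod_roots]
  exact (associated_unit_mul_left _ _ (isUnit_C.2 (isUnit_iff_ne_zero.2
    (leadingCoeff_ne_zero.2 hm)))).dvd.trans h1

section AlgClosed

variable {k : Type*} [Field k] {U : Type*} [AddCommGroup U] [Module k U] [FiniteDimensional k U]

open Polynomial in
/-- An invertible endomorphism over an algebraically closed field of characteristic `≠ 2` has a
square root that is a polynomial in it. -/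
theorem Module.End.exists_sqrt [IsAlgClosed k] [CharZero k] (T : Module.End k U) (hT : IsUnit T) :
    ∃ S ∈ Algebra.adjoin k {T}, S * S = T := by
  classical
  set m := minpoly k T with hm
  have hm0 : m ≠ 0 := minpoly.ne_zero (Algebra.IsIntegral.isIntegral T)
  have h0 : ∀ μ ∈ m.roots.toFinset, μ ≠ 0 := by
    rintro μ hμ rfl
    rw [Multiset.mem_toFinset] at hμ
    have h1 := isRoot_of_mem_roots hμ
    have h2 := Module.End.hasEigenvalue_of_isRoot h1
    obtain ⟨v, hv⟩ := h2.exists_hasEigenvector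
    have h3 := hv.apply_eq_smul
    rw [zero_smul] at h3
    exact hv.2 ((Module.End.isUnit_iff T).1 hT |>.1 (h3.trans (map_zero T).symm))
  choose f hf using fun μ : k => IsAlgClosed.exists_pow_nat_eq μ (n := 2) two_pos
  -- `r(μ)² = μ` at every eigenvalue, so `r(T)² - T` is nilpotent and `r(T)` is a square root of `T`
  -- to first approximation.
  set r := Lagrange.interpolate m.roots.toFinset id f with hr
  have hrμ : ∀ μ ∈ m.roots.toFinset, r.eval μ = f μ := fun μ hμ =>
    Lagrange.eval_interpolate_at_node f (fun a _ b _ h => h) hμ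
  set A := Algebra.adjoin k {T}
  let τ : A := ⟨T, Algebra.self_mem_adjoin_singleton k T⟩
  have haev : ∀ p : k[X], ((aeval τ p : A) : Module.End k U) = aeval T p := fun p => by
    rw [← Subalgebra.coe_val, ← aeval_algHom_apply]; rfl
  have hnil : IsNilpotent (aeval τ (r ^ 2 - X)) := by
    refine ⟨m.natDegree, Subtype.ext ?_⟩
    rw [← map_pow, haev]
    have h1 : m ∣ (r ^ 2 - X) ^ m.natDegree := by
      refine (Polynomial.dvd_prod_X_sub_C_roots_pow hm0).trans (pow_dvd_pow_of_dvd ?_ _)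
      refine Finset.prod_dvd_of_coprime ?_ ?_
      · intro a _ b _ hab
        exact isCoprime_X_sub_C_of_isUnit_sub (isUnit_iff_ne_zero.2 (sub_ne_zero.2 hab))
      · intro μ hμ
        rw [dvd_iff_isRoot, IsRoot, eval_sub, eval_pow, hrμ μ hμ, hf, eval_X, sub_self]
    obtain ⟨q, hq⟩ := h1
    rw [hq, map_mul, minpoly.aeval, zero_mul]
    rfl
  have hunit : IsUnit (aeval τ r) := by
    have hco : IsCoprime r m := by
      rw [Polynomial.isCoprime_iff_aeval_ne_zero_of_isAlgClosed k k]
      intro a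
      by_contra! h
      have ha : a ∈ m.roots.toFinset := by
        rw [Multiset.mem_toFinset, mem_roots hm0]; simpa using h.2
      have h1 := hrμ a ha
      have h2 := h.1
      rw [coe_aeval_eq_eval] at h2
      rw [h2] at h1
      have h3 := hf a
      rw [← h1] at h3
      exact h0 a ha (by rw [← h3]; simp)
    obtain ⟨a, b, hab⟩ := hco
    have h := congrArg (aeval τ) hab
    rw [map_add, map_mul, map_mul, map_one] at h
    have hm' : aeval τ m = 0 := Subtype.ext (by rw [haev, minpoly.aeval]; rfl)
    rw [hm', mul_zero, add_zero] at h
    exact IsUnit.of_mul_eq_one_right _ h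
  -- Newton's method for `X² - T`, in the commutative algebra generated by `T`: the derivative `2
  -- r(T)` at the approximate root is a unit.
  obtain ⟨s, ⟨-, hs⟩, -⟩ := Polynomial.existsUnique_nilpotent_sub_and_aeval_eq_zero
    (P := (X ^ 2 - C τ : A[X])) (x := aeval τ r)
    (by simpa using hnil)
    (by
      simp only [derivative_sub, derivative_X_pow, derivative_C, sub_zero]
      simp only [map_mul, map_pow, aeval_X, Nat.cast_ofNat, map_ofNat]
      have h2 : IsUnit (2 : A) := by
        refine IsUnit.of_mul_eq_one (algebraMap k A 2⁻¹) ?_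
        rw [← map_ofNat (algebraMap k A) 2, ← map_mul, mul_inv_cancel₀ two_ne_zero, map_one]
      exact (by simpa using h2.mul hunit))
  refine ⟨s, s.2, ?_⟩
  have := congrArg (Subtype.val) hs
  simp only [map_sub, aeval_X_pow, aeval_C, Algebra.algebraMap_self, RingHom.id_apply] at this
  rw [pow_two] at this
  exact sub_eq_zero.1 this

/-- Nondegeneracy of the trace form: for the rank-one map `D = l(·) v` the trace of `Z D` is `l (Z
v)`. -/
theorem Module.End.eq_zero_of_trace_mul_eq_zero {Z : Module.End k U}
    (h : ∀ D, LinearMap.trace k U (Z * D) = 0) : Z = 0 := by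
  ext v
  refine (Module.forall_dual_apply_eq_zero_iff k (Z v)).1 fun l => ?_
  rw [← LinearMap.trace_smulRight]
  exact h (l.smulRight v) ▸ congrArg _ (by ext w; simp)

/-- A nilpotent endomorphism `N` lies in the image of its adjoint action. -/
theorem Module.End.exists_commutator_eq_of_isNilpotent {N : Module.End k U} (hN : IsNilpotent N) :
    ∃ D : Module.End k U, D * N - N * D = N := by
  by_contra! hne
  let ad : Module.End k U →ₗ[k] Module.End k U :=
    LinearMap.mulRight k N - LinearMap.mulLeft k N
  have hN' : N ∉ LinearMap.range ad := by
    rintro ⟨D, hD⟩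
    exact hne D (by simpa [ad] using hD)
  -- A functional separating `N` from the range of `ad` has the form `D ↦ tr(Z D)`. Its vanishing on
  -- commutators says that `Z` commutes with `N`, so `Z N` is nilpotent and has trace zero, a
  -- contradiction.
  obtain ⟨f, hfN, hf⟩ := Submodule.exists_dual_map_eq_bot_of_notMem hN' inferInstance
  have hf' : ∀ D, f (D * N - N * D) = 0 := by
    intro D
    have : f (ad D) ∈ (LinearMap.range ad).map f := ⟨_, ⟨D, rfl⟩, rfl⟩
    rw [hf] at this
    simpa [ad] using this
  obtain ⟨Z, hZ⟩ : ∃ Z : Module.End k U, ∀ D, f D = LinearMap.trace k U (Z * D) := by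
    let tr : Module.End k U →ₗ[k] Module.Dual k (Module.End k U) :=
      (LinearMap.mul k (Module.End k U)).compr₂ (LinearMap.trace k U)
    have hinj : Function.Injective tr := by
      rw [← LinearMap.ker_eq_bot, LinearMap.ker_eq_bot']
      exact fun Z hZ => Module.End.eq_zero_of_trace_mul_eq_zero fun D => LinearMap.congr_fun hZ D
    have hsurj : Function.Surjective tr :=
      (LinearMap.injective_iff_surjective_of_finrank_eq_finrank
        (Subspace.dual_finrank_eq).symm).1 hinj
    obtain ⟨Z, hZ⟩ := hsurj f
    exact ⟨Z, fun D => by rw [← hZ]; rfl⟩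
  have hcomm : Commute N Z := by
    refine sub_eq_zero.1 (Module.End.eq_zero_of_trace_mul_eq_zero fun D => ?_)
    have := hf' D
    rw [map_sub, hZ, hZ, ← mul_assoc, LinearMap.trace_mul_comm] at this
    rw [sub_mul, map_sub, mul_assoc, mul_assoc Z]
    exact this
  apply hfN
  rw [hZ]
  exact (LinearMap.isNilpotent_trace_of_isNilpotent (hcomm.symm.isNilpotent_mul_left hN)).eq_zero

/-- For a nilpotent `N` and a semisimple `s` commuting with it, there is `D` commuting with `s`
such that `[D, N] = N`. -/
theorem Module.End.exists_commutator_eq_of_commute [PerfectField k] {N s : Module.End k U}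
    (hN : IsNilpotent N) (hs : s.IsSemisimple) (hc : Commute s N) :
    ∃ D : Module.End k U, D * N - N * D = N ∧ Commute s D := by
  obtain ⟨D, hD⟩ := Module.End.exists_commutator_eq_of_isNilpotent hN
  -- `L - R` is the commutator with `s`. It is semisimple, being a difference of commuting
  -- semisimple maps, so its kernel and its range are complementary; the kernel component of `D`
  -- turns out to be the required element.
  let L : Module.End k (Module.End k U) := LinearMap.mulLeft k s
  let R : Module.End k (Module.End k U) := LinearMap.mulRight k s
  have hL : L.IsSemisimple := by
    refine Module.End.isSemisimple_of_squarefree_aeval_eq_zero hs.minpoly_squarefree ?_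
    have : Polynomial.aeval (Algebra.lmul k (Module.End k U) s) (minpoly k s) = 0 := by
      rw [Polynomial.aeval_algHom_apply, minpoly.aeval, map_zero]
    exact this
  have hR : R.IsSemisimple := by
    refine Module.End.isSemisimple_of_squarefree_aeval_eq_zero hs.minpoly_squarefree ?_
    have : ∀ p : Polynomial k, Polynomial.aeval R p =
        LinearMap.mulRight k (Polynomial.aeval s p) := by
      intro p
      induction p using Polynomial.induction_on' with
      | add p q hp hq => ext1 X; simp [hp, hq, mul_add]
      | monomial n a =>
        ext1 X
        simp only [Polynomial.aeval_monomial, LinearMap.mulRight_apply]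
        rw [Module.End.mul_apply]
        simp only [R, LinearMap.pow_mulRight, LinearMap.mulRight_apply,
          Module.algebraMap_end_apply, Algebra.algebraMap_eq_smul_one, smul_mul_assoc, one_mul,
          mul_smul_comm, LinearMap.smul_apply, Module.End.one_apply]
    rw [this, minpoly.aeval]
    ext1 X
    simp
  have hLR : Commute L R := LinearMap.ext fun X => by simp [L, R, mul_assoc]
  have hA : (L - R).IsSemisimple := hL.sub_of_commute hLR hR
  have hker : ∀ X, (L - R) ((L - R) X) = 0 → (L - R) X = 0 := by
    intro X hX
    have h1 := hA.isFinitelySemisimple.genEigenspace_eq_eigenspace 0 (k := 2) (by norm_num)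
    have h2 : X ∈ (L - R).genEigenspace 0 (2 : ℕ) := by
      rw [Module.End.mem_genEigenspace_nat]
      simpa [pow_two] using hX
    rw [Nat.cast_ofNat, h1, Module.End.mem_eigenspace_iff, zero_smul] at h2
    exact h2
  have htop : LinearMap.ker (L - R) ⊔ LinearMap.range (L - R) = ⊤ := by
    refine Submodule.eq_top_of_disjoint _ _ ?_ ?_
    · rw [add_comm, LinearMap.finrank_range_add_finrank_ker]
    · rw [Submodule.disjoint_def]
      rintro _ hx ⟨Y, rfl⟩
      exact hker Y hx
  obtain ⟨D₀, hD₀, _, ⟨Z, rfl⟩, hsum⟩ := Submodule.mem_sup.1 (htop ▸ Submodule.mem_top (x := D))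
  let ad : Module.End k (Module.End k U) := LinearMap.mulRight k N - LinearMap.mulLeft k N
  have hadA : ∀ X, ad ((L - R) X) = (L - R) (ad X) := by
    intro X
    have h := hc.eq
    simp only [ad, L, R, LinearMap.sub_apply, LinearMap.mulRight_apply, LinearMap.mulLeft_apply,
      sub_mul, mul_sub, mul_assoc]
    rw [h]
    simp only [← mul_assoc]
    rw [h]
    abel
  have hD₀' : (L - R) D₀ = 0 := hD₀
  have hAN : (L - R) N = 0 := by simp [L, R, hc.eq]
  have hadD : ad D = N := by simpa [ad] using hD
  -- The range component `(L - R) Z` of `D` contributes `(L - R) (ad Z)` to `[D, N] = N`. Since `N`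
  -- and the contribution of `D₀` are killed by `L - R`, so is this one, and kernel and range meet
  -- in zero.
  have h1 : (L - R) (ad Z) = 0 := by
    apply hker
    have h2 := congrArg (L - R) hadD
    rw [← hsum, map_add, map_add, ← hadA, hD₀', map_zero, zero_add, hAN, hadA] at h2
    exact h2
  refine ⟨D₀, ?_, ?_⟩
  · rw [← hsum, map_add, hadA, h1, add_zero] at hadD
    simpa [ad] using hadD
  · exact sub_eq_zero.1 (by simpa [L, R] using hD₀')

end AlgClosed

open Polynomial in
/-- If `x` and `s` are inverted by a ring endomorphism and differ by a nilpotent element, then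
`x / s` is the square of the Cayley transform of a nilpotent element. -/
theorem exists_nilpotent_cayley {S : Type*} [CommRing S] (h2 : IsUnit (2 : S)) (ι : S →+* S)
    {n s : S} (hn : IsNilpotent n) (hs : ι s * s = 1) (hx : ι (n + s) * (n + s) = 1) :
    ∃ M : S, IsNilpotent M ∧ ι M = -M ∧ (n + s) * (1 - M) ^ 2 = s * (1 + M) ^ 2 := by
  -- The equation for `M`. Its value at `0` is the nilpotent `n` and its derivative there is the
  -- unit `-2 (n + 2 s)`, so Newton's method gives a unique nilpotent root.
  set P : S[X] := C (n + s) * (1 - X) ^ 2 - C s * (1 + X) ^ 2 with hP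
  have hev : ∀ r, aeval r P = (n + s) * (1 - r) ^ 2 - s * (1 + r) ^ 2 := by
    intro r; simp [hP]
  have hsu : IsUnit s := IsUnit.of_mul_eq_one_right _ hs
  obtain ⟨M, ⟨hM, hM'⟩, huniq⟩ := Polynomial.existsUnique_nilpotent_sub_and_aeval_eq_zero
    (P := P) (x := (0 : S)) (by rw [hev]; simpa using hn)
    (by
      have h1 : aeval (0 : S) (derivative P) = -2 * (n + 2 * s) := by
        simp [hP, derivative_pow]; ring
      rw [h1]
      refine (h2.neg).mul ?_
      rw [add_comm]
      exact IsNilpotent.isUnit_add_left_of_commute hn (h2.mul hsu) (Commute.all _ _))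
  have hMn : IsNilpotent M := by simpa using hM
  rw [hev, sub_eq_zero] at hM'
  refine ⟨M, hMn, ?_, hM'⟩
  -- Applying `ι` and using `ι x = x⁻¹`, `ι s = s⁻¹` shows that `-ι M` is a nilpotent root of the
  -- same equation; uniqueness gives the antisymmetry.
  have h1 := huniq (-ι M) ⟨by simpa using hMn.map ι, by
    rw [hev, sub_eq_zero]
    have h := congrArg (fun z => z * (n + s) * s) (congrArg ι hM')
    simp only [map_mul, map_pow, map_sub, map_one, map_add ι 1] at h
    linear_combination (-1 : S) * h + (s * (1 - ι M) ^ 2) * hx -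
      ((n + s) * (1 + ι M) ^ 2) * hs⟩
  exact neg_eq_iff_eq_neg.1 h1

section AlgClosed

variable {k : Type*} [Field k] {U : Type*} [AddCommGroup U] [Module k U]

/-- Conjugation by an involution, as an algebra homomorphism. -/
def Module.End.conjInvolution (ε : Module.End k U) (hε : ε * ε = 1) :
    Module.End k U →ₐ[k] Module.End k U :=
  AlgHom.ofLinearMap (LinearMap.mulLeft k ε ∘ₗ LinearMap.mulRight k ε) (by simp [hε])
    (by
      intro a b
      simp only [LinearMap.comp_apply, LinearMap.mulLeft_apply, LinearMap.mulRight_apply]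
      calc _ = ε * a * 1 * b * ε := by simp only [mul_one, mul_assoc]
        _ = _ := by rw [← hε]; simp only [mul_assoc])

theorem Module.End.conjInvolution_apply (ε : Module.End k U) (hε : ε * ε = 1)
    (X : Module.End k U) : Module.End.conjInvolution ε hε X = ε * X * ε := by
  simp [Module.End.conjInvolution, mul_assoc]

/-- If the adjoint of `x` is `ε x ε`, then the same holds for the elements of the algebra generated
by `x` and `ε x ε`, provided that these two commute. -/
theorem Module.End.adjoint_eq_conj_of_mem_adjoin (β : LinearMap.BilinForm k U)
    {ε x : Module.End k U} (hε : ε * ε = 1) (hεβ : ∀ v w, β (ε v) (ε w) = β v w)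
    (hx : ∀ v w, β (x v) w = β v (ε (x (ε w)))) (hc : Commute x (ε * x * ε))
    {e : Module.End k U} (he : e ∈ Algebra.adjoin k {x, ε * x * ε}) (v w : U) :
    β (e v) w = β v (ε (e (ε w))) := by
  have hεε : ∀ v, ε (ε v) = v := fun v => LinearMap.congr_fun hε v
  have hε' : ∀ v w, β (ε v) w = β v (ε w) := fun v w => by
    conv_lhs => rw [← hεε w, hεβ]
  have hcomm : ∀ a ∈ ({x, ε * x * ε} : Set (Module.End k U)),
      ∀ b ∈ ({x, ε * x * ε} : Set (Module.End k U)), a * b = b * a := by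
    rintro a (rfl | rfl) b (rfl | rfl)
    exacts [rfl, hc, hc.symm, rfl]
  induction he using Algebra.adjoin_induction generalizing v w with
  | mem a ha =>
    rcases ha with rfl | rfl
    · exact hx v w
    · simp only [Module.End.mul_apply]
      rw [hε', hx, hεε, hε', hεε]
  | algebraMap r =>
    simp [Module.algebraMap_end_apply, hεε]
  | add a b _ _ ha hb =>
    simp only [LinearMap.add_apply, map_add, ha, hb]
  -- Taking adjoints reverses products and conjugation by `ε` does not; commutativity of the algebra
  -- reconciles the two.
  | mul a b hma hmb ha hb =>
    have hab : a * b = b * a :=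
      have := Algebra.isMulCommutative_adjoin k hcomm
      congrArg Subtype.val (mul_comm' (⟨a, hma⟩ : Algebra.adjoin k {x, ε * x * ε}) ⟨b, hmb⟩)
    conv_rhs => rw [hab]
    simp only [Module.End.mul_apply]
    rw [ha, hb, hεε]

variable [FiniteDimensional k U]

/-- The multiplicative Jordan decomposition of an element `x` inverted by an involution `ε`: the
unipotent part is written as the square of a Cayley transform. -/
theorem Module.End.exists_semisimple_nilpotent_cayley [CharZero k] (ε x : Module.End k U)
    (hε : ε * ε = 1) (hx : x * (ε * x * ε) = 1) :
    ∃ s ∈ Algebra.adjoin k {x, ε * x * ε}, ∃ M ∈ Algebra.adjoin k {x, ε * x * ε},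
      s.IsSemisimple ∧ IsNilpotent M ∧ Commute s M ∧ ε * s * ε * s = 1 ∧ ε * M * ε = -M ∧
      x * (1 - M) ^ 2 = s * (1 + M) ^ 2 := by
  have hx' : ε * x * ε * x = 1 := by
    have h := congrArg (fun z => ε * z * ε) hx
    simp only [mul_one, hε] at h
    rw [← h]
    simp only [mul_assoc]
    rw [hε, mul_one]
  have hc : Commute x (ε * x * ε) := hx.trans hx'.symm
  have hcomm : ∀ a ∈ ({x, ε * x * ε} : Set (Module.End k U)),
      ∀ b ∈ ({x, ε * x * ε} : Set (Module.End k U)), a * b = b * a := by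
    rintro a (rfl | rfl) b (rfl | rfl)
    exacts [rfl, hc, hc.symm, rfl]
  obtain ⟨n, hn, s, hs, hnn, hss, hxns⟩ := Module.End.exists_isNilpotent_isSemisimple (f := x)
  set conj := Module.End.conjInvolution ε hε with hconj
  -- As `ε x ε = x⁻¹`, this algebra is commutative and stable under conjugation by `ε`. It contains
  -- the additive Jordan parts of `x`, which are polynomials in `x`, so the rest is a computation in
  -- a commutative ring with involution.
  set A := Algebra.adjoin k {x, ε * x * ε} with hA
  have : IsMulCommutative A := Algebra.isMulCommutative_adjoin k hcomm
  let : CommRing A := { (inferInstance : Ring A) with mul_comm := mul_comm' }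
  have hle : Algebra.adjoin k {x} ≤ A := Algebra.adjoin_mono (by simp)
  have hstab : A ≤ A.comap conj := by
    rw [hA, Algebra.adjoin_le_iff]
    rintro a (ha | ha)
    · rw [ha]
      exact Algebra.subset_adjoin (Or.inr (Module.End.conjInvolution_apply ε hε x))
    · refine Algebra.subset_adjoin (Or.inl ?_)
      change conj a = x
      rw [ha, hconj, Module.End.conjInvolution_apply]
      calc _ = (ε * ε) * x * (ε * ε) := by simp only [mul_assoc]
        _ = x := by rw [hε, one_mul, mul_one]
  let ι : A →+* A :=
    { toFun := fun a => ⟨conj a, hstab a.2⟩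
      map_one' := Subtype.ext (map_one conj)
      map_mul' := fun a b => Subtype.ext (map_mul conj _ _)
      map_zero' := Subtype.ext (map_zero conj)
      map_add' := fun a b => Subtype.ext (map_add conj _ _) }
  let n' : A := ⟨n, hle hn⟩
  let s' : A := ⟨s, hle hs⟩
  have hn' : IsNilpotent n' := by
    obtain ⟨i, hi⟩ := hnn
    exact ⟨i, Subtype.ext hi⟩
  have hxι : ι (n' + s') * (n' + s') = 1 := by
    refine Subtype.ext ?_
    change conj (n + s) * (n + s) = 1
    rw [← hxns, Module.End.conjInvolution_apply, hx']
  -- Modulo nilpotents `s` equals `x`, so `ι s * s - 1` is nilpotent; it is also semisimple, hence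
  -- zero.
  have hsι : ι s' * s' = 1 := by
    have hnil : IsNilpotent (ι s' * s' - 1) := by
      rw [← hxι, map_add]
      have : ι s' * s' - (ι n' + ι s') * (n' + s') = -(ι n' * (n' + s') + ι s' * n') := by ring
      rw [this, isNilpotent_neg_iff]
      exact (Commute.all _ _).isNilpotent_add
        ((Commute.all _ _).isNilpotent_mul_right (hn'.map ι))
        ((Commute.all _ _).isNilpotent_mul_left hn')
    have hcss : conj s * s = s * conj s := congrArg Subtype.val (mul_comm (ι s') s')
    have hconjss : (conj s).IsSemisimple := by
      refine Module.End.isSemisimple_of_squarefree_aeval_eq_zero hss.minpoly_squarefree ?_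
      rw [Polynomial.aeval_algHom_apply, minpoly.aeval, map_zero]
    have hss' : (conj s * s - 1).IsSemisimple :=
      (hconjss.mul_of_commute hcss hss).sub_of_commute (Commute.one_right _)
        Module.End.isSemisimple_id
    have hnil' : IsNilpotent (conj s * s - 1) := by
      obtain ⟨i, hi⟩ := hnil
      exact ⟨i, congrArg Subtype.val hi⟩
    exact Subtype.ext (sub_eq_zero.1
      (Module.End.eq_zero_of_isNilpotent_isSemisimple hnil' hss'))
  have h2 : IsUnit (2 : A) := by
    refine IsUnit.of_mul_eq_one (algebraMap k A 2⁻¹) ?_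
    refine Subtype.ext ?_
    change (2 : Module.End k U) * algebraMap k _ 2⁻¹ = 1
    rw [← map_ofNat (algebraMap k (Module.End k U)) 2, ← map_mul, mul_inv_cancel₀ two_ne_zero,
      map_one]
  obtain ⟨M, hM, hιM, hxM⟩ := exists_nilpotent_cayley h2 ι hn' hsι hxι
  refine ⟨s, hle hs, M, M.2, hss, ?_, congrArg Subtype.val (mul_comm s' M), ?_, ?_, ?_⟩
  · obtain ⟨i, hi⟩ := hM
    exact ⟨i, congrArg Subtype.val hi⟩
  · rw [← Module.End.conjInvolution_apply ε hε]
    exact congrArg Subtype.val hsι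
  · rw [← Module.End.conjInvolution_apply ε hε]
    exact congrArg Subtype.val hιM
  · rw [hxns]
    exact congrArg Subtype.val hxM

/-- The Chinese remainder theorem for finitely many members of a possibly infinite coprime family.
-/
theorem exists_forall_sub_mem_of_pairwise_isCoprime {R ι : Type*} [CommRing R] (s : Finset ι)
    (I : ι → Ideal R) (hI : Pairwise (Function.onFun IsCoprime I)) (x : ι → R) :
    ∃ r, ∀ i ∈ s, r - x i ∈ I i := by
  obtain ⟨r, hr⟩ := Ideal.exists_forall_sub_mem_ideal (I := fun i : s => I i)
    (fun a b hab => hI (fun h => hab (Subtype.ext h))) (fun i => x i)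
  exact ⟨r, fun i hi => hr ⟨i, hi⟩⟩

theorem Commute.aeval_right {R A : Type*} [CommSemiring R] [Semiring A] [Algebra R A] {a b : A}
    (h : Commute a b) (p : Polynomial R) : Commute a (Polynomial.aeval b p) := by
  induction p using Polynomial.induction_on' with
  | add p q hp hq => rw [map_add]; exact hp.add_right hq
  | monomial i r =>
    rw [Polynomial.aeval_monomial]
    exact (Algebra.commute_algebraMap_right _ _).mul_right (h.pow_right i)

open Polynomial in
/-- If `[D, N] = N`, then for `c ≠ 0` there is a polynomial `P` in `D` with `P N P⁻¹ = c N`. -/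
theorem Module.End.exists_conj_eq_smul_of_commutator [IsAlgClosed k] [CharZero k]
    {D N : Module.End k U} (hDN : D * N - N * D = N) {c : k} (hc : c ≠ 0) :
    ∃ P : Module.End k U, IsUnit P ∧ P * N = c • (N * P) ∧
      ∀ Z, Commute Z D → Commute Z P := by
  classical
  -- Choose a representative of each coset of `ℤ` in `k` and set `f (rep + n) = c ^ n`; the integer
  -- `n` is unique in characteristic zero.
  obtain ⟨f, hf0, hf1⟩ : ∃ f : k → k, (∀ μ, f μ ≠ 0) ∧ ∀ μ, f (μ + 1) = c * f μ := by
    let rep : k → k := fun μ =>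
      Quotient.out (QuotientAddGroup.mk μ : k ⧸ AddSubgroup.zmultiples (1 : k))
    have hrep : ∀ μ, rep (μ + 1) = rep μ := by
      intro μ
      have : (QuotientAddGroup.mk (μ + 1) : k ⧸ AddSubgroup.zmultiples (1 : k)) =
          QuotientAddGroup.mk μ := by
        rw [QuotientAddGroup.eq]
        exact ⟨-1, by simp⟩
      simp only [rep, this]
    have hn : ∀ μ, ∃ n : ℤ, μ = rep μ + n := by
      intro μ
      have h : (QuotientAddGroup.mk (rep μ) : k ⧸ AddSubgroup.zmultiples (1 : k)) =
          QuotientAddGroup.mk μ := Quotient.out_eq _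
      rw [QuotientAddGroup.eq] at h
      obtain ⟨n, hn⟩ := h
      refine ⟨n, ?_⟩
      have hn' : (n : k) = -rep μ + μ := by simpa using hn
      rw [hn']; ring
    choose n hn using hn
    refine ⟨fun μ => c ^ n μ, fun μ => zpow_ne_zero _ hc, fun μ => ?_⟩
    have h1 := hn (μ + 1)
    rw [hrep] at h1
    have h2 : ((n (μ + 1) : ℤ) : k) = ((n μ + 1 : ℤ) : k) := by
      push_cast
      linear_combination (-1 : k) * h1 + hn μ
    change c ^ n (μ + 1) = c * c ^ n μ
    rw [Int.cast_injective h2, zpow_add_one₀ hc, mul_comm]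
  set m := minpoly k D with hm
  have hm0 : m ≠ 0 := minpoly.ne_zero (Algebra.IsIntegral.isIntegral D)
  set Λ := m.roots.toFinset with hΛ
  -- The degree bounds the multiplicities of the roots of `m`; the `+ 1` makes the exponent visibly
  -- nonzero, so that congruence modulo `(X - μ) ^ n` determines the value at `μ`.
  set n := m.natDegree + 1 with hn
  have hcop : Pairwise (Function.onFun IsCoprime fun μ : k => Ideal.span {(X - C μ) ^ n}) := by
    intro a b hab
    rw [Function.onFun, Ideal.isCoprime_span_singleton_iff]
    exact (isCoprime_X_sub_C_of_isUnit_sub (isUnit_iff_ne_zero.2 (sub_ne_zero.2 hab))).pow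
  -- `q` is close to the constant `f μ` at each root `μ` and also at `μ + 1`, because `q(X + 1)` has
  -- to be compared with `c q(X)` at the roots.
  obtain ⟨q, hq⟩ := exists_forall_sub_mem_of_pairwise_isCoprime (Λ ∪ Λ.image (· + 1))
    (fun μ : k => Ideal.span {(X - C μ) ^ n}) hcop (fun μ => C (f μ))
  have hq' : ∀ μ ∈ Λ ∪ Λ.image (· + 1), (X - C μ) ^ n ∣ q - C (f μ) := fun μ hμ =>
    Ideal.mem_span_singleton.1 (hq μ hμ)
  have hunit : IsUnit (aeval D q) := by
    have hco : IsCoprime q m := by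
      rw [Polynomial.isCoprime_iff_aeval_ne_zero_of_isAlgClosed k k]
      intro a
      by_contra! h
      rw [coe_aeval_eq_eval] at h
      have ha : a ∈ Λ := by
        rw [hΛ, Multiset.mem_toFinset, mem_roots hm0]; exact h.2
      have h1 := (dvd_pow_self _ (Nat.succ_ne_zero _)).trans
        (hq' a (Finset.mem_union_left _ ha))
      rw [dvd_iff_isRoot, IsRoot, eval_sub, eval_C, h.1, zero_sub, neg_eq_zero] at h1
      exact hf0 a h1
    obtain ⟨a, b, hab⟩ := hco
    have h := congrArg (aeval D) hab
    rw [map_add, map_mul, map_mul, map_one, minpoly.aeval, mul_zero, add_zero] at h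
    have h' : aeval D q * aeval D a = 1 := by rw [← map_mul, mul_comm, map_mul, h]
    exact ⟨⟨_, _, h', h⟩, rfl⟩
  refine ⟨aeval D q, hunit, ?_, fun Z hZ => ?_⟩
  -- `D N = N (D + 1)`, so moving a polynomial in `D` past `N` shifts its variable by one. It
  -- remains to see that `q(D + 1) = c q(D)`.
  · have hcomm : ∀ p : k[X], aeval D p * N = N * aeval D (p.comp (X + 1)) := by
      have hDN' : D * N = N * (D + 1) := by rw [mul_add, mul_one, ← sub_eq_iff_eq_add']; exact hDN
      have hpow : ∀ i, D ^ i * N = N * (D + 1) ^ i := by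
        intro i
        induction i with
        | zero => simp
        | succ i ih => rw [pow_succ', mul_assoc, ih, ← mul_assoc, hDN', mul_assoc, ← pow_succ']
      intro p
      have hD1 : ∀ p : k[X], aeval D (p.comp (X + 1)) = aeval (D + 1) p := by
        intro p
        rw [aeval_comp]; simp
      rw [hD1]
      induction p using Polynomial.induction_on' with
      | add p r hp hr => rw [map_add, map_add, add_mul, mul_add, hp, hr]
      | monomial i a =>
        rw [aeval_monomial, aeval_monomial, mul_assoc, hpow, ← mul_assoc, ← mul_assoc,
          Algebra.commutes]
    have hdvd : m ∣ q.comp (X + 1) - C c * q := by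
      refine (Polynomial.dvd_prod_X_sub_C_roots_pow hm0).trans ?_
      rw [← Finset.prod_pow]
      refine Finset.prod_dvd_of_coprime ?_ ?_
      · intro a _ b _ hab
        exact (isCoprime_X_sub_C_of_isUnit_sub
          (isUnit_iff_ne_zero.2 (sub_ne_zero.2 hab))).pow
      · intro μ hμ
        have h1 := hq' μ (Finset.mem_union_left _ hμ)
        have h2 := hq' (μ + 1) (Finset.mem_union_right _ (Finset.mem_image_of_mem _ hμ))
        obtain ⟨r, hr⟩ := h2
        have h3 : (X - C μ) ^ n ∣ q.comp (X + 1) - C (f (μ + 1)) := by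
          refine ⟨r.comp (X + 1), ?_⟩
          have := congrArg (fun p => p.comp (X + 1)) hr
          simp only [sub_comp, mul_comp, pow_comp, X_comp, C_comp, C_add, C_1,
            add_comp, one_comp] at this
          rw [this]
          ring
        refine (pow_dvd_pow _ (Nat.le_succ _)).trans ?_
        have h4 : q.comp (X + 1) - C c * q =
            (q.comp (X + 1) - C (f (μ + 1))) - C c * (q - C (f μ)) := by
          rw [hf1, C_mul]; ring
        rw [h4]
        exact dvd_sub h3 (h1.mul_left _)
    obtain ⟨r, hr⟩ := hdvd
    have h := congrArg (aeval D) hr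
    rw [map_mul, minpoly.aeval, zero_mul, map_sub, sub_eq_zero, map_mul, aeval_C,
      ← Algebra.smul_def] at h
    rw [hcomm, h, mul_smul_comm]
  · exact hZ.aeval_right q

/-- Let `N` be a nilpotent skew-adjoint endomorphism that anticommutes with an isometric involution
`ε`, and `s` a semisimple isometry inverted by `ε` that commutes with `N`. Over an algebraically
closed field, `N` and `c N` are conjugate by an isometry that commutes with `ε` and `s`. -/
theorem Module.End.exists_isometry_conj_eq_smul [IsAlgClosed k] [CharZero k]
    (β : LinearMap.BilinForm k U) (hβ : β.Nondegenerate)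
    (hβs : ∀ v w, β v w = β w v) {ε s N : Module.End k U}
    (hε : ε * ε = 1) (hεβ : ∀ v w, β (ε v) (ε w) = β v w)
    (hs : s.IsSemisimple) (hsβ : ∀ v w, β (s v) (s w) = β v w) (hεs : ε * s * ε * s = 1)
    (hN : IsNilpotent N) (hNβ : ∀ v w, β (N v) w = -β v (N w)) (hεN : ε * N * ε = -N)
    (hsN : Commute s N) {c : k} (hc : c ≠ 0) :
    ∃ h : Module.End k U, IsUnit h ∧ (∀ v w, β (h v) (h w) = β v w) ∧ Commute h ε ∧ Commute h s ∧
      h * N = c • (N * h) := by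
  have hεε : ∀ v, ε (ε v) = v := fun v => LinearMap.congr_fun hε v
  have hsε : s * (ε * s * ε) = 1 :=
    mul_eq_one_comm.1 hεs
  obtain ⟨D₀, hD₀, hsD₀⟩ := Module.End.exists_commutator_eq_of_commute hN hs hsN
  -- Average over conjugation by `ε`. As `ε N ε = -N`, the signs cancel and `ε D₀ ε` satisfies the
  -- same commutator relation; it commutes with `s` because `ε s ε = s⁻¹`.
  obtain ⟨D, hD, hsD, hεD⟩ : ∃ D : Module.End k U, D * N - N * D = N ∧ Commute s D ∧
      Commute ε D := by
    refine ⟨(2⁻¹ : k) • (D₀ + ε * D₀ * ε), ?_, ?_, ?_⟩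
    · have h1 : ε * D₀ * ε * N = -(ε * (D₀ * N) * ε) := by
        have : ε * N = -(N * ε) := by
          have := congrArg (fun z => z * ε) hεN
          simp only [mul_assoc, hε, mul_one, neg_mul] at this
          exact this
        rw [mul_assoc _ ε, this, mul_neg]
        simp only [mul_assoc]
      have h2 : N * (ε * D₀ * ε) = -(ε * (N * D₀) * ε) := by
        have : N * ε = -(ε * N) := by
          have := congrArg (fun z => ε * z) hεN
          simp only [← mul_assoc, hε, one_mul, mul_neg] at this
          exact this
        rw [mul_assoc, ← mul_assoc N, this]
        simp only [mul_assoc, neg_mul]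
      rw [smul_mul_assoc, mul_smul_comm, ← smul_sub, add_mul, mul_add, h1, h2]
      have h3 : D₀ * N + -(ε * (D₀ * N) * ε) - (N * D₀ + -(ε * (N * D₀) * ε)) =
          (D₀ * N - N * D₀) - ε * (D₀ * N - N * D₀) * ε := by
        rw [mul_sub, sub_mul]; abel
      rw [h3, hD₀, hεN, sub_neg_eq_add, ← two_smul k, smul_smul, inv_mul_cancel₀ two_ne_zero,
        one_smul]
    · refine (Commute.smul_right (hsD₀.add_right ?_) _)
      have h1 : Commute (ε * s * ε) D₀ :=
        Commute.units_inv_left (u := ⟨s, ε * s * ε, hsε, hεs⟩) hsD₀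
      have h2 := congrArg (fun z => ε * z * ε) h1.eq
      simp only [mul_assoc, hε, mul_one] at h2
      simp only [← mul_assoc, hε, one_mul] at h2
      rw [Commute, SemiconjBy]
      simp only [← mul_assoc]
      exact h2
    · refine (Commute.smul_right ?_ _)
      rw [Commute, SemiconjBy, mul_add, add_mul]
      simp only [mul_assoc, hε, mul_one]
      simp only [← mul_assoc, hε, one_mul]
      exact add_comm _ _
  obtain ⟨P, hP, hPN, hPcomm⟩ := Module.End.exists_conj_eq_smul_of_commutator hD hc
  have hPs : Commute s P := hPcomm s hsD
  have hPε : Commute ε P := hPcomm ε hεD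
  -- `A = P* P` measures the failure of `P` to be an isometry. It commutes with `ε` and `s`, and
  -- also with `N`: both sides of `[A, N] = 0` acquire the same factor `c` when `N` passes `P`,
  -- since `N` is skew.
  obtain ⟨A, hAβ⟩ : ∃ A : Module.End k U, ∀ v w, β (A v) w = β (P v) (P w) :=
    ⟨β.leftAdjointOfNondegenerate hβ P * P, fun v w =>
      β.isAdjointPairLeftAdjointOfNondegenerate hβ P _ _⟩
  have hPinj : Function.Injective P := ((Module.End.isUnit_iff P).1 hP).1
  have hinj : ∀ v, (∀ w, β v w = 0) → v = 0 := hβ.1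
  have hext : ∀ {X Y : Module.End k U}, (∀ v w, β (X v) w = β (Y v) w) → X = Y := by
    intro X Y h
    ext v
    refine sub_eq_zero.1 (hinj _ fun w => ?_)
    rw [map_sub, LinearMap.sub_apply, h, sub_self]
  have hsurj : ∀ {X : Module.End k U}, IsUnit X → Function.Surjective X := fun h =>
    ((Module.End.isUnit_iff _).1 h).2
  have hεu : IsUnit ε := ⟨⟨ε, ε, hε, hε⟩, rfl⟩
  have hsu : IsUnit s := ⟨⟨s, ε * s * ε, hsε, hεs⟩, rfl⟩
  have hiso : ∀ {X : Module.End k U}, IsUnit X → (∀ v w, β (X v) (X w) = β v w) →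
      Commute X P → Commute X A := by
    intro X hX hXβ hXP
    refine hext fun v w => ?_
    obtain ⟨w, rfl⟩ := hsurj hX w
    rw [Module.End.mul_apply, Module.End.mul_apply, hXβ, hAβ, hAβ]
    rw [← Module.End.mul_apply P X, ← Module.End.mul_apply P X, ← hXP.eq, Module.End.mul_apply,
      Module.End.mul_apply, hXβ]
  have hAε : Commute ε A := hiso hεu hεβ hPε
  have hAs : Commute s A := hiso hsu hsβ hPs
  have hAN : Commute N A := by
    refine hext fun v w => ?_
    have h1 : ∀ v, P (N v) = c • N (P v) := LinearMap.congr_fun hPN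
    rw [Module.End.mul_apply, Module.End.mul_apply, hNβ, hAβ, hAβ, h1, h1, map_smul, map_smul,
      LinearMap.smul_apply, hNβ, smul_neg]
  have hAu : IsUnit A := by
    rw [Module.End.isUnit_iff, Function.Bijective, ← LinearMap.injective_iff_surjective, and_self,
      ← LinearMap.ker_eq_bot, LinearMap.ker_eq_bot']
    intro v hv
    apply hPinj
    rw [map_zero]
    refine hinj _ fun w => ?_
    obtain ⟨w, rfl⟩ := hsurj hP w
    rw [← hAβ, hv, map_zero, LinearMap.zero_apply]
  -- Being a polynomial in `A`, the square root is self-adjoint and commutes with everything that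
  -- commutes with `A`; hence `P S⁻¹` is an isometry and keeps the other properties of `P`.
  obtain ⟨S, hS, hSS⟩ := Module.End.exists_sqrt A hAu
  have hScomm : ∀ {X}, Commute X A → Commute X S := by
    intro X hX
    rw [Algebra.adjoin_singleton_eq_range_aeval] at hS
    obtain ⟨p, rfl⟩ := hS
    exact hX.aeval_right p
  have hAsymm : ∀ v w, β (A v) w = β v (A w) := fun v w => by
    rw [hAβ, hβs v, hAβ, hβs]
  have hSβ : ∀ v w, β (S v) w = β v (S w) := by
    clear hScomm hSS
    induction hS using Algebra.adjoin_induction with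
    | mem a ha => rw [ha]; exact hAsymm
    | algebraMap r => simp [Module.algebraMap_end_apply]
    | add a b _ _ ha hb => intro v w; simp [ha, hb]
    | mul a b hma hmb ha hb =>
      intro v w
      have hab : a * b = b * a :=
        congrArg Subtype.val (mul_comm (⟨a, hma⟩ : Algebra.adjoin k {A}) ⟨b, hmb⟩)
      rw [Module.End.mul_apply, ha, hb, ← Module.End.mul_apply, ← hab]
  have hSu : IsUnit S := by
    obtain ⟨a, ha⟩ := hAu.exists_right_inv
    rw [← hSS, mul_assoc] at ha
    exact ⟨⟨S, _, ha, mul_eq_one_comm.1 ha⟩, rfl⟩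
  obtain ⟨S, rfl⟩ := hSu
  have hSinv : ∀ v, (S : Module.End k U) ((S⁻¹ : (Module.End k U)ˣ).1 v) = v := fun v =>
    LinearMap.congr_fun (S.mul_inv) v
  refine ⟨P * (S⁻¹ : (Module.End k U)ˣ), hP.mul (Units.isUnit _), fun v w => ?_, ?_, ?_, ?_⟩
  · rw [Module.End.mul_apply, Module.End.mul_apply, ← hAβ, ← hSS, Module.End.mul_apply, hSinv,
      hSβ, hSinv]
  · exact (hPε.mul_right ((hScomm hAε).units_inv_right)).symm
  · exact (hPs.mul_right ((hScomm hAs).units_inv_right)).symm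
  · rw [mul_assoc, ← ((hScomm hAN).units_inv_right).eq, ← mul_assoc, hPN, smul_mul_assoc,
      mul_assoc]

end AlgClosed

/-! ### Extension of scalars of endomorphisms and descent of semisimplicity. -/

section ExtendEnd

variable {K : Type u} [Field K] {W : Type u} [AddCommGroup W] [Module K W]
  {R S : Type u} [CommRing R] [Algebra K R] [CommRing S] [Algebra K S]

theorem extendEnd_add (f : R →ₐ[K] S) (φ ψ : Module.End R (R ⊗[K] W)) :
    extendEnd f (φ + ψ) = extendEnd f φ + extendEnd f ψ :=
  end_ext fun w => by simp [extendEnd_tmul]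

theorem extendEnd_smul (f : R →ₐ[K] S) (r : R) (φ : Module.End R (R ⊗[K] W)) :
    extendEnd f (r • φ) = f r • extendEnd f φ :=
  end_ext fun w => by simp [extendEnd_tmul, rTensor_smul]

/-- Extension of scalars of endomorphisms as a ring homomorphism. -/
noncomputable def extendEndHom (f : R →ₐ[K] S) :
    Module.End R (R ⊗[K] W) →+* Module.End S (S ⊗[K] W) :=
  { toFun := extendEnd f
    map_one' := extendEnd_one f
    map_mul' := extendEnd_mul f
    map_zero' := end_ext fun w => by simp [extendEnd_tmul]
    map_add' := extendEnd_add f }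

theorem extendEndHom_apply (f : R →ₐ[K] S) (φ : Module.End R (R ⊗[K] W)) :
    extendEndHom f φ = extendEnd f φ := rfl

theorem extendEnd_comp {T : Type u} [CommRing T] [Algebra K T] (f' : S →ₐ[K] T) (f : R →ₐ[K] S)
    (φ : Module.End R (R ⊗[K] W)) : extendEnd f' (extendEnd f φ) = extendEnd (f'.comp f) φ := by
  refine end_ext fun w => ?_
  simp only [extendEnd_tmul, one_smul]
  rw [show (f'.comp f).toLinearMap = f'.toLinearMap ∘ₗ f.toLinearMap from rfl,
    LinearMap.rTensor_comp]
  rfl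

theorem extendEnd_id (φ : Module.End R (R ⊗[K] W)) : extendEnd (AlgHom.id K R) φ = φ :=
  end_ext fun w => by simp [extendEnd_tmul]

theorem extendEnd_aeval (f : R →ₐ[K] S) (φ : Module.End R (R ⊗[K] W)) (p : Polynomial R) :
    extendEnd f (Polynomial.aeval φ p) =
      Polynomial.aeval (extendEnd f φ) (p.map (f : R →+* S)) := by
  rw [← extendEndHom_apply, ← extendEndHom_apply]
  induction p using Polynomial.induction_on' with
  | add p q hp hq => simp only [map_add, Polynomial.map_add, hp, hq]
  | monomial n a =>
    rw [Polynomial.map_monomial, Polynomial.aeval_monomial, Polynomial.aeval_monomial, map_mul,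
      map_pow, Algebra.algebraMap_eq_smul_one, extendEndHom_apply, extendEnd_smul, extendEnd_one,
      Algebra.algebraMap_eq_smul_one]
    rfl

theorem extendEnd_injective (f : R →ₐ[K] S) (hf : Function.Injective f) :
    Function.Injective (extendEnd (W := W) f) := by
  intro φ ψ h
  refine end_ext fun w => ?_
  have hinj : Function.Injective (f.toLinearMap.rTensor W) :=
    Module.Flat.rTensor_preserves_injective_linearMap _ hf
  apply hinj
  rw [← extendEnd_rTensor, ← extendEnd_rTensor, h]

/-- The nilpotent Jordan part is a polynomial in `φ`, so over `L` it is semisimple as well as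
nilpotent, hence zero; extension of scalars is injective, so it was zero before. -/
theorem Module.End.IsSemisimple.of_extendEnd [CharZero K] [FiniteDimensional K W] {L : Type u}
    [Field L] [Algebra K L] (φ : Module.End K (K ⊗[K] W))
    (h : (extendEnd (Algebra.ofId K L) φ).IsSemisimple) : φ.IsSemisimple := by
  obtain ⟨n, hn, s, -, hnn, hss, rfl⟩ := Module.End.exists_isNilpotent_isSemisimple (f := φ)
  rw [Algebra.adjoin_singleton_eq_range_aeval] at hn
  obtain ⟨p, hp⟩ := hn
  have h1 : (extendEnd (Algebra.ofId K L) n).IsSemisimple := by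
    conv in n => rw [← hp]
    change (extendEnd (Algebra.ofId K L) (Polynomial.aeval (n + s) p)).IsSemisimple
    rw [extendEnd_aeval]
    exact h.aeval _
  have h2 : IsNilpotent (extendEnd (Algebra.ofId K L) n) := hnn.map (extendEndHom _)
  have h3 := Module.End.eq_zero_of_isNilpotent_isSemisimple h2 h1
  have h4 : n = 0 := extendEnd_injective (Algebra.ofId K L) (algebraMap K L).injective
    (h3.trans (map_zero (extendEndHom (Algebra.ofId K L))).symm)
  rwa [h4, zero_add]

end ExtendEnd

/-! ### Cayley transforms over arbitrary algebras. -/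

section Cayley

variable {K : Type u} [Field K] {W : Type u} [AddCommGroup W] [Module K W]
  (B : LinearMap.BilinForm K W)
  {R S : Type u} [CommRing R] [Algebra K R] [CommRing S] [Algebra K S]

theorem isUnit_one_add_end {M : Module.End R (R ⊗[K] W)} (hM : IsNilpotent M) :
    IsUnit (1 + M) := IsNilpotent.isUnit_one_add (r := M) hM

theorem isUnit_one_sub_end {M : Module.End R (R ⊗[K] W)} (hM : IsNilpotent M) :
    IsUnit (1 - M) := IsNilpotent.isUnit_one_sub (r := M) hM

/-- The Cayley transform `(1 + M) / (1 - M)` of a nilpotent skew-adjoint endomorphism. -/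
noncomputable def cayley {M : Module.End R (R ⊗[K] W)} (hM : IsNilpotent M)
    (hskew : ∀ x y, B.baseChange R (M x) y = -B.baseChange R x (M y)) : orthogonalPoints B R :=
  ⟨(isUnit_one_add_end hM).unit * (isUnit_one_sub_end hM).unit⁻¹, by
    intro x y
    set u := (isUnit_one_sub_end hM).unit⁻¹ with hu
    have h : ∀ z, ∃ z', z = z' - M z' ∧ u.1 z = z' := fun z => ⟨u.1 z, by
      have := gl_apply_inv_apply (R := R) (M := R ⊗[K] W) (isUnit_one_sub_end hM).unit z
      exact this.symm, rfl⟩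
    obtain ⟨x', hx, hx'⟩ := h x
    obtain ⟨y', hy, hy'⟩ := h y
    change B.baseChange R ((1 + M) (u.1 x)) ((1 + M) (u.1 y)) = _
    rw [hx', hy', hx, hy]
    simp only [LinearMap.add_apply, Module.End.one_apply, map_add, map_sub, LinearMap.sub_apply,
      hskew]
    abel⟩

/-- A denominator-free form of the definition, which ring homomorphisms preserve and which can
therefore be specialized. -/
theorem cayley_mul {M : Module.End R (R ⊗[K] W)} (hM : IsNilpotent M)
    (hskew : ∀ x y, B.baseChange R (M x) y = -B.baseChange R x (M y)) :
    (cayley B hM hskew).1.1 * (1 - M) = 1 + M := by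
  change (1 + M) * ((isUnit_one_sub_end hM).unit⁻¹).1 * (1 - M) = 1 + M
  rw [mul_assoc]
  have : ((isUnit_one_sub_end hM).unit⁻¹).1 * (1 - M) = 1 := Units.inv_mul (isUnit_one_sub_end hM).unit
  rw [this, mul_one]

end Cayley

section RingIdentities

variable {A : Type*} [Ring A]

theorem conj_one_sub_of_conj_eq_neg {ε M : A} (hε : ε * ε = 1) (hM : ε * M * ε = -M) :
    ε * (1 - M) * ε = 1 + M := by
  rw [mul_sub, sub_mul, hM, mul_one, hε, sub_neg_eq_add]

theorem conj_one_add_of_conj_eq_neg {ε M : A} (hε : ε * ε = 1) (hM : ε * M * ε = -M) :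
    ε * (1 + M) * ε = 1 - M := by
  rw [mul_add, add_mul, hM, mul_one, hε, sub_eq_add_neg]

/-- This is `y s y = s y²` with the denominators of `y = (1 + M)/(1 - M)` cleared; it serves to
recognize `x` as `y s y`. -/
theorem mul_mul_mul_one_sub_sq {s y M : A} (hsM : Commute s M) (hy : y * (1 - M) = 1 + M) :
    y * s * y * (1 - M) ^ 2 = s * (1 + M) ^ 2 := by
  have c1 : s * (1 + M) = (1 + M) * s := (Commute.one_right s).add_right hsM
  have c2 : s * (1 - M) = (1 - M) * s := (Commute.one_right s).sub_right hsM
  have c3 : (1 + M) * (1 - M) = (1 - M) * (1 + M) := by noncomm_ring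
  rw [pow_two (1 - M), mul_assoc, ← mul_assoc y (1 - M), hy, mul_assoc y, c3,
    ← mul_assoc s, c2, mul_assoc (1 - M), ← mul_assoc y, hy, c1, pow_two, ← mul_assoc, ← mul_assoc,
    mul_assoc s]
  exact (Commute.mul_right c1 c1).symm

/-- If `h` conjugates `M` to `c M`, it conjugates the Cayley transform `y` of `M` to the Cayley
transform `z` of `c M`; again denominators are cleared. -/
theorem mul_mul_one_sub_of_conj_eq_smul {L : Type*} [Field L] [Algebra L A] {z h y M : A} {c : L}
    (hhM : h * M = c • (M * h)) (hy : y * (1 - M) = 1 + M)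
    (hz : z * (1 - c • M) = 1 + c • M) : z * h * (1 - M) = h * y * (1 - M) := by
  rw [mul_assoc h, hy, mul_add, mul_one, hhM, mul_assoc, mul_sub, hhM, mul_one]
  have h1 : h - c • (M * h) = (1 - c • M) * h := by rw [sub_mul, one_mul, smul_mul_assoc]
  rw [h1, ← mul_assoc, hz, add_mul, one_mul, smul_mul_assoc]

end RingIdentities

/-! ### The one-parameter degeneration of `g`. -/

section Degeneration

variable {K : Type u} [Field K] {W : Type u} [AddCommGroup W] [Module K W]
  [FiniteDimensional K W] (B : LinearMap.BilinForm K W)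

theorem eq_zero_of_baseChange_eq_zero (hB : B.Nondegenerate) (R : Type u) [CommRing R]
    [Algebra K R] {x : R ⊗[K] W} (h : ∀ y, B.baseChange R x y = 0) : x = 0 := by
  apply (dualEquiv B hB R).injective
  refine LinearMap.ext fun y => ?_
  rw [dualEquiv_apply, h, map_zero, LinearMap.zero_apply]

theorem nondegenerate_baseChange (hs : B.IsSymm) (hB : B.Nondegenerate) (L : Type u) [Field L]
    [Algebra K L] : (B.baseChange L).Nondegenerate :=
  ⟨fun _ h => eq_zero_of_baseChange_eq_zero B hB L h, fun _ h =>
    eq_zero_of_baseChange_eq_zero B hB L fun y => by rw [baseChange_comm B hs, h]⟩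

theorem Module.End.IsSemisimple.conj_unit {k U : Type*} [Field k] [AddCommGroup U] [Module k U]
    [FiniteDimensional k U] {f : Module.End k U} (hf : f.IsSemisimple) (u : (Module.End k U)ˣ) :
    (u⁻¹.1 * f * u.1).IsSemisimple := by
  refine ((LinearMap.GeneralLinearGroup.toLinearEquiv u).isSemisimple_iff (M₂ := U) _ f ?_).2 hf
  ext v
  change u.1 (u⁻¹.1 (f (u.1 v))) = f (u.1 v)
  rw [← Module.End.mul_apply, Units.mul_inv, Module.End.one_apply]

/-- Let `x = g ε g⁻¹ ε` over an algebraically closed field. The square root `y` of the unipotent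
part of `x` is a Cayley transform, and the translates `y_c y⁻¹ g` of the corresponding
one-parameter family stay in one double coset for `c ≠ 0`, while for `c = 0` they give an element
with semisimple symmetrization. -/
theorem exists_degeneration [CharZero K] (hs : B.IsSymm) (hB : B.Nondegenerate)
    (L : Type u) [Field L] [Algebra K L] [IsAlgClosed L] (ε g : orthogonalPoints B L)
    (hε : ε * ε = 1) :
    ∃ (M : Module.End L (L ⊗[K] W)) (_ : IsNilpotent M)
      (_ : ∀ x y, B.baseChange L (M x) y = -B.baseChange L x (M y)) (a : orthogonalPoints B L),
      Module.End.IsSemisimple (a * ε * a⁻¹ * ε).1.1 ∧ ∀ c : L, c ≠ 0 → ∀ y : orthogonalPoints B L,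
        y.1.1 * (1 - c • M) = 1 + c • M → ∃ h₁ h₂ : orthogonalPoints B L,
          ε * h₁ * ε = h₁ ∧ ε * h₂ * ε = h₂ ∧ y * a = h₁ * g * h₂ := by
  have : CharZero L := charZero_of_injective_algebraMap (algebraMap K L).injective
  set β := B.baseChange L with hβ
  have hβn : β.Nondegenerate := nondegenerate_baseChange B hs hB L
  have hβs : ∀ v w, β v w = β w v := baseChange_comm B hs L
  set x : orthogonalPoints B L := g * ε * g⁻¹ * ε with hx
  have hxε : x * (ε * x * ε) = 1 := by
    rw [hx]
    calc _ = g * ε * g⁻¹ * (ε * ε) * g * ε * g⁻¹ * (ε * ε) := by simp only [mul_assoc]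
      _ = g * (ε * (g⁻¹ * g)  * ε) * g⁻¹ := by rw [hε]; simp only [mul_assoc, mul_one]
      _ = 1 := by rw [inv_mul_cancel, mul_one, hε, mul_one, mul_inv_cancel]
  have hε' : ε.1.1 * ε.1.1 = 1 := congrArg (fun z : orthogonalPoints B L => z.1.1) hε
  have hxε' : x.1.1 * (ε.1.1 * x.1.1 * ε.1.1) = 1 :=
    congrArg (fun z : orthogonalPoints B L => z.1.1) hxε
  obtain ⟨s, hsA, M, hMA, hss, hMn, hsM, hεs, hεM, hxM⟩ :=
    Module.End.exists_semisimple_nilpotent_cayley ε.1.1 x.1.1 hε' hxε'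
  have hxβ : ∀ v w, β (x.1.1 v) w = β v (ε.1.1 (x.1.1 (ε.1.1 w))) := by
    intro v w
    have h := x.2 v (ε.1.1 (x.1.1 (ε.1.1 w)))
    have h2 : x.1.1 (ε.1.1 (x.1.1 (ε.1.1 w))) = w := LinearMap.congr_fun hxε' w
    rw [h2] at h
    exact h
  have hxc : Commute x.1.1 (ε.1.1 * x.1.1 * ε.1.1) := hxε'.trans (mul_eq_one_comm.1 hxε').symm
  have hadj : ∀ {e}, e ∈ Algebra.adjoin L {x.1.1, ε.1.1 * x.1.1 * ε.1.1} → ∀ v w,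
      β (e v) w = β v (ε.1.1 (e (ε.1.1 w))) := fun he =>
    Module.End.adjoint_eq_conj_of_mem_adjoin β hε' ε.2 hxβ hxc he
  have hskew : ∀ v w, β (M v) w = -β v (M w) := by
    intro v w
    have h2 : ε.1.1 (M (ε.1.1 w)) = -M w := LinearMap.congr_fun hεM w
    rw [hadj hMA, h2, map_neg]
  have hsβ : ∀ v w, β (s v) (s w) = β v w := by
    intro v w
    have h2 : ε.1.1 (s (ε.1.1 (s w))) = w := LinearMap.congr_fun hεs w
    rw [hadj hsA, h2]
  set y := cayley B hMn hskew with hy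
  have hyM : y.1.1 * (1 - M) = 1 + M := cayley_mul B hMn hskew
  -- Conjugation by `ε` changes the sign of `M`, which exchanges numerator and denominator of the
  -- Cayley transform.
  have hεy : ε * y * ε = y⁻¹ := by
    refine eq_inv_of_mul_eq_one_left ?_
    refine Subtype.ext (Units.ext ?_)
    change ε.1.1 * y.1.1 * ε.1.1 * y.1.1 = 1
    refine (isUnit_one_sub_end hMn).mul_left_injective ?_
    change ε.1.1 * y.1.1 * ε.1.1 * y.1.1 * (1 - M) = 1 * (1 - M)
    have h1 := (conj_one_sub_of_conj_eq_neg (A := Module.End L (L ⊗[K] W)) hε' hεM).symm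
    rw [mul_assoc, hyM, h1]
    calc _ = ε.1.1 * y.1.1 * (ε.1.1 * ε.1.1) * (1 - M) * ε.1.1 := by simp only [mul_assoc]
      _ = ε.1.1 * (y.1.1 * (1 - M)) * ε.1.1 := by rw [hε']; simp only [mul_assoc, mul_one]
      _ = _ := by
        rw [hyM, one_mul]
        exact conj_one_add_of_conj_eq_neg (A := Module.End L (L ⊗[K] W)) hε' hεM
  -- The unipotent factor is removed symmetrically: the symmetrization of `a` is `y⁻¹ x y⁻¹ = s`.
  set a := y⁻¹ * g with ha
  have hsa : a * ε * a⁻¹ * ε = y⁻¹ * x * y⁻¹ := by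
    have h1 : y * ε = ε * y⁻¹ := by
      rw [← hεy]; simp only [← mul_assoc, hε, one_mul]
    rw [ha, hx, mul_inv_rev, inv_inv]
    calc _ = y⁻¹ * g * ε * g⁻¹ * (y * ε) := by simp only [mul_assoc]
      _ = _ := by rw [h1]; simp only [mul_assoc]
  have hsa' : (a * ε * a⁻¹ * ε).1.1 = s := by
    rw [hsa]
    have h1 : x.1.1 = y.1.1 * s * y.1.1 := by
      refine ((isUnit_one_sub_end hMn).pow 2).mul_left_injective ?_
      change x.1.1 * (1 - M) ^ 2 = y.1.1 * s * y.1.1 * (1 - M) ^ 2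
      rw [hxM]
      exact (mul_mul_mul_one_sub_sq (A := Module.End L (L ⊗[K] W)) hsM hyM).symm
    change (y⁻¹).1.1 * x.1.1 * (y⁻¹).1.1 = s
    have h2 : (y⁻¹).1.1 * y.1.1 = 1 := Units.inv_mul y.1
    have h3 : y.1.1 * (y⁻¹).1.1 = 1 := Units.mul_inv y.1
    rw [h1, ← mul_assoc, ← mul_assoc, h2, one_mul, mul_assoc, h3, mul_one]
  refine ⟨M, hMn, hskew, a, hsa' ▸ hss, fun c hc z hz => ?_⟩
  obtain ⟨h, hu, hhβ, hhε, hhs, hhM⟩ := Module.End.exists_isometry_conj_eq_smul β hβn hβs hε' ε.2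
    hss hsβ hεs hMn hskew hεM hsM hc
  obtain ⟨h, rfl⟩ := hu
  let h' : orthogonalPoints B L := ⟨h, hhβ⟩
  have hh'ε : Commute h' ε := Subtype.ext (Units.ext hhε)
  have hh's : Commute h' (a * ε * a⁻¹ * ε) := by
    refine Subtype.ext (Units.ext ?_)
    change h.1 * (a * ε * a⁻¹ * ε).1.1 = (a * ε * a⁻¹ * ε).1.1 * h.1
    rw [hsa']
    exact hhs
  -- `a ε a⁻¹` is the symmetrization of `a` times `ε`, and `h'` commutes with both. This is what
  -- makes `a⁻¹ h'⁻¹ a` commute with `ε`.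
  have hh'a : Commute h' (a * ε * a⁻¹) := by
    have h1 := hh's.mul_right hh'ε
    rwa [mul_assoc, hε, mul_one] at h1
  have hzy : z * h' = h' * y := by
    refine Subtype.ext (Units.ext ?_)
    change z.1.1 * h.1 = h.1 * y.1.1
    refine (isUnit_one_sub_end hMn).mul_left_injective ?_
    change z.1.1 * h.1 * (1 - M) = h.1 * y.1.1 * (1 - M)
    exact mul_mul_one_sub_of_conj_eq_smul (A := Module.End L (L ⊗[K] W)) hhM hyM hz
  -- From `z = h' y h'⁻¹` and `g = y a` one gets `z a = h' g (a⁻¹ h'⁻¹ a)`.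
  refine ⟨h', a⁻¹ * h'⁻¹ * a, ?_, ?_, ?_⟩
  · rw [← hh'ε.eq, mul_assoc, hε, mul_one]
  · have h1 : h'⁻¹ * (a * ε * a⁻¹) = (a * ε * a⁻¹) * h'⁻¹ := hh'a.inv_left.eq
    have h2 : ε * (a⁻¹ * h'⁻¹ * a) * ε = ε * a⁻¹ * (h'⁻¹ * (a * ε * a⁻¹)) * a := by
      simp only [mul_assoc, inv_mul_cancel, mul_one]
    rw [h2, h1]
    simp only [← mul_assoc]
    rw [inv_mul_cancel_right, hε, one_mul]
  · have h1 : z = h' * y * h'⁻¹ := by rw [← hzy, mul_inv_cancel_right]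
    have h2 : g = y * a := by rw [ha, mul_inv_cancel_left]
    rw [h1, h2]
    simp only [mul_assoc, mul_inv_cancel_left]

end Degeneration

/-! ### Closed double cosets have semisimple symmetrizations. -/

section Closed

variable {F : Type u} [Field F] {V : Type u} [AddCommGroup V] [Module F V]
  (B : LinearMap.BilinForm F V)

theorem extendEnd_skew {R S : Type u} [CommRing R] [Algebra F R] [CommRing S] [Algebra F S]
    (f : R →ₐ[F] S) {M : Module.End R (R ⊗[F] V)}
    (h : ∀ x y, B.baseChange R (M x) y = -B.baseChange R x (M y)) (x y : S ⊗[F] V) :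
    B.baseChange S (extendEnd f M x) y = -B.baseChange S x (extendEnd f M y) := by
  have key : (B.baseChange S).comp (extendEnd f M) LinearMap.id =
      -(B.baseChange S).comp LinearMap.id (extendEnd f M) := by
    ext w w'
    have h1 : ∀ w : V, (1 : S) ⊗ₜ[F] w = f.toLinearMap.rTensor V (1 ⊗ₜ w) := by
      intro w; simp
    change B.baseChange S (extendEnd f M (1 ⊗ₜ w)) (1 ⊗ₜ w') =
      -B.baseChange S (1 ⊗ₜ w) (extendEnd f M (1 ⊗ₜ w'))
    rw [h1, h1, extendEnd_rTensor, extendEnd_rTensor, baseChange_rTensor, baseChange_rTensor, h,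
      map_neg]
  exact LinearMap.congr_fun₂ key x y

/-- If the values of a polynomial family of points of `G` at all nonzero parameters lie in a Zariski
closed set, then so does the value at `0`. -/
theorem IsZariskiClosed.eval_zero_mem {G : GroupFunctor F} {Z : Set (G.pts (AlgebraicClosure F))}
    (hZ : IsZariskiClosed G Z) (γ : G.pts (Polynomial (AlgebraicClosure F)))
    (h : ∀ c : AlgebraicClosure F, c ≠ 0 →
      G.map ((Polynomial.aeval (R := AlgebraicClosure F) c).restrictScalars F) γ ∈ Z) :
    G.map ((Polynomial.aeval (R := AlgebraicClosure F) (0 : AlgebraicClosure F)).restrictScalars F)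
      γ ∈ Z := by
  obtain ⟨T, rfl⟩ := hZ
  intro φ hφ
  rw [φ.eval_map]
  -- The value of `φ` on the family is a polynomial in the parameter, and it vanishes at all nonzero
  -- elements of an infinite field.
  have h0 : φ.eval _ γ = 0 := by
    refine Polynomial.eq_zero_of_infinite_isRoot _ ?_
    refine Set.Infinite.mono (s := {c | c ≠ 0}) ?_ (Set.finite_singleton 0).infinite_compl
    intro c hc
    have h1 := h c hc φ hφ
    rw [φ.eval_map, Polynomial.coe_aeval_eq_eval] at h1
    exact h1
  rw [h0, map_zero]

/-- If the double coset of `g` is closed, then `s(g)` is semisimple. -/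
theorem isSemisimple_s_of_isZariskiClosed [CharZero F] [FiniteDimensional F V] (hs : B.IsSymm)
    (hB : B.Nondegenerate) (ε : (orthogonalGroup B).pts F) (hε : orderOf ε = 2)
    (g : (orthogonalGroup B).pts F)
    (hcl : IsZariskiClosed (orthogonalGroup B)
      ((SymPair.ofElement (orthogonalGroup B) ε hε).doubleCoset g)) :
    Module.End.IsSemisimple (show orthogonalPoints B F from
      (SymPair.ofElement (orthogonalGroup B) ε hε).s F g).1.1 := by
  set L := AlgebraicClosure F
  let f : F →ₐ[F] L := Algebra.ofId F L
  let ε' : orthogonalPoints B L := (orthogonalGroup B).map f ε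
  let g' : orthogonalPoints B L := (orthogonalGroup B).map f g
  have hε2 : ε * ε = 1 := by rw [← pow_two, ← hε, pow_orderOf_eq_one]
  have hε' : ε' * ε' = 1 := ((orthogonalGroup B).map f).map_mul ε ε ▸
    (congrArg _ hε2).trans (map_one ((orthogonalGroup B).map f))
  obtain ⟨M, hM, hskew, a, hss, hfam⟩ := exists_degeneration B hs hB L ε' g' hε'
  let A := Polynomial L
  let j : L →ₐ[F] A := IsScalarTower.toAlgHom F L A
  let MA : Module.End A (A ⊗[F] V) := (Polynomial.X : A) • extendEnd j M
  have hMA : IsNilpotent MA := by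
    obtain ⟨n, hn⟩ := hM
    refine ⟨n, ?_⟩
    rw [smul_pow, ← extendEndHom_apply, ← map_pow, hn, map_zero, smul_zero]
  have hMAskew : ∀ x y, B.baseChange A (MA x) y = -B.baseChange A x (MA y) := by
    intro x y
    simp only [MA, LinearMap.smul_apply, map_smul, extendEnd_skew B j hskew, smul_neg]
  let aA : orthogonalPoints B A := (orthogonalGroup B).map j a
  -- The whole curve as one point over the polynomial ring. No denominators occur: `X • M` is
  -- nilpotent, so `1 - X • M` is already invertible there.
  let γ : orthogonalPoints B A := cayley B hMA hMAskew * aA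
  have hev : ∀ c : L, ∃ y : orthogonalPoints B L, y.1.1 * (1 - c • M) = 1 + c • M ∧
      (orthogonalGroup B).map ((Polynomial.aeval (R := L) c).restrictScalars F) γ = y * a := by
    intro c
    set e : A →ₐ[F] L := (Polynomial.aeval (R := L) c).restrictScalars F with he
    have hej : e.comp j = AlgHom.id F L := by
      ext x
      simp [he, j]
    have hMc : extendEnd e MA = c • M := by
      rw [extendEnd_smul, extendEnd_comp, hej, extendEnd_id]
      congr 1
      exact Polynomial.aeval_X c
    refine ⟨(orthogonalGroup B).map e (cayley B hMA hMAskew), ?_, ?_⟩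
    · change extendEnd e (cayley B hMA hMAskew).1.1 * (1 - c • M) = 1 + c • M
      rw [← hMc]
      have h := congrArg (extendEndHom e) (cayley_mul B hMA hMAskew)
      rw [map_mul, map_add, map_one] at h
      have h2 : extendEndHom e (1 - MA) = 1 - extendEndHom e MA :=
        (map_sub (extendEndHom (W := V) e) 1 MA).trans (by rw [map_one])
      rw [h2] at h
      exact h
    · have h1 : (orthogonalGroup B).map e aA = a := by
        have h2 := (orthogonalGroup B).map_comp e j a
        rw [hej] at h2
        exact h2.symm.trans ((orthogonalGroup B).map_id L a)
      exact (map_mul ((orthogonalGroup B).map e) (cayley B hMA hMAskew) aA).trans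
        (congrArg _ h1)
  have hmem : (show (orthogonalGroup B).pts L from a) ∈
      (SymPair.ofElement (orthogonalGroup B) ε hε).doubleCoset g := by
    have h0 := hcl.eval_zero_mem γ (by
      intro c hc
      obtain ⟨y, hy, hy'⟩ := hev c
      obtain ⟨h₁, h₂, hh₁, hh₂, hh⟩ := hfam c hc y hy
      exact ⟨h₁, hh₁, h₂, hh₂, hy'.trans hh⟩)
    obtain ⟨y, hy, hy'⟩ := hev 0
    have hy1 : y = 1 := by
      rw [zero_smul, add_zero] at hy
      refine Subtype.ext (Units.ext (Eq.trans ?_ hy))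
      change y.1.1 = y.1.1 * (1 - 0)
      rw [show (1 - 0 : Module.End L (L ⊗[F] V)) = 1 from sub_zero (1 : Module.End L (L ⊗[F] V)),
        mul_one]
    rw [hy', hy1, one_mul] at h0
    exact h0
  obtain ⟨h₁, h₂, hh₁, hh₂, hh⟩ : ∃ h₁ h₂ : orthogonalPoints B L, ε' * h₁ * ε' = h₁ ∧
      ε' * h₂ * ε' = h₂ ∧ a = h₁ * g' * h₂ := by
    obtain ⟨h₁, hh₁, h₂, hh₂, hh⟩ := hmem
    exact ⟨h₁, h₂, hh₁, hh₂, hh⟩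
  -- From `a = h₁ g' h₂` the symmetrizations of `g'` and `a` are conjugate by `h₁`, and that of `a`
  -- is semisimple.
  have hx : Module.End.IsSemisimple (g' * ε' * g'⁻¹ * ε').1.1 := by
    have e1 : ∀ h : orthogonalPoints B L, ε' * h * ε' = h → h * ε' = ε' * h := by
      intro h hh
      conv_lhs => rw [← hh]
      rw [mul_assoc, hε', mul_one]
    have e2 : ε' * h₂ = h₂ * ε' := (e1 h₂ hh₂).symm
    have h1 : g' * ε' * g'⁻¹ * ε' = h₁⁻¹ * (a * ε' * a⁻¹ * ε') * h₁ := by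
      have e3 : h₁ * ε' = ε' * h₁ := e1 h₁ hh₁
      rw [hh]
      calc _ = g' * (ε' * h₂ * h₂⁻¹) * g'⁻¹ * ε' := by rw [mul_inv_cancel_right]
        _ = g' * h₂ * ε' * h₂⁻¹ * g'⁻¹ * (h₁⁻¹ * (h₁ * ε')) := by
          rw [e2, inv_mul_cancel_left]; simp only [mul_assoc]
        _ = _ := by
          rw [e3, mul_inv_rev, mul_inv_rev]; simp only [mul_assoc, inv_mul_cancel_left]
    rw [h1]
    exact hss.conj_unit _
  refine Module.End.IsSemisimple.of_extendEnd (L := L) _ ?_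
  have h1 : (orthogonalGroup B).map f ((SymPair.ofElement (orthogonalGroup B) ε hε).s F g) =
      g' * ε' * g'⁻¹ * ε' := by
    change (orthogonalGroup B).map f (g * ((orthogonalGroup B).map (Algebra.ofId F F) ε * g⁻¹ *
      (orthogonalGroup B).map (Algebra.ofId F F) ε)) = _
    rw [map_mul, map_mul, map_mul, map_inv, ← (orthogonalGroup B).map_comp,
      Subsingleton.elim (f.comp (Algebra.ofId F F)) f]
    change g' * (ε' * g'⁻¹ * ε') = _
    simp only [mul_assoc]
  rw [← h1] at hx
  exact hx

end Closed

/-! ### Isomorphisms and products of symmetric pairs. -/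

namespace SymPair

variable {K : Type u} [Field K]

/-- Composition of isomorphisms of symmetric pairs. -/
def Iso.trans {P Q T : SymPair K} (a : Iso P Q) (b : Iso Q T) : Iso P T where
  toEquiv R _ _ := (a.toEquiv R).trans (b.toEquiv R)
  map_comm f g := by
    change b.toEquiv _ (a.toEquiv _ _) = _
    rw [a.map_comm, b.map_comm]; rfl
  θ_comm R _ _ g := by
    change b.toEquiv _ (a.toEquiv _ _) = _
    rw [a.θ_comm, b.θ_comm]; rfl

/-- Restriction of scalars of isomorphisms of symmetric pairs. -/
def Iso.res (F : Type u) [Field F] [Algebra F K] {P Q : SymPair K} (a : Iso P Q) :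
    Iso (P.res F) (Q.res F) where
  toEquiv R _ _ := a.toEquiv (K ⊗[F] R)
  map_comm _ g := a.map_comm _ g
  θ_comm _ _ _ g := a.θ_comm _ g

/-- A family of isomorphisms onto `P₀ × ∏ Pᵢ` gives an isomorphism onto the product of the family
`P₀, P₁, …`. -/
def Iso.toProdCons {n : ℕ} {D P₀ Q : SymPair K} {P : Fin n → SymPair K}
    (e : ∀ (R : Type u) [CommRing R] [Algebra K R], D.G.pts R ≃* P₀.G.pts R × Q.G.pts R)
    (map_comm : ∀ {R S : Type u} [CommRing R] [Algebra K R] [CommRing S] [Algebra K S]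
      (f : R →ₐ[K] S) (g : D.G.pts R),
      e S (D.G.map f g) = (P₀.G.map f (e R g).1, Q.G.map f (e R g).2))
    (θ_comm : ∀ (R : Type u) [CommRing R] [Algebra K R] (g : D.G.pts R),
      e R (D.θ R g) = (P₀.θ R (e R g).1, Q.θ R (e R g).2))
    (b : Iso Q (prod P)) :
    Iso D (prod (Fin.cons P₀ P : Fin (n + 1) → SymPair K)) where
  toEquiv R _ _ :=
    { toFun := fun g => Fin.cons (α := fun i => ((Fin.cons P₀ P : Fin (n + 1) → SymPair K) i).G.pts R)
        (e R g).1 (b.toEquiv R (e R g).2)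
      invFun := fun g => (e R).symm (g 0, (b.toEquiv R).symm fun i => g i.succ)
      left_inv := fun g => (e R).symm_apply_eq.2
        (Prod.ext rfl ((b.toEquiv R).symm_apply_apply _))
      right_inv := fun g => funext fun i => by
        refine Fin.cases ?_ (fun j => ?_) i
        · exact congrArg Prod.fst ((e R).apply_symm_apply
            (g 0, (b.toEquiv R).symm fun i => g i.succ))
        · exact (congrArg (fun p => b.toEquiv R p.2 j) ((e R).apply_symm_apply
            (g 0, (b.toEquiv R).symm fun i => g i.succ))).trans
            (congrFun ((b.toEquiv R).apply_symm_apply fun i => g i.succ) j)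
      map_mul' := fun g g' => by
        funext i
        refine Fin.cases ?_ (fun j => ?_) i
        · exact congrArg Prod.fst (map_mul (e R) g g')
        · change b.toEquiv R (e R (g * g')).2 j = _
          rw [map_mul, Prod.snd_mul, map_mul]
          rfl }
  map_comm f g := by
    funext i
    refine Fin.cases ?_ (fun j => ?_) i
    · exact congrArg Prod.fst (map_comm f g)
    · change b.toEquiv _ (e _ _).2 j = _
      rw [map_comm, b.map_comm]
      rfl
  θ_comm R _ _ g := by
    funext i
    refine Fin.cases ?_ (fun j => ?_) i
    · exact congrArg Prod.fst (θ_comm R g)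
    · change b.toEquiv _ (e _ _).2 j = _
      rw [θ_comm, b.θ_comm]
      rfl

/-- A pair whose groups of points are trivial is the empty product. -/
def Iso.ofSubsingleton (D : SymPair K)
    (h : ∀ (R : Type u) [CommRing R] [Algebra K R], Subsingleton (D.G.pts R))
    (P : Fin 0 → SymPair K) : Iso D (prod P) where
  toEquiv R _ _ :=
    { toFun := fun _ i => i.elim0
      invFun := fun _ => 1
      left_inv := fun _ => (h R).elim _ _
      right_inv := fun _ => funext fun i => i.elim0
      map_mul' := fun _ _ => funext fun i => i.elim0 }
  map_comm _ _ := funext fun i => i.elim0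
  θ_comm _ _ _ _ := funext fun i => i.elim0

end SymPair

/-! ### Base change of linear maps and of bilinear forms. -/

section BaseChange

variable {K : Type u} [Field K] {V W W' : Type u} [AddCommGroup V] [Module K V]
  [AddCommGroup W] [Module K W] [AddCommGroup W'] [Module K W']

theorem baseChange_apply_rTensor {R S : Type u} [CommRing R] [Algebra K R] [CommRing S]
    [Algebra K S] (f : R →ₐ[K] S) (i : W →ₗ[K] V) (z : R ⊗[K] W) :
    i.baseChange S (f.toLinearMap.rTensor W z) = f.toLinearMap.rTensor V (i.baseChange R z) := by
  induction z with
  | zero => simp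
  | add x y hx hy => simp only [map_add, hx, hy]
  | tmul a w => simp

theorem extendEnd_baseChange {R S : Type u} [CommRing R] [Algebra K R] [CommRing S]
    [Algebra K S] (f : R →ₐ[K] S) (Y : Module.End K W) :
    extendEnd f (Y.baseChange R) = Y.baseChange S :=
  end_ext fun w => by simp [extendEnd_tmul]

/-- To compare an extension of scalars with another endomorphism, it is enough to look at the
image of `R ⊗ W`. -/
theorem extendEnd_eq_of_rTensor {R S : Type u} [CommRing R] [Algebra K R] [CommRing S]
    [Algebra K S] (f : R →ₐ[K] S) (φ : Module.End R (R ⊗[K] W)) (ψ : Module.End S (S ⊗[K] W))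
    (h : ∀ z, ψ (f.toLinearMap.rTensor W z) = f.toLinearMap.rTensor W (φ z)) :
    ψ = extendEnd f φ := by
  refine end_ext fun w => ?_
  have h1 : (1 : S) ⊗ₜ[K] w = f.toLinearMap.rTensor W (1 ⊗ₜ w) := by simp
  rw [h1, h, extendEnd_rTensor]

/-- A relation between bilinear forms is preserved by extension of scalars. -/
theorem baseChange_form_relation (B : LinearMap.BilinForm K V) (B' : LinearMap.BilinForm K W')
    {X Y : W →ₗ[K] V} {X' Y' : W →ₗ[K] W'}
    (h : ∀ v w, B (X v) (Y w) = B' (X' v) (Y' w)) (R : Type u) [CommRing R] [Algebra K R]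
    (z z' : R ⊗[K] W) :
    B.baseChange R (X.baseChange R z) (Y.baseChange R z') =
      B'.baseChange R (X'.baseChange R z) (Y'.baseChange R z') := by
  induction z with
  | zero => simp
  | add x x' hx hx' => simp only [map_add, LinearMap.add_apply, hx, hx']
  | tmul a w =>
    induction z' with
    | zero => simp
    | add y y' hy hy' => simp only [map_add, hy, hy']
    | tmul b w' => simp [h]

end BaseChange

/-! ### The symmetric pair of an involution and an endomorphism. -/

section CentralizerPair

variable {K : Type u} [Field K] {V : Type u} [AddCommGroup V] [Module K V]

/-- An isometric involution `ε` of `(V, B)` together with an endomorphism `Y` whose adjoint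
is `ε Y ε`. -/
structure InvolutionDatum (B : LinearMap.BilinForm K V) (ε Y : Module.End K V) : Prop where
  involutive : ∀ v, ε (ε v) = v
  isometry : ∀ v w, B (ε v) (ε w) = B v w
  adjoint : ∀ v w, B (Y v) w = B v (ε (Y (ε w)))

/-- The `R`-points of the centralizer of `Y` in `O(V)`. -/
def centralizerPoints (B : LinearMap.BilinForm K V) (Y : Module.End K V) (R : Type u) [CommRing R]
    [Algebra K R] : Subgroup (LinearMap.GeneralLinearGroup R (R ⊗[K] V)) where
  carrier := {g | g ∈ orthogonalPoints B R ∧ ∀ z, g.1 (Y.baseChange R z) = Y.baseChange R (g.1 z)}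
  mul_mem' := by
    rintro a b ⟨ha, ha'⟩ ⟨hb, hb'⟩
    refine ⟨mul_mem ha hb, fun z => ?_⟩
    change a.1 (b.1 _) = Y.baseChange R (a.1 (b.1 z))
    rw [hb', ha']
  one_mem' := ⟨one_mem _, fun _ => rfl⟩
  inv_mem' := by
    rintro a ⟨ha, ha'⟩
    refine ⟨inv_mem ha, fun z => ?_⟩
    conv_lhs => rw [← gl_apply_inv_apply a z, ← ha', gl_inv_apply_apply]

theorem extendGL_mem_centralizerPoints (B : LinearMap.BilinForm K V) (Y : Module.End K V)
    {R S : Type u} [CommRing R] [Algebra K R] [CommRing S] [Algebra K S] (f : R →ₐ[K] S)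
    {g : LinearMap.GeneralLinearGroup R (R ⊗[K] V)} (hg : g ∈ centralizerPoints B Y R) :
    extendGL f g ∈ centralizerPoints B Y S := by
  refine ⟨extendGL_preserves B f g g hg.1, fun z => ?_⟩
  have h1 : g.1 * Y.baseChange R = Y.baseChange R * g.1 := LinearMap.ext hg.2
  have h2 := congrArg (extendEnd f) h1
  rw [extendEnd_mul, extendEnd_mul, extendEnd_baseChange] at h2
  exact LinearMap.congr_fun h2 z

/-- The centralizer of `Y` in `O(V)`, as a group functor. -/
noncomputable def centralizerGroup (B : LinearMap.BilinForm K V) (Y : Module.End K V) :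
    GroupFunctor K where
  pts := fun R _ _ => centralizerPoints B Y R
  grp := fun _ _ _ => inferInstance
  map := fun f => ((extendGL f).comp (Subgroup.subtype _)).codRestrict _
    fun g => extendGL_mem_centralizerPoints B Y f g.2
  map_id := fun _ _ _ g => Subtype.ext (extendGL_id g.1)
  map_comp := fun f' f g => Subtype.ext (extendGL_comp f' f g.1)

variable {B : LinearMap.BilinForm K V} {ε Y : Module.End K V}

theorem InvolutionDatum.baseChange_involutive (h : InvolutionDatum B ε Y) (R : Type u) [CommRing R]
    [Algebra K R] (z : R ⊗[K] V) : ε.baseChange R (ε.baseChange R z) = z := by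
  rw [← LinearMap.comp_apply, ← LinearMap.baseChange_comp,
    show ε ∘ₗ ε = LinearMap.id from LinearMap.ext h.involutive, LinearMap.baseChange_id]
  rfl

theorem InvolutionDatum.baseChange_isometry (h : InvolutionDatum B ε Y) (R : Type u) [CommRing R]
    [Algebra K R] (z z' : R ⊗[K] V) :
    B.baseChange R (ε.baseChange R z) (ε.baseChange R z') = B.baseChange R z z' := by
  have := baseChange_form_relation B B (X := ε) (Y := ε) (X' := LinearMap.id) (Y' := LinearMap.id)
    h.isometry R z z'
  simpa using this

theorem InvolutionDatum.baseChange_adjoint (h : InvolutionDatum B ε Y) (R : Type u) [CommRing R]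
    [Algebra K R] (z z' : R ⊗[K] V) :
    B.baseChange R (Y.baseChange R z) z' =
      B.baseChange R z (ε.baseChange R (Y.baseChange R (ε.baseChange R z'))) := by
  have := baseChange_form_relation B B (X := Y) (Y := LinearMap.id) (X' := LinearMap.id)
    (Y' := ε ∘ₗ Y ∘ₗ ε) h.adjoint R z z'
  simpa [LinearMap.baseChange_comp] using this

/-- The involution `ε` as an `R`-point of `GL(V)`. -/
noncomputable def InvolutionDatum.point (h : InvolutionDatum B ε Y) (R : Type u) [CommRing R]
    [Algebra K R] : LinearMap.GeneralLinearGroup R (R ⊗[K] V) :=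
  ⟨ε.baseChange R, ε.baseChange R, LinearMap.ext (h.baseChange_involutive R),
    LinearMap.ext (h.baseChange_involutive R)⟩

variable [FiniteDimensional K V]

/-- Elements of the centralizer of `Y` commute with the adjoint of `Y`. -/
theorem InvolutionDatum.commute_adjoint (h : InvolutionDatum B ε Y) (hs : B.IsSymm)
    (hB : B.Nondegenerate) {R : Type u} [CommRing R] [Algebra K R]
    {g : LinearMap.GeneralLinearGroup R (R ⊗[K] V)} (hg : g ∈ centralizerPoints B Y R)
    (z : R ⊗[K] V) :
    g.1 (ε.baseChange R (Y.baseChange R (ε.baseChange R z))) =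
      ε.baseChange R (Y.baseChange R (ε.baseChange R (g.1 z))) := by
  refine sub_eq_zero.1 (eq_zero_of_baseChange_eq_zero B hB R fun y => ?_)
  -- Against a test vector of the form `g y` the isometry `g` can be cancelled, and the claim
  -- becomes that `g` commutes with `Y`.
  obtain ⟨y, rfl⟩ : ∃ y', g.1 y' = y := ⟨(g⁻¹).1 y, gl_apply_inv_apply g y⟩
  rw [baseChange_comm B hs, map_sub, sub_eq_zero, hg.1, ← h.baseChange_adjoint,
    ← h.baseChange_adjoint, ← hg.2, hg.1]

theorem InvolutionDatum.conj_mem (h : InvolutionDatum B ε Y) (hs : B.IsSymm)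
    (hB : B.Nondegenerate) {R : Type u} [CommRing R] [Algebra K R]
    {g : LinearMap.GeneralLinearGroup R (R ⊗[K] V)} (hg : g ∈ centralizerPoints B Y R) :
    h.point R * g * h.point R ∈ centralizerPoints B Y R := by
  refine ⟨fun x y => ?_, fun z => ?_⟩
  · change B.baseChange R (ε.baseChange R (g.1 (ε.baseChange R x)))
      (ε.baseChange R (g.1 (ε.baseChange R y))) = _
    rw [h.baseChange_isometry, hg.1, h.baseChange_isometry]
  · change ε.baseChange R (g.1 (ε.baseChange R (Y.baseChange R z))) =
      Y.baseChange R (ε.baseChange R (g.1 (ε.baseChange R z)))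
    have h1 := h.commute_adjoint hs hB hg (ε.baseChange R z)
    rw [h.baseChange_involutive] at h1
    rw [h1, h.baseChange_involutive]

/-- The symmetric pair formed by the centralizer of `Y` in `O(V)` and the involution
`g ↦ ε g ε`. -/
noncomputable def centralizerPair (hs : B.IsSymm) (hB : B.Nondegenerate)
    (h : InvolutionDatum B ε Y) : SymPair K where
  G := centralizerGroup B Y
  θ := fun R _ _ =>
    { toFun := fun g => ⟨h.point R * g.1 * h.point R, h.conj_mem hs hB g.2⟩
      map_one' := Subtype.ext (Units.ext (LinearMap.ext (h.baseChange_involutive R)))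
      map_mul' := fun g g' => Subtype.ext (Units.ext (LinearMap.ext fun z => by
        change _ = ε.baseChange R (g.1.1 (ε.baseChange R (ε.baseChange R (g'.1.1 _))))
        rw [h.baseChange_involutive]
        rfl)) }
  θ_θ := fun R _ _ g => Subtype.ext (Units.ext (LinearMap.ext fun z => by
    change ε.baseChange R (ε.baseChange R (g.1.1 (ε.baseChange R (ε.baseChange R z)))) = _
    rw [h.baseChange_involutive, h.baseChange_involutive]))
  θ_map := fun {R S} _ _ _ _ f g => Subtype.ext (Units.ext (by
    change (ε.baseChange S * extendEnd f g.1.1 * ε.baseChange S : Module.End S (S ⊗[K] V)) =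
      extendEnd f (ε.baseChange R * g.1.1 * ε.baseChange R)
    rw [extendEnd_mul, extendEnd_mul, extendEnd_baseChange]))

/-- Elements of the centralizer of `Y` commute with the algebra generated by `Y` and its
adjoint. -/
theorem InvolutionDatum.commute_of_mem_adjoin (h : InvolutionDatum B ε Y) (hs : B.IsSymm)
    (hB : B.Nondegenerate) {R : Type u} [CommRing R] [Algebra K R]
    {g : LinearMap.GeneralLinearGroup R (R ⊗[K] V)} (hg : g ∈ centralizerPoints B Y R)
    {e : Module.End K V} (he : e ∈ Algebra.adjoin K {Y, ε * Y * ε}) (z : R ⊗[K] V) :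
    g.1 (e.baseChange R z) = e.baseChange R (g.1 z) := by
  induction he using Algebra.adjoin_induction generalizing z with
  | mem a ha =>
    rcases ha with rfl | ha
    · exact hg.2 z
    · have : (a.baseChange R : Module.End R (R ⊗[K] V)) =
          ε.baseChange R ∘ₗ Y.baseChange R ∘ₗ ε.baseChange R := by
        rw [← LinearMap.baseChange_comp, ← LinearMap.baseChange_comp]
        exact congrArg _ (Set.mem_singleton_iff.1 ha)
      rw [this]
      exact h.commute_adjoint hs hB hg z
  | algebraMap r =>
    have : ∀ z : R ⊗[K] V, (algebraMap K (Module.End K V) r).baseChange R z =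
        algebraMap K R r • z := by
      intro z
      rw [Algebra.algebraMap_eq_smul_one, LinearMap.baseChange_smul]
      simp [Module.End.one_eq_id]
    rw [this, this, map_smul]
  | add a b _ _ ha hb =>
    rw [LinearMap.baseChange_add, LinearMap.add_apply, LinearMap.add_apply, map_add, ha, hb]
  | mul a b _ _ ha hb =>
    rw [Module.End.mul_eq_comp, LinearMap.baseChange_comp, LinearMap.comp_apply,
      LinearMap.comp_apply, ha, hb]

end CentralizerPair

/-! ### Orthogonal direct summands stable under the involution. -/

section Retract

variable {K : Type u} [Field K] {V W : Type u} [AddCommGroup V] [Module K V]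
  [AddCommGroup W] [Module K W]

/-- A direct summand `W` of `V`, with inclusion `i` and projection `π`, such that `i π` is
self-adjoint, commutes with `ε` and `Y`, and lies in the algebra generated by `Y` and its
adjoint. -/
structure OrthogonalRetract (B : LinearMap.BilinForm K V) (ε Y : Module.End K V) (i : W →ₗ[K] V)
    (π : V →ₗ[K] W) : Prop where
  retract : ∀ w, π (i w) = w
  mem_adjoin : i ∘ₗ π ∈ Algebra.adjoin K {Y, ε * Y * ε}
  comm_involution : ∀ v, ε (i (π v)) = i (π (ε v))
  comm : ∀ v, Y (i (π v)) = i (π (Y v))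
  selfAdjoint : ∀ v w, B (i (π v)) w = B v (i (π w))

variable {B : LinearMap.BilinForm K V} {ε Y : Module.End K V} {i : W →ₗ[K] V} {π : V →ₗ[K] W}

namespace OrthogonalRetract

/-- Self-adjointness of `i π` makes `ker π` orthogonal to `W`, so only the `W`-component of `v`
matters. Nondegeneracy on `W` follows from this. -/
theorem form_eq (r : OrthogonalRetract B ε Y i π) (w : W) (v : V) :
    B (i w) v = B (i w) (i (π v)) := by
  rw [← r.selfAdjoint, r.retract]

theorem datum (r : OrthogonalRetract B ε Y i π) (h : InvolutionDatum B ε Y) :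
    InvolutionDatum (B.comp i i) (π ∘ₗ ε ∘ₗ i) (π ∘ₗ Y ∘ₗ i) where
  involutive v := by
    change π (ε (i (π (ε (i v))))) = v
    rw [← r.comm_involution, h.involutive, r.retract, r.retract]
  isometry v w := by
    change B (i (π (ε (i v)))) (i (π (ε (i w)))) = B (i v) (i w)
    rw [← r.comm_involution, ← r.comm_involution, h.isometry, r.retract, r.retract]
  adjoint v w := by
    change B (i (π (Y (i v)))) (i w) = B (i v) (i (π (ε (i (π (Y (i (π (ε (i w))))))))))
    simp only [← r.comm, ← r.comm_involution, r.retract]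
    exact h.adjoint _ _

theorem isSymm (hs : B.IsSymm) : (B.comp i i).IsSymm := ⟨fun v w => hs.eq (i v) (i w)⟩

theorem nondegenerate (r : OrthogonalRetract B ε Y i π) (hs : B.IsSymm) (hB : B.Nondegenerate) :
    (B.comp i i).Nondegenerate := by
  have h1 : ∀ w : W, (∀ w', B (i w) (i w') = 0) → w = 0 := by
    intro w hw
    have h2 : i w = 0 := hB.1 _ fun v => by rw [r.form_eq, hw]
    rw [← r.retract w, h2, map_zero]
  exact ⟨h1, fun w hw => h1 w fun w' => by rw [← hw w']; exact hs.eq _ _⟩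

variable {R : Type u} [CommRing R] [Algebra K R]

theorem baseChange_retract (r : OrthogonalRetract B ε Y i π) (z : R ⊗[K] W) :
    π.baseChange R (i.baseChange R z) = z := by
  have h : π ∘ₗ i = LinearMap.id := LinearMap.ext r.retract
  rw [← LinearMap.comp_apply, ← LinearMap.baseChange_comp, h, LinearMap.baseChange_id]
  rfl

theorem baseChange_comm (r : OrthogonalRetract B ε Y i π) (z : R ⊗[K] V) :
    Y.baseChange R (i.baseChange R (π.baseChange R z)) =
      i.baseChange R (π.baseChange R (Y.baseChange R z)) := by
  have h : Y ∘ₗ i ∘ₗ π = i ∘ₗ π ∘ₗ Y := LinearMap.ext r.comm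
  simpa [LinearMap.baseChange_comp] using congrArg (fun l => l.baseChange R z) h

theorem baseChange_comm_involution (r : OrthogonalRetract B ε Y i π) (z : R ⊗[K] V) :
    ε.baseChange R (i.baseChange R (π.baseChange R z)) =
      i.baseChange R (π.baseChange R (ε.baseChange R z)) := by
  have h : ε ∘ₗ i ∘ₗ π = i ∘ₗ π ∘ₗ ε := LinearMap.ext r.comm_involution
  simpa [LinearMap.baseChange_comp] using congrArg (fun l => l.baseChange R z) h

theorem baseChange_selfAdjoint (r : OrthogonalRetract B ε Y i π) (z z' : R ⊗[K] V) :
    B.baseChange R (i.baseChange R (π.baseChange R z)) z' =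
      B.baseChange R z (i.baseChange R (π.baseChange R z')) := by
  have := baseChange_form_relation B B (X := i ∘ₗ π) (Y := LinearMap.id) (X' := LinearMap.id)
    (Y' := i ∘ₗ π) r.selfAdjoint R z z'
  simpa [LinearMap.baseChange_comp] using this

theorem baseChange_form (z z' : R ⊗[K] W) :
    (B.comp i i).baseChange R z z' = B.baseChange R (i.baseChange R z) (i.baseChange R z') := by
  have := baseChange_form_relation B (B.comp i i) (X := i) (Y := i) (X' := LinearMap.id)
    (Y' := LinearMap.id) (fun _ _ => rfl) R z z'
  simpa using this.symm

variable [FiniteDimensional K V]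

theorem commute (r : OrthogonalRetract B ε Y i π) (h : InvolutionDatum B ε Y) (hs : B.IsSymm)
    (hB : B.Nondegenerate) {g : LinearMap.GeneralLinearGroup R (R ⊗[K] V)}
    (hg : g ∈ centralizerPoints B Y R) (z : R ⊗[K] V) :
    g.1 (i.baseChange R (π.baseChange R z)) = i.baseChange R (π.baseChange R (g.1 z)) := by
  have := h.commute_of_mem_adjoin hs hB hg r.mem_adjoin z
  rwa [LinearMap.baseChange_comp] at this

/-- Restriction of elements of the centralizer of `Y` to the summand `W`. -/
noncomputable def restrictPoints (r : OrthogonalRetract B ε Y i π) (h : InvolutionDatum B ε Y)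
    (hs : B.IsSymm) (hB : B.Nondegenerate) (R : Type u) [CommRing R] [Algebra K R] :
    centralizerPoints B Y R →* centralizerPoints (B.comp i i) (π ∘ₗ Y ∘ₗ i) R where
  toFun g :=
    ⟨⟨π.baseChange R ∘ₗ g.1.1 ∘ₗ i.baseChange R, π.baseChange R ∘ₗ (g⁻¹).1.1 ∘ₗ i.baseChange R,
      LinearMap.ext fun z => by
        change π.baseChange R (g.1.1 (i.baseChange R (π.baseChange R
          ((g⁻¹).1.1 (i.baseChange R z))))) = z
        rw [r.commute h hs hB g.2, r.baseChange_retract]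
        exact (congrArg _ (gl_apply_inv_apply g.1 _)).trans (r.baseChange_retract z),
      LinearMap.ext fun z => by
        change π.baseChange R ((g⁻¹).1.1 (i.baseChange R (π.baseChange R
          (g.1.1 (i.baseChange R z))))) = z
        rw [r.commute h hs hB (g⁻¹).2, r.baseChange_retract]
        exact (congrArg _ (gl_inv_apply_apply g.1 _)).trans (r.baseChange_retract z)⟩, by
      refine ⟨fun z z' => ?_, fun z => ?_⟩
      · change (B.comp i i).baseChange R (π.baseChange R (g.1.1 (i.baseChange R z)))
          (π.baseChange R (g.1.1 (i.baseChange R z'))) = _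
        rw [baseChange_form, ← r.commute h hs hB g.2, ← r.commute h hs hB g.2, g.2.1,
          r.baseChange_retract, r.baseChange_retract, baseChange_form]
      · change π.baseChange R (g.1.1 (i.baseChange R ((π ∘ₗ Y ∘ₗ i).baseChange R z))) =
          (π ∘ₗ Y ∘ₗ i).baseChange R (π.baseChange R (g.1.1 (i.baseChange R z)))
        simp only [LinearMap.baseChange_comp, LinearMap.comp_apply]
        rw [← r.commute h hs hB g.2, r.baseChange_retract, r.commute h hs hB g.2,
          r.baseChange_retract, g.2.2]⟩
  map_one' := Subtype.ext (Units.ext (LinearMap.ext fun z => r.baseChange_retract z))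
  map_mul' g g' := Subtype.ext (Units.ext (LinearMap.ext fun z => by
    change π.baseChange R (g.1.1 (g'.1.1 (i.baseChange R z))) =
      π.baseChange R (g.1.1 (i.baseChange R (π.baseChange R (g'.1.1 (i.baseChange R z)))))
    rw [r.commute h hs hB g.2, r.baseChange_retract]))

theorem restrictPoints_apply (r : OrthogonalRetract B ε Y i π) (h : InvolutionDatum B ε Y)
    (hs : B.IsSymm) (hB : B.Nondegenerate) (g : centralizerPoints B Y R) (z : R ⊗[K] W) :
    (r.restrictPoints h hs hB R g).1.1 z = π.baseChange R (g.1.1 (i.baseChange R z)) := rfl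

end OrthogonalRetract

end Retract

/-! ### The pair of an orthogonal sum is a product. -/

section Decomposition

variable {K : Type u} [Field K] {V W₁ W₂ : Type u} [AddCommGroup V] [Module K V]
  [AddCommGroup W₁] [Module K W₁] [AddCommGroup W₂] [Module K W₂]
  {B : LinearMap.BilinForm K V} {ε Y : Module.End K V} {i₁ : W₁ →ₗ[K] V} {π₁ : V →ₗ[K] W₁}
  {i₂ : W₂ →ₗ[K] V} {π₂ : V →ₗ[K] W₂} {R : Type u} [CommRing R] [Algebra K R]

theorem baseChange_sum (hsum : ∀ v, i₁ (π₁ v) + i₂ (π₂ v) = v) (z : R ⊗[K] V) :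
    i₁.baseChange R (π₁.baseChange R z) + i₂.baseChange R (π₂.baseChange R z) = z := by
  have h : i₁ ∘ₗ π₁ + i₂ ∘ₗ π₂ = LinearMap.id := LinearMap.ext hsum
  simpa [LinearMap.baseChange_comp, LinearMap.baseChange_add] using
    congrArg (fun l => l.baseChange R z) h

/-- Two projections with sum the identity annihilate each other: apply the sum to a vector of `W₂`.
-/
theorem OrthogonalRetract.baseChange_cross (r₁ : OrthogonalRetract B ε Y i₁ π₁)
    (r₂ : OrthogonalRetract B ε Y i₂ π₂) (hsum : ∀ v, i₁ (π₁ v) + i₂ (π₂ v) = v) (z : R ⊗[K] W₂) :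
    π₁.baseChange R (i₂.baseChange R z) = 0 := by
  have h := baseChange_sum (R := R) hsum (i₂.baseChange R z)
  rw [r₂.baseChange_retract, add_eq_right] at h
  rw [← r₁.baseChange_retract (R := R) (π₁.baseChange R _), h, map_zero]

/-- An element of the centralizer of `Y` assembled from its restrictions to two complementary
summands. -/
noncomputable def glueGL (r₁ : OrthogonalRetract B ε Y i₁ π₁) (r₂ : OrthogonalRetract B ε Y i₂ π₂)
    (hsum : ∀ v, i₁ (π₁ v) + i₂ (π₂ v) = v)
    (g₁ : LinearMap.GeneralLinearGroup R (R ⊗[K] W₁))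
    (g₂ : LinearMap.GeneralLinearGroup R (R ⊗[K] W₂)) :
    LinearMap.GeneralLinearGroup R (R ⊗[K] V) where
  val := i₁.baseChange R ∘ₗ g₁.1 ∘ₗ π₁.baseChange R + i₂.baseChange R ∘ₗ g₂.1 ∘ₗ π₂.baseChange R
  inv := i₁.baseChange R ∘ₗ (g₁⁻¹).1 ∘ₗ π₁.baseChange R +
    i₂.baseChange R ∘ₗ (g₂⁻¹).1 ∘ₗ π₂.baseChange R
  val_inv := LinearMap.ext fun z => by
    have hsum' : ∀ v, i₂ (π₂ v) + i₁ (π₁ v) = v := fun v => by rw [add_comm, hsum]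
    rw [Module.End.mul_apply]
    simp only [LinearMap.add_apply, LinearMap.comp_apply, map_add]
    rw [r₁.baseChange_retract, r₂.baseChange_retract, r₁.baseChange_cross r₂ hsum,
      r₂.baseChange_cross r₁ hsum', gl_apply_inv_apply, gl_apply_inv_apply]
    simp only [map_zero, add_zero, zero_add]
    exact baseChange_sum hsum z
  inv_val := LinearMap.ext fun z => by
    have hsum' : ∀ v, i₂ (π₂ v) + i₁ (π₁ v) = v := fun v => by rw [add_comm, hsum]
    rw [Module.End.mul_apply]
    simp only [LinearMap.add_apply, LinearMap.comp_apply, map_add]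
    rw [r₁.baseChange_retract, r₂.baseChange_retract, r₁.baseChange_cross r₂ hsum,
      r₂.baseChange_cross r₁ hsum', gl_inv_apply_apply, gl_inv_apply_apply]
    simp only [map_zero, add_zero, zero_add]
    exact baseChange_sum hsum z

theorem glueGL_apply (r₁ : OrthogonalRetract B ε Y i₁ π₁) (r₂ : OrthogonalRetract B ε Y i₂ π₂)
    (hsum : ∀ v, i₁ (π₁ v) + i₂ (π₂ v) = v)
    (g₁ : LinearMap.GeneralLinearGroup R (R ⊗[K] W₁))
    (g₂ : LinearMap.GeneralLinearGroup R (R ⊗[K] W₂)) (z : R ⊗[K] V) :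
    (glueGL r₁ r₂ hsum g₁ g₂).1 z = i₁.baseChange R (g₁.1 (π₁.baseChange R z)) +
      i₂.baseChange R (g₂.1 (π₂.baseChange R z)) := rfl

theorem glueGL_mem (r₁ : OrthogonalRetract B ε Y i₁ π₁) (r₂ : OrthogonalRetract B ε Y i₂ π₂)
    (hsum : ∀ v, i₁ (π₁ v) + i₂ (π₂ v) = v)
    (g₁ : centralizerPoints (B.comp i₁ i₁) (π₁ ∘ₗ Y ∘ₗ i₁) R)
    (g₂ : centralizerPoints (B.comp i₂ i₂) (π₂ ∘ₗ Y ∘ₗ i₂) R) :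
    glueGL r₁ r₂ hsum g₁.1 g₂.1 ∈ centralizerPoints B Y R := by
  have hsum' : ∀ v, i₂ (π₂ v) + i₁ (π₁ v) = v := fun v => by rw [add_comm, hsum]
  -- The summands are orthogonal, since `i₁ π₁` is self-adjoint, fixes `W₁` and kills `W₂`.
  have c₁₂ : ∀ a b, B.baseChange R (i₁.baseChange R a) (i₂.baseChange R b) = 0 := fun a b => by
    rw [← r₁.baseChange_retract a, r₁.baseChange_selfAdjoint, r₁.baseChange_cross r₂ hsum,
      map_zero, map_zero]
  have c₂₁ : ∀ a b, B.baseChange R (i₂.baseChange R a) (i₁.baseChange R b) = 0 := fun a b => by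
    rw [← r₂.baseChange_retract a, r₂.baseChange_selfAdjoint, r₂.baseChange_cross r₁ hsum',
      map_zero, map_zero]
  refine ⟨fun z z' => ?_, fun z => ?_⟩
  · rw [glueGL_apply, glueGL_apply]
    have h1 := g₁.2.1 (π₁.baseChange R z) (π₁.baseChange R z')
    have h2 := g₂.2.1 (π₂.baseChange R z) (π₂.baseChange R z')
    rw [OrthogonalRetract.baseChange_form, OrthogonalRetract.baseChange_form] at h1 h2
    conv_rhs => rw [← baseChange_sum (R := R) hsum z, ← baseChange_sum (R := R) hsum z']
    simp only [map_add, LinearMap.add_apply, c₁₂, c₂₁, h1, h2]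
  · have y₁ : ∀ z, π₁.baseChange R (Y.baseChange R z) =
        (π₁ ∘ₗ Y ∘ₗ i₁).baseChange R (π₁.baseChange R z) := fun z => by
      simp only [LinearMap.baseChange_comp, LinearMap.comp_apply]
      rw [r₁.baseChange_comm, r₁.baseChange_retract]
    have y₂ : ∀ z, π₂.baseChange R (Y.baseChange R z) =
        (π₂ ∘ₗ Y ∘ₗ i₂).baseChange R (π₂.baseChange R z) := fun z => by
      simp only [LinearMap.baseChange_comp, LinearMap.comp_apply]
      rw [r₂.baseChange_comm, r₂.baseChange_retract]
    have y₁' : ∀ z, i₁.baseChange R ((π₁ ∘ₗ Y ∘ₗ i₁).baseChange R z) =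
        Y.baseChange R (i₁.baseChange R z) := fun z => by
      simp only [LinearMap.baseChange_comp, LinearMap.comp_apply]
      rw [← r₁.baseChange_comm, r₁.baseChange_retract]
    have y₂' : ∀ z, i₂.baseChange R ((π₂ ∘ₗ Y ∘ₗ i₂).baseChange R z) =
        Y.baseChange R (i₂.baseChange R z) := fun z => by
      simp only [LinearMap.baseChange_comp, LinearMap.comp_apply]
      rw [← r₂.baseChange_comm, r₂.baseChange_retract]
    rw [glueGL_apply, glueGL_apply, y₁, y₂, g₁.2.2, g₂.2.2, y₁', y₂', map_add]

variable [FiniteDimensional K V]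

/-- The pair attached to an orthogonal sum is the product of the pairs attached to the summands. -/
noncomputable def decompositionEquiv (r₁ : OrthogonalRetract B ε Y i₁ π₁)
    (r₂ : OrthogonalRetract B ε Y i₂ π₂) (hsum : ∀ v, i₁ (π₁ v) + i₂ (π₂ v) = v)
    (h : InvolutionDatum B ε Y) (hs : B.IsSymm) (hB : B.Nondegenerate)
    (R : Type u) [CommRing R] [Algebra K R] :
    centralizerPoints B Y R ≃* centralizerPoints (B.comp i₁ i₁) (π₁ ∘ₗ Y ∘ₗ i₁) R ×
      centralizerPoints (B.comp i₂ i₂) (π₂ ∘ₗ Y ∘ₗ i₂) R where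
  toFun g := (r₁.restrictPoints h hs hB R g, r₂.restrictPoints h hs hB R g)
  invFun p := ⟨glueGL r₁ r₂ hsum p.1.1 p.2.1, glueGL_mem r₁ r₂ hsum p.1 p.2⟩
  left_inv g := Subtype.ext (Units.ext (LinearMap.ext fun z => by
    rw [glueGL_apply, OrthogonalRetract.restrictPoints_apply,
      OrthogonalRetract.restrictPoints_apply, ← r₁.commute h hs hB g.2, ← r₂.commute h hs hB g.2,
      r₁.baseChange_retract, r₂.baseChange_retract, ← map_add, baseChange_sum hsum]))
  right_inv p := by
    have hsum' : ∀ v, i₂ (π₂ v) + i₁ (π₁ v) = v := fun v => by rw [add_comm, hsum]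
    refine Prod.ext (Subtype.ext (Units.ext (LinearMap.ext fun z => ?_)))
      (Subtype.ext (Units.ext (LinearMap.ext fun z => ?_)))
    · rw [OrthogonalRetract.restrictPoints_apply, glueGL_apply, r₁.baseChange_retract,
        r₂.baseChange_cross r₁ hsum', map_zero, map_zero, add_zero, r₁.baseChange_retract]
    · rw [OrthogonalRetract.restrictPoints_apply, glueGL_apply, r₂.baseChange_retract,
        r₁.baseChange_cross r₂ hsum, map_zero, map_zero, zero_add, r₂.baseChange_retract]
  map_mul' g g' := Prod.ext (map_mul _ _ _) (map_mul _ _ _)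

theorem OrthogonalRetract.restrictPoints_map (r₁ : OrthogonalRetract B ε Y i₁ π₁)
    (h : InvolutionDatum B ε Y) (hs : B.IsSymm) (hB : B.Nondegenerate) {S : Type u} [CommRing S]
    [Algebra K S] (f : R →ₐ[K] S) (g : centralizerPoints B Y R) :
    r₁.restrictPoints h hs hB S ((centralizerGroup B Y).map f g) =
      (centralizerGroup (B.comp i₁ i₁) (π₁ ∘ₗ Y ∘ₗ i₁)).map f (r₁.restrictPoints h hs hB R g) := by
  refine Subtype.ext (Units.ext (extendEnd_eq_of_rTensor f _ _ fun z => ?_))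
  change π₁.baseChange S (extendEnd f g.1.1 (i₁.baseChange S _)) = _
  rw [baseChange_apply_rTensor, extendEnd_rTensor, baseChange_apply_rTensor]
  rfl

variable [FiniteDimensional K W₁] [FiniteDimensional K W₂]

theorem OrthogonalRetract.restrictPoints_θ (r₁ : OrthogonalRetract B ε Y i₁ π₁)
    (h : InvolutionDatum B ε Y) (hs : B.IsSymm) (hB : B.Nondegenerate)
    (g : centralizerPoints B Y R) :
    r₁.restrictPoints h hs hB R ((centralizerPair hs hB h).θ R g) =
      (centralizerPair (isSymm hs) (r₁.nondegenerate hs hB) (r₁.datum h)).θ R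
        (r₁.restrictPoints h hs hB R g) := by
  refine Subtype.ext (Units.ext (LinearMap.ext fun z => ?_))
  change π₁.baseChange R (ε.baseChange R (g.1.1 (ε.baseChange R (i₁.baseChange R z)))) =
    (π₁ ∘ₗ ε ∘ₗ i₁).baseChange R (π₁.baseChange R (g.1.1 (i₁.baseChange R
      ((π₁ ∘ₗ ε ∘ₗ i₁).baseChange R z))))
  simp only [LinearMap.baseChange_comp, LinearMap.comp_apply]
  rw [← r₁.baseChange_comm_involution, r₁.baseChange_retract, r₁.baseChange_comm_involution,
    r₁.baseChange_retract]

/-- If the pair attached to the second summand is a product of pairs, then adding the pair attached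
to the first summand gives the pair of the orthogonal sum. -/
noncomputable def SymPair.Iso.ofDecomposition (r₁ : OrthogonalRetract B ε Y i₁ π₁)
    (r₂ : OrthogonalRetract B ε Y i₂ π₂) (hsum : ∀ v, i₁ (π₁ v) + i₂ (π₂ v) = v)
    (h : InvolutionDatum B ε Y) (hs : B.IsSymm) (hB : B.Nondegenerate) {n : ℕ}
    {P : Fin n → SymPair K}
    (b : Iso (centralizerPair (OrthogonalRetract.isSymm hs) (r₂.nondegenerate hs hB)
      (r₂.datum h)) (SymPair.prod P)) :
    Iso (centralizerPair hs hB h) (SymPair.prod (Fin.cons (centralizerPair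
      (OrthogonalRetract.isSymm hs) (r₁.nondegenerate hs hB) (r₁.datum h)) P :
        Fin (n + 1) → SymPair K)) :=
  SymPair.Iso.toProdCons (Q := centralizerPair (OrthogonalRetract.isSymm hs)
    (r₂.nondegenerate hs hB) (r₂.datum h)) (fun R _ _ => decompositionEquiv r₁ r₂ hsum h hs hB R)
    (fun f g => Prod.ext (r₁.restrictPoints_map h hs hB f g) (r₂.restrictPoints_map h hs hB f g))
    (fun _ _ _ g => Prod.ext (r₁.restrictPoints_θ h hs hB g) (r₂.restrictPoints_θ h hs hB g)) b

end Decomposition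

/-! ### Forms with values in an extension field, seen through a functional. -/

section Functional

variable {K L : Type u} [Field K] [Field L] [Algebra K L]

/-- The `R`-linear extension `L ⊗ R → R` of a functional on `L`. -/
noncomputable def extendFunctional (l : L →ₗ[K] K) (R : Type u) [CommRing R] [Algebra K R] :
    L ⊗[K] R →ₗ[K] R :=
  TensorProduct.lid K R ∘ₗ l.rTensor R

theorem extendFunctional_tmul (l : L →ₗ[K] K) (R : Type u) [CommRing R] [Algebra K R] (a : L)
    (r : R) : extendFunctional l R (a ⊗ₜ r) = l a • r := by
  simp [extendFunctional]

/-- The pairing `l(a b)` on the field `L` is nondegenerate, so a dual basis for it recovers the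
coordinates of `x` in `R`. With this, identities of `R`-valued forms lift to `L ⊗ R`-valued ones. -/
theorem eq_zero_of_extendFunctional_eq_zero [FiniteDimensional K L] {l : L →ₗ[K] K} (hl : l ≠ 0)
    {R : Type u} [CommRing R] [Algebra K R] {x : L ⊗[K] R}
    (h : ∀ a : L, extendFunctional l R ((a ⊗ₜ 1) * x) = 0) : x = 0 := by
  let T : LinearMap.BilinForm K L := (LinearMap.mul K L).compr₂ l
  have hT : ∀ a b, T a b = l (a * b) := fun _ _ => rfl
  have hsep : ∀ a, (∀ b, l (a * b) = 0) → a = 0 := by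
    intro a ha
    by_contra h0
    apply hl
    ext b
    have := ha (a⁻¹ * b)
    rwa [mul_inv_cancel_left₀ h0] at this
  have hTn : T.Nondegenerate := ⟨fun a ha => hsep a ha, fun a ha => hsep a fun b => by
    rw [mul_comm]; exact ha b⟩
  classical
  let b := Module.finBasis K L
  obtain ⟨c, rfl⟩ := TensorProduct.eq_repr_basis_left b x
  have hc : ∀ i, c i = 0 := by
    intro i
    have h1 := h (T.dualBasis hTn b i)
    rw [Finsupp.sum, Finset.mul_sum, map_sum] at h1
    rw [← h1, Finset.sum_eq_single i]
    · rw [Algebra.TensorProduct.tmul_mul_tmul, one_mul, extendFunctional_tmul, ← hT,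
        LinearMap.BilinForm.apply_dualBasis_left, if_pos rfl, one_smul]
    · intro j _ hj
      rw [Algebra.TensorProduct.tmul_mul_tmul, one_mul, extendFunctional_tmul, ← hT,
        LinearMap.BilinForm.apply_dualBasis_left, if_neg hj, zero_smul]
    · intro hi
      rw [Finsupp.notMem_support_iff.1 hi, TensorProduct.tmul_zero, mul_zero, map_zero]
  rw [show c = 0 from Finsupp.ext hc, Finsupp.sum_zero_index]

end Functional

section Conjugation

/-- Transport of a linear automorphism along an additive equivalence. -/
def conjGL {R R' M M' : Type u} [CommRing R] [AddCommGroup M] [Module R M] [CommRing R']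
    [AddCommGroup M'] [Module R' M'] (e : M ≃+ M') (g : LinearMap.GeneralLinearGroup R M)
    (hg : ∀ (c : R') (x : M'), e (g.1 (e.symm (c • x))) = c • e (g.1 (e.symm x))) :
    LinearMap.GeneralLinearGroup R' M' where
  val :=
    { toFun := fun x => e (g.1 (e.symm x))
      map_add' := fun x y => by simp only [map_add]
      map_smul' := hg }
  inv :=
    { toFun := fun x => e ((g⁻¹).1 (e.symm x))
      map_add' := fun x y => by simp only [map_add]
      map_smul' := fun c x => by
        have h := hg c (e ((g⁻¹).1 (e.symm x)))
        rw [e.symm_apply_apply, gl_apply_inv_apply, e.apply_symm_apply] at h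
        have h2 : e.symm (c • e ((g⁻¹).1 (e.symm x))) = (g⁻¹).1 (e.symm (c • x)) := by
          rw [← h, e.symm_apply_apply, gl_inv_apply_apply]
        rw [← h2, e.apply_symm_apply]
        rfl }
  val_inv := LinearMap.ext fun x => by
    change e (g.1 (e.symm (e ((g⁻¹).1 (e.symm x))))) = x
    rw [e.symm_apply_apply, gl_apply_inv_apply, e.apply_symm_apply]
  inv_val := LinearMap.ext fun x => by
    change e ((g⁻¹).1 (e.symm (e (g.1 (e.symm x))))) = x
    rw [e.symm_apply_apply, gl_inv_apply_apply, e.apply_symm_apply]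

variable {K : Type u} [Field K] {V : Type u} [AddCommGroup V] [Module K V] [FiniteDimensional K V]
  {B : LinearMap.BilinForm K V} {ε Y : Module.End K V}
  {L : Type u} [Field L] [Algebra K L] [FiniteDimensional K L]
  {R : Type u} [CommRing R] [Algebra K R]

/-- Suppose that a field `L` acts on `V` through the algebra generated by `Y` and its adjoint. Then
the centralizer of `Y` in `O(V)` is the group of `L ⊗ R`-linear automorphisms that commute with `Y`
and preserve an `L ⊗ R`-valued form which lifts `B` along a functional on `L`. -/
noncomputable def centralizerPointsEquiv (h : InvolutionDatum B ε Y) (hs : B.IsSymm)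
    (hB : B.Nondegenerate) {l : L →ₗ[K] K} (hl : l ≠ 0) {ρ : L → Module.End K V}
    (hρ : ∀ a, ρ a ∈ Algebra.adjoin K {Y, ε * Y * ε}) (hρ1 : ρ 1 = 1)
    {M : Type u} [AddCommGroup M] [Module (L ⊗[K] R) M] (e : (R ⊗[K] V) ≃+ M)
    (he : ∀ (a : L) (r : R) z, e (r • (ρ a).baseChange R z) = (a ⊗ₜ[K] r) • e z)
    (φ : M → M → L ⊗[K] R) (hφ : ∀ c x y, φ (c • x) y = c * φ x y)
    (hφB : ∀ z z', extendFunctional l R (φ (e z) (e z')) = B.baseChange R z z')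
    (H : Subgroup (LinearMap.GeneralLinearGroup (L ⊗[K] R) M))
    (hH : ∀ g, g ∈ H ↔ (∀ x y, φ (g.1 x) (g.1 y) = φ x y) ∧
      ∀ z, g.1 (e (Y.baseChange R z)) = e (Y.baseChange R (e.symm (g.1 (e z))))) :
    centralizerPoints B Y R ≃* H :=
  have he' : ∀ (a : L) (r : R) x, e.symm ((a ⊗ₜ[K] r) • x) = r • (ρ a).baseChange R (e.symm x) := by
    intro a r x
    rw [AddEquiv.symm_apply_eq, he, e.apply_symm_apply]
  have her : ∀ (r : R) z, e (r • z) = ((1 : L) ⊗ₜ[K] r) • e z := by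
    intro r z
    rw [← he, hρ1, Module.End.one_eq_id, LinearMap.baseChange_id, LinearMap.id_apply]
  -- Linearity over `L` costs nothing: `ρ a` lies in the algebra generated by `Y` and its adjoint,
  -- with which `g` commutes.
  have hlin : ∀ g ∈ centralizerPoints B Y R, ∀ (c : L ⊗[K] R) x,
      e (g.1 (e.symm (c • x))) = c • e (g.1 (e.symm x)) := by
    intro g hg c x
    induction c with
    | zero => simp
    | add c c' hc hc' => simp only [add_smul, map_add, hc, hc']
    | tmul a r =>
      rw [he', map_smul, h.commute_of_mem_adjoin hs hB hg (hρ a), he]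
  have hlin' : ∀ (g : LinearMap.GeneralLinearGroup (L ⊗[K] R) M) (r : R) z,
      e.symm (g.1 (e.symm.symm (r • z))) = r • e.symm (g.1 (e.symm.symm z)) := by
    intro g r z
    rw [AddEquiv.symm_symm, her, map_smul, AddEquiv.symm_apply_eq, her, e.apply_symm_apply]
  { toFun := fun g => ⟨conjGL e g.1 (hlin g.1 g.2), by
      rw [hH]
      have hg : ∀ x, (conjGL e g.1 (hlin g.1 g.2)).1 x = e (g.1.1 (e.symm x)) := fun _ => rfl
      refine ⟨fun x y => ?_, fun z => ?_⟩
      -- The test multiplier `a ⊗ 1` is absorbed into the first argument by linearity, where the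
      -- identity for `B` applies.
      · refine sub_eq_zero.1 (eq_zero_of_extendFunctional_eq_zero hl fun a => ?_)
        rw [mul_sub, map_sub, ← hφ, ← hφ, ← map_smul, hg, hg, hφB]
        obtain ⟨z, hz⟩ := e.surjective ((a ⊗ₜ[K] (1 : R)) • x)
        obtain ⟨z', rfl⟩ := e.surjective y
        rw [← hz, e.symm_apply_apply, e.symm_apply_apply, hφB, g.2.1, sub_self]
      · rw [hg, hg, e.symm_apply_apply, e.symm_apply_apply, e.symm_apply_apply, g.2.2]⟩
    invFun := fun g => ⟨conjGL e.symm g.1 (hlin' g.1), by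
      have hg : ∀ z, (conjGL e.symm g.1 (hlin' g.1)).1 z = e.symm (g.1.1 (e z)) := fun _ => rfl
      have hg2 := (hH g.1).1 g.2
      refine ⟨fun z z' => ?_, fun z => ?_⟩
      · rw [hg, hg, ← hφB, e.apply_symm_apply, e.apply_symm_apply, hg2.1, hφB]
      · rw [hg, hg, hg2.2, e.symm_apply_apply]⟩
    left_inv := fun g => Subtype.ext (Units.ext (LinearMap.ext fun z => by
      change e.symm (e (g.1.1 (e.symm (e z)))) = _
      rw [e.symm_apply_apply, e.symm_apply_apply]))
    right_inv := fun g => Subtype.ext (Units.ext (LinearMap.ext fun z => by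
      change e (e.symm (g.1.1 (e (e.symm z)))) = _
      rw [e.apply_symm_apply, e.apply_symm_apply]))
    map_mul' := fun g g' => Subtype.ext (Units.ext (LinearMap.ext fun z => by
      change e (g.1.1 (g'.1.1 _)) = e (g.1.1 (e.symm (e (g'.1.1 _))))
      rw [e.symm_apply_apply])) }

end Conjugation

/-! ### Restriction of scalars from `K` to `F`. -/

section RestrictionOfScalars

variable {F K : Type u} [Field F] [Field K] [Algebra F K] {V : Type u} [AddCommGroup V]
  [Module F V] [Module K V] [IsScalarTower F K V]

variable (F K V) in
/-- The identification of `R ⊗ V` over `F` with `(K ⊗ R) ⊗ V` over `K`. -/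
noncomputable def resEquiv (R : Type u) [CommRing R] [Algebra F R] :
    (R ⊗[F] V) ≃+ ((K ⊗[F] R) ⊗[K] V) :=
  (TensorProduct.comm F R V).toAddEquiv.trans
    ((TensorProduct.AlgebraTensorModule.cancelBaseChange F K K V R).symm.toAddEquiv.trans
      (TensorProduct.comm K V (K ⊗[F] R)).toAddEquiv)

theorem resEquiv_tmul (R : Type u) [CommRing R] [Algebra F R] (r : R) (v : V) :
    resEquiv F K V R (r ⊗ₜ v) = ((1 : K) ⊗ₜ[F] r) ⊗ₜ[K] v := by
  simp [resEquiv]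

theorem resEquiv_smul (R : Type u) [CommRing R] [Algebra F R] (a : K) (r : R) (z : R ⊗[F] V) :
    resEquiv F K V R (r • (Algebra.lsmul F F V a).baseChange R z) =
      (a ⊗ₜ[F] r) • resEquiv F K V R z := by
  induction z with
  | zero => simp
  | add x y hx hy => simp only [map_add, smul_add, hx, hy]
  | tmul s v =>
    rw [LinearMap.baseChange_tmul, TensorProduct.smul_tmul', resEquiv_tmul, resEquiv_tmul,
      TensorProduct.smul_tmul', smul_eq_mul, smul_eq_mul, Algebra.TensorProduct.tmul_mul_tmul,
      mul_one, Algebra.lsmul_coe, ← TensorProduct.smul_tmul, TensorProduct.smul_tmul', smul_eq_mul,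
      mul_one]

theorem resEquiv_baseChange (R : Type u) [CommRing R] [Algebra F R] (X : Module.End K V)
    (z : R ⊗[F] V) :
    resEquiv F K V R ((X.restrictScalars F).baseChange R z) =
      X.baseChange (K ⊗[F] R) (resEquiv F K V R z) := by
  induction z with
  | zero => simp
  | add x y hx hy => simp only [map_add, hx, hy]
  | tmul s v =>
    rw [LinearMap.baseChange_tmul, resEquiv_tmul, resEquiv_tmul, LinearMap.baseChange_tmul]
    rfl

theorem resEquiv_rTensor {R S : Type u} [CommRing R] [Algebra F R] [CommRing S] [Algebra F S]
    (f : R →ₐ[F] S) (z : R ⊗[F] V) :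
    resEquiv F K V S (f.toLinearMap.rTensor V z) =
      (Algebra.TensorProduct.map (AlgHom.id K K) f).toLinearMap.rTensor V
        (resEquiv F K V R z) := by
  induction z with
  | zero => simp
  | add x y hx hy => simp only [map_add, hx, hy]
  | tmul s v => simp [resEquiv_tmul]

theorem resEquiv_form {B : LinearMap.BilinForm F V} {B' : LinearMap.BilinForm K V}
    {l : K →ₗ[F] F} (hBl : ∀ v w, B v w = l (B' v w)) (R : Type u) [CommRing R] [Algebra F R]
    (z z' : R ⊗[F] V) :
    extendFunctional l R (B'.baseChange (K ⊗[F] R) (resEquiv F K V R z) (resEquiv F K V R z')) =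
      B.baseChange R z z' := by
  induction z with
  | zero => simp
  | add x x' hx hx' => simp only [map_add, LinearMap.add_apply, hx, hx']
  | tmul a w =>
    induction z' with
    | zero => simp
    | add y y' hy hy' => simp only [map_add, hy, hy']
    | tmul b w' =>
      rw [resEquiv_tmul, resEquiv_tmul, LinearMap.BilinForm.baseChange_tmul,
        LinearMap.BilinForm.baseChange_tmul, Algebra.TensorProduct.tmul_mul_tmul, one_mul,
        TensorProduct.smul_tmul', extendFunctional_tmul, hBl, smul_eq_mul, mul_one]

variable [FiniteDimensional F V] [FiniteDimensional F K] [FiniteDimensional K V]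

/-- If a field `K` acts on `V` through the algebra generated by `Y` and its adjoint, and `B` is
obtained from a `K`-bilinear form `B'` by a functional on `K`, then the pair of `(V, B, ε, Y)` is
obtained from the pair over `K` by restriction of scalars. -/
noncomputable def SymPair.Iso.restrictScalars {B : LinearMap.BilinForm F V}
    {B' : LinearMap.BilinForm K V} {ε' Y' : Module.End K V}
    (h : InvolutionDatum B (ε'.restrictScalars F) (Y'.restrictScalars F))
    (hs : B.IsSymm) (hB : B.Nondegenerate) (h' : InvolutionDatum B' ε' Y') (hs' : B'.IsSymm)
    (hB' : B'.Nondegenerate) {l : K →ₗ[F] F} (hl : l ≠ 0) (hBl : ∀ v w, B v w = l (B' v w))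
    (hK : ∀ a : K, (Algebra.lsmul F F V a : Module.End F V) ∈ Algebra.adjoin F
      {Y'.restrictScalars F, ε'.restrictScalars F * Y'.restrictScalars F * ε'.restrictScalars F}) :
    Iso (centralizerPair hs hB h) ((centralizerPair hs' hB' h').res F) where
  toEquiv R _ _ := centralizerPointsEquiv h hs hB hl hK (map_one _) (resEquiv F K V R)
    (resEquiv_smul R) (fun x y => B'.baseChange (K ⊗[F] R) x y)
    (fun c x y => by simp) (resEquiv_form hBl R) (centralizerPoints B' Y' (K ⊗[F] R))
    (fun g => by
      refine and_congr Iff.rfl ⟨fun hg z => ?_, fun hg z => ?_⟩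
      · rw [resEquiv_baseChange, resEquiv_baseChange, AddEquiv.apply_symm_apply, hg]
      · obtain ⟨z, rfl⟩ := (resEquiv F K V R).surjective z
        have := hg z
        rwa [resEquiv_baseChange, resEquiv_baseChange, AddEquiv.apply_symm_apply] at this)
  map_comm {R S} _ _ _ _ f g := Subtype.ext (Units.ext (by
    refine extendEnd_eq_of_rTensor _ _ _ fun z => ?_
    obtain ⟨z, rfl⟩ := (resEquiv F K V R).surjective z
    change resEquiv F K V S (extendEnd f g.1.1 ((resEquiv F K V S).symm _)) =
      LinearMap.rTensor V _ (resEquiv F K V R (g.1.1 ((resEquiv F K V R).symm _)))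
    rw [← resEquiv_rTensor, ← resEquiv_rTensor, AddEquiv.symm_apply_apply, AddEquiv.symm_apply_apply,
      extendEnd_rTensor]))
  θ_comm R _ _ g := Subtype.ext (Units.ext (LinearMap.ext fun z => by
    obtain ⟨z, rfl⟩ := (resEquiv F K V R).surjective z
    change resEquiv F K V R ((ε'.restrictScalars F).baseChange R (g.1.1
      ((ε'.restrictScalars F).baseChange R ((resEquiv F K V R).symm _)))) =
      ε'.baseChange (K ⊗[F] R) (resEquiv F K V R (g.1.1 ((resEquiv F K V R).symm
        (ε'.baseChange (K ⊗[F] R) _))))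
    rw [resEquiv_baseChange, ← resEquiv_baseChange R ε' z, AddEquiv.symm_apply_apply,
      AddEquiv.symm_apply_apply]))

end RestrictionOfScalars

/-! ### Hermitian forms and unitary groups. -/

section ScalarEquiv

variable {K L V W : Type u} [Field K] [Field L] [Algebra K L] [AddCommGroup V] [Module K V]
  [AddCommGroup W] [Module K W]

/-- The identification of `R ⊗ V` with `(L ⊗ R) ⊗ W`, for `V` identified with `L ⊗ W`. -/
noncomputable def scalarEquiv (e : (L ⊗[K] W) ≃ₗ[K] V) (R : Type u) [CommRing R] [Algebra K R] :
    (R ⊗[K] V) ≃+ ((L ⊗[K] R) ⊗[K] W) :=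
  ((e.symm.lTensor R) ≪≫ₗ (TensorProduct.assoc K R L W).symm ≪≫ₗ
    (TensorProduct.comm K R L).rTensor W).toAddEquiv

theorem scalarEquiv_symm_tmul (e : (L ⊗[K] W) ≃ₗ[K] V) (R : Type u) [CommRing R] [Algebra K R]
    (a : L) (r : R) (w : W) :
    (scalarEquiv e R).symm ((a ⊗ₜ r) ⊗ₜ w) = r ⊗ₜ e (a ⊗ₜ w) := by
  rw [AddEquiv.symm_apply_eq]
  simp [scalarEquiv]

theorem tensorTensor_induction {R : Type u} [CommRing R] [Algebra K R]
    {p : (L ⊗[K] R) ⊗[K] W → Prop} (zero : p 0) (add : ∀ x y, p x → p y → p (x + y))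
    (tmul : ∀ (a : L) (r : R) (w : W), p ((a ⊗ₜ r) ⊗ₜ w)) (x : (L ⊗[K] R) ⊗[K] W) : p x := by
  induction x with
  | zero => exact zero
  | add x y hx hy => exact add x y hx hy
  | tmul c w =>
    induction c with
    | zero => rw [TensorProduct.zero_tmul]; exact zero
    | add c c' hc hc' => rw [TensorProduct.add_tmul]; exact add _ _ hc hc'
    | tmul a r => exact tmul a r w

theorem scalarEquiv_rTensor (e : (L ⊗[K] W) ≃ₗ[K] V) {R S : Type u} [CommRing R] [Algebra K R]
    [CommRing S] [Algebra K S] (f : R →ₐ[K] S) (z : R ⊗[K] V) :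
    scalarEquiv e S (f.toLinearMap.rTensor V z) =
      (Algebra.TensorProduct.map (AlgHom.id K L) f).toLinearMap.rTensor W
        (scalarEquiv e R z) := by
  rw [← AddEquiv.eq_symm_apply]
  obtain ⟨x, rfl⟩ := (scalarEquiv e R).symm.surjective z
  rw [AddEquiv.apply_symm_apply]
  induction x using tensorTensor_induction with
  | zero => simp
  | add x y hx hy => simp only [map_add, hx, hy]
  | tmul a r w => simp [scalarEquiv_symm_tmul]

end ScalarEquiv

section Hermitian

variable {K L V W : Type u} [Field K] [Field L] [Algebra K L] [AddCommGroup V] [Module K V]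
  [AddCommGroup W] [Module K W] {B : LinearMap.BilinForm K V} {B' : LinearMap.BilinForm K W}
  {ε ξ : Module.End K V} {ρ : L →ₐ[K] Module.End K V} {i : W → V}
  {e : (L ⊗[K] W) ≃ₗ[K] V} {τ : L ≃ₐ[K] L} {l : L →ₗ[K] K}

theorem scalarEquiv_smul (he : ∀ a w, e (a ⊗ₜ w) = ρ a (i w)) (R : Type u) [CommRing R]
    [Algebra K R] (a : L) (r : R) (z : R ⊗[K] V) :
    scalarEquiv e R (r • (ρ a).baseChange R z) = (a ⊗ₜ[K] r) • scalarEquiv e R z := by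
  rw [← AddEquiv.eq_symm_apply]
  obtain ⟨x, rfl⟩ := (scalarEquiv e R).symm.surjective z
  rw [AddEquiv.apply_symm_apply]
  induction x using tensorTensor_induction with
  | zero => simp
  | add x y hx hy => simp only [map_add, smul_add, hx, hy]
  | tmul b s w =>
    rw [TensorProduct.smul_tmul', smul_eq_mul, Algebra.TensorProduct.tmul_mul_tmul,
      scalarEquiv_symm_tmul, scalarEquiv_symm_tmul, LinearMap.baseChange_tmul,
      TensorProduct.smul_tmul', smul_eq_mul, he, he, map_mul]
    rfl

theorem scalarEquiv_involution (he : ∀ a w, e (a ⊗ₜ w) = ρ a (i w))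
    (hε : ∀ a w, ε (ρ a (i w)) = ρ (τ a) (i w)) (R : Type u) [CommRing R] [Algebra K R]
    (z : R ⊗[K] V) :
    scalarEquiv e R (ε.baseChange R z) =
      (conjHom τ R).toLinearMap.rTensor W (scalarEquiv e R z) := by
  rw [← AddEquiv.eq_symm_apply]
  obtain ⟨x, rfl⟩ := (scalarEquiv e R).symm.surjective z
  rw [AddEquiv.apply_symm_apply]
  induction x using tensorTensor_induction with
  | zero => simp
  | add x y hx hy => simp only [map_add, hx, hy]
  | tmul b s w => simp [scalarEquiv_symm_tmul, conjHom, he, hε]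

theorem hermExt_scalarEquiv (he : ∀ a w, e (a ⊗ₜ w) = ρ a (i w))
    (hform : ∀ a b v w, B (ρ a (i v)) (ρ b (i w)) = l (a * τ b) * B' v w) (R : Type u)
    [CommRing R] [Algebra K R] (z z' : R ⊗[K] V) :
    extendFunctional l R (hermExt B' τ R (scalarEquiv e R z) (scalarEquiv e R z')) =
      B.baseChange R z z' := by
  obtain ⟨x, rfl⟩ := (scalarEquiv e R).symm.surjective z
  obtain ⟨y, rfl⟩ := (scalarEquiv e R).symm.surjective z'
  rw [AddEquiv.apply_symm_apply, AddEquiv.apply_symm_apply]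
  induction x using tensorTensor_induction with
  | zero => simp [hermExt]
  | add x x' hx hx' =>
    rw [map_add, map_add, LinearMap.add_apply, ← hx, ← hx', ← map_add]
    simp [hermExt]
  | tmul a r v =>
    induction y using tensorTensor_induction with
    | zero => simp [hermExt]
    | add y y' hy hy' =>
      rw [map_add, map_add, ← hy, ← hy', ← map_add]
      simp [hermExt]
    | tmul b s w =>
      rw [hermExt_tmul, scalarEquiv_symm_tmul, scalarEquiv_symm_tmul,
        LinearMap.BilinForm.baseChange_tmul, he, he, hform, conjHom,
        Algebra.TensorProduct.map_tmul, Algebra.TensorProduct.tmul_mul_tmul, map_smul,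
        extendFunctional_tmul, mul_smul, smul_comm]
      rfl

/-- If a field `L` with an involution `τ` acts on `V = L ⊗ W` through polynomials in `ξ`, if `B`
comes from the hermitian extension of a form on `W` by a functional on `L`, and if `ε` is the
semilinear map `τ ⊗ id`, then the centralizer of `ξ` in `O(V)` is the unitary group
of `L ⊗ W`. -/
noncomputable def SymPair.Iso.toUnitary [FiniteDimensional K V] [FiniteDimensional K L]
    (h : InvolutionDatum B ε ξ) (hs : B.IsSymm) (hB : B.Nondegenerate)
    (hτ : ∀ a, τ (τ a) = a) (hl : l ≠ 0) (hρ : ∀ a, ρ a ∈ Algebra.adjoin K {ξ, ε * ξ * ε})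
    {c : L} (hc : ρ c = ξ) (he : ∀ a w, e (a ⊗ₜ w) = ρ a (i w))
    (hε : ∀ a w, ε (ρ a (i w)) = ρ (τ a) (i w))
    (hform : ∀ a b v w, B (ρ a (i v)) (ρ b (i w)) = l (a * τ b) * B' v w) :
    Iso (centralizerPair hs hB h) (pairUO B' τ hτ) :=
  -- `ξ` becomes the scalar `c ⊗ 1`, so every `L ⊗ R`-linear automorphism commutes with it and only
  -- the hermitian form remains as a condition.
  have hξ : ∀ (R : Type u) [CommRing R] [Algebra K R] z, scalarEquiv e R (ξ.baseChange R z) =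
      (c ⊗ₜ[K] (1 : R)) • scalarEquiv e R z := fun R _ _ z => by
    rw [← scalarEquiv_smul he, one_smul, hc]
  { toEquiv := fun R _ _ => centralizerPointsEquiv h hs hB hl hρ (map_one _) (scalarEquiv e R)
      (scalarEquiv_smul he R) (hermExt B' τ R) (fun c x y => by simp [hermExt])
      (hermExt_scalarEquiv he hform R) (unitaryPoints B' τ R) (fun g =>
        ⟨fun hg => ⟨hg, fun z => by rw [hξ, hξ, AddEquiv.apply_symm_apply, map_smul]⟩,
          fun hg => hg.1⟩)
    map_comm := fun {R S} _ _ _ _ f g => Subtype.ext (Units.ext (by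
      refine extendEnd_eq_of_rTensor _ _ _ fun z => ?_
      obtain ⟨z, rfl⟩ := (scalarEquiv e R).surjective z
      change scalarEquiv e S (extendEnd f g.1.1 ((scalarEquiv e S).symm _)) =
        LinearMap.rTensor _ _ (scalarEquiv e R (g.1.1 ((scalarEquiv e R).symm _)))
      rw [← scalarEquiv_rTensor, ← scalarEquiv_rTensor, AddEquiv.symm_apply_apply,
        AddEquiv.symm_apply_apply, extendEnd_rTensor]))
    θ_comm := fun R _ _ g => Subtype.ext (Units.ext (by
      refine extendEnd_eq_of_rTensor _ _ _ fun z => ?_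
      obtain ⟨z, rfl⟩ := (scalarEquiv e R).surjective z
      change scalarEquiv e R (ε.baseChange R (g.1.1 (ε.baseChange R ((scalarEquiv e R).symm _)))) =
        LinearMap.rTensor _ _ (scalarEquiv e R (g.1.1 ((scalarEquiv e R).symm _)))
      rw [← scalarEquiv_involution he hε, ← scalarEquiv_involution he hε,
        AddEquiv.symm_apply_apply, AddEquiv.symm_apply_apply, h.baseChange_involutive])) }

end Hermitian

/-! ### The non-split case: `K(√d)` acts on `V`. -/

section Quadratic

variable {K : Type u} [Field K]

/-- The conjugation of `K(√d)`. -/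
def QuadraticAlgebra.conj (d : K) : QuadraticAlgebra K d 0 ≃ₐ[K] QuadraticAlgebra K d 0 :=
  have hinv : ∀ a : QuadraticAlgebra K d 0, (⟨a.re, - -a.im⟩ : QuadraticAlgebra K d 0) = a :=
    fun a => by rw [neg_neg]
  { toFun := fun a => ⟨a.re, -a.im⟩
    invFun := fun a => ⟨a.re, -a.im⟩
    left_inv := hinv
    right_inv := hinv
    map_mul' := fun a b => by ext <;> simp; ring
    map_add' := fun a b => by ext <;> simp; ring
    commutes' := fun a => by ext <;> simp }

theorem QuadraticAlgebra.conj_conj (d : K) (a : QuadraticAlgebra K d 0) :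
    conj d (conj d a) = a := (conj d).left_inv a

theorem QuadraticAlgebra.conj_ne_refl [CharZero K] (d : K) : conj d ≠ AlgEquiv.refl := by
  intro h
  have h1 := congrArg QuadraticAlgebra.im (AlgEquiv.congr_fun h ⟨0, 1⟩)
  have h2 : (-1 : K) = 1 := h1
  norm_num at h2

variable [CharZero K] {V : Type u} [AddCommGroup V] [Module K V]
  {B : LinearMap.BilinForm K V} {ε ξ : Module.End K V} {d : K}

/-- The action of `K(√d)` through a square root `ξ` of `d`. -/
def quadraticAction (hsq : ∀ v, ξ (ξ v) = d • v) :
    QuadraticAlgebra K d 0 →ₐ[K] Module.End K V :=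
  QuadraticAlgebra.lift ⟨ξ, LinearMap.ext fun v => by simp [hsq]⟩

omit [CharZero K] in
theorem quadraticAction_apply (hsq : ∀ v, ξ (ξ v) = d • v) (a : QuadraticAlgebra K d 0) (v : V) :
    quadraticAction hsq a v = a.re • v + a.im • ξ v := by
  simp [quadraticAction]

theorem quadraticAction_conj (hsq : ∀ v, ξ (ξ v) = d • v) (hanti : ∀ v, ε (ξ v) = -ξ (ε v))
    (a : QuadraticAlgebra K d 0) (v : V) :
    ε (quadraticAction hsq a v) = quadraticAction hsq (QuadraticAlgebra.conj d a) (ε v) := by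
  simp [quadraticAction_apply, hanti, QuadraticAlgebra.conj]

variable (ε) in
/-- The vectors fixed by `ε`. -/
abbrev fixedVectors : Submodule K V := LinearMap.eqLocus ε LinearMap.id

/-- The identification of `V` with `K(√d) ⊗ V^ε`. -/
noncomputable def quadraticEquiv (hε : ∀ v, ε (ε v) = v) (hsq : ∀ v, ξ (ξ v) = d • v)
    (hanti : ∀ v, ε (ξ v) = -ξ (ε v)) (hd : d ≠ 0) :
    (QuadraticAlgebra K d 0 ⊗[K] fixedVectors ε) ≃ₗ[K] V :=
  -- The inverse writes `v` as `p + ξ m` with `p = (v + ε v)/2` and `m = ξ (v - ε v)/(2 d)`, both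
  -- fixed by `ε`.
  have hp : ∀ v, ((2 : K)⁻¹ • (LinearMap.id + ε) : Module.End K V) v ∈ fixedVectors ε := fun v => by
    simp [LinearMap.mem_eqLocus, hε, add_comm]
  have hm : ∀ v, ((2 * d)⁻¹ • (ξ ∘ₗ (LinearMap.id - ε)) : Module.End K V) v ∈ fixedVectors ε :=
    fun v => by simp [LinearMap.mem_eqLocus, hε, hanti, neg_add_eq_sub, smul_sub]
  LinearEquiv.ofLinearMap
    (TensorProduct.lift ((quadraticAction hsq).toLinearMap.compl₂ (fixedVectors ε).subtype))
    (TensorProduct.mk K _ _ 1 ∘ₗ LinearMap.codRestrict _ _ hp +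
      TensorProduct.mk K _ _ ⟨0, 1⟩ ∘ₗ LinearMap.codRestrict _ _ hm)
    (LinearMap.ext fun v => by
      simp only [LinearMap.comp_apply, LinearMap.add_apply, TensorProduct.mk_apply, map_add,
        TensorProduct.lift.tmul, LinearMap.compl₂_apply, AlgHom.toLinearMap_apply,
        quadraticAction_apply, Submodule.subtype_apply, LinearMap.codRestrict_apply,
        LinearMap.smul_apply, LinearMap.sub_apply, LinearMap.id_apply, map_smul, map_sub, hsq,
        QuadraticAlgebra.re_one, QuadraticAlgebra.im_one]
      match_scalars <;> field_simp <;> ring)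
    (TensorProduct.ext' fun a w => by
      have hw : ε (w : V) = w := w.2
      have h1 : LinearMap.codRestrict _ _ hp (quadraticAction hsq a w) = a.re • w := by
        refine Subtype.ext ?_
        change (2 : K)⁻¹ • (quadraticAction hsq a (w : V) + ε (quadraticAction hsq a (w : V))) =
          a.re • (w : V)
        simp only [quadraticAction_apply, map_add, map_smul, hanti, hw]
        match_scalars <;> field_simp <;> ring
      have h2 : LinearMap.codRestrict _ _ hm (quadraticAction hsq a w) = a.im • w := by
        refine Subtype.ext ?_
        change (2 * d)⁻¹ • ξ (quadraticAction hsq a (w : V) - ε (quadraticAction hsq a (w : V))) =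
          a.im • (w : V)
        simp only [quadraticAction_apply, map_add, map_sub, map_neg, map_smul, hanti, hw, hsq]
        match_scalars <;> field_simp <;> ring
      change (1 : QuadraticAlgebra K d 0) ⊗ₜ LinearMap.codRestrict _ _ hp (quadraticAction hsq a w) +
        (⟨0, 1⟩ : QuadraticAlgebra K d 0) ⊗ₜ LinearMap.codRestrict _ _ hm
          (quadraticAction hsq a w) = a ⊗ₜ w
      rw [h1, h2, ← TensorProduct.smul_tmul, ← TensorProduct.smul_tmul, ← TensorProduct.add_tmul]
      congr 1
      ext <;> simp [QuadraticAlgebra.re_one, QuadraticAlgebra.im_one])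

theorem quadraticEquiv_tmul (hε : ∀ v, ε (ε v) = v) (hsq : ∀ v, ξ (ξ v) = d • v)
    (hanti : ∀ v, ε (ξ v) = -ξ (ε v)) (hd : d ≠ 0) (a : QuadraticAlgebra K d 0)
    (w : fixedVectors ε) :
    quadraticEquiv hε hsq hanti hd (a ⊗ₜ w) = quadraticAction hsq a w := rfl

omit [CharZero K] in
theorem InvolutionDatum.anti_adjoint (h : InvolutionDatum B ε ξ)
    (hanti : ∀ v, ε (ξ v) = -ξ (ε v)) (v w : V) : B (ξ v) w = -B v (ξ w) := by
  rw [h.adjoint, hanti, h.involutive, map_neg]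

/-- `ξ` maps the fixed vectors to the `-1` eigenspace of `ε`, which is orthogonal to them. -/
theorem InvolutionDatum.form_fixed (h : InvolutionDatum B ε ξ) (hanti : ∀ v, ε (ξ v) = -ξ (ε v))
    {v w : V} (hv : ε v = v) (hw : ε w = w) : B v (ξ w) = 0 := by
  have h1 := h.isometry v (ξ w)
  rw [hv, hanti, hw, map_neg, neg_eq_iff_add_eq_zero, ← two_mul] at h1
  exact (mul_eq_zero.1 h1).resolve_left two_ne_zero

/-- So `B` is the image of the hermitian extension of its restriction to `V^ε` under the functional
`re`; using `re` instead of the trace avoids a factor `2`. -/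
theorem InvolutionDatum.form_quadraticAction (h : InvolutionDatum B ε ξ)
    (hsq : ∀ v, ξ (ξ v) = d • v) (hanti : ∀ v, ε (ξ v) = -ξ (ε v)) {v w : V} (hv : ε v = v)
    (hw : ε w = w) (a b : QuadraticAlgebra K d 0) :
    B (quadraticAction hsq a v) (quadraticAction hsq b w) =
      (a * QuadraticAlgebra.conj d b).re * B v w := by
  simp only [quadraticAction_apply, map_add, map_smul, LinearMap.add_apply, LinearMap.smul_apply,
    h.anti_adjoint hanti, h.form_fixed hanti hv hw, hsq, smul_eq_mul, QuadraticAlgebra.re_mul,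
    QuadraticAlgebra.conj, AlgEquiv.coe_mk, Equiv.coe_fn_mk]
  ring

omit [CharZero K] in
theorem LinearMap.BilinForm.IsSymm.nondegenerate_of_left {B : LinearMap.BilinForm K V}
    (hs : B.IsSymm) (h : ∀ v, (∀ w, B v w = 0) → v = 0) : B.Nondegenerate :=
  ⟨h, fun w hw => h w fun v => (hs.eq w v).trans (hw v)⟩

/-- For `v` fixed by `ε`, pairing with `u` is half of pairing with the fixed vector `u + ε u`. -/
theorem InvolutionDatum.nondegenerate_fixedVectors (h : InvolutionDatum B ε ξ) (hs : B.IsSymm)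
    (hB : B.Nondegenerate) : (B.restrict (fixedVectors ε)).Nondegenerate := by
  refine (hs.restrict _).nondegenerate_of_left fun v hv => Subtype.ext (hB.1 v.1 fun u => ?_)
  have h1 : B v.1 (ε u) = B v.1 u := by
    have h2 := h.isometry v.1 u
    rwa [show ε v.1 = v.1 from v.2] at h2
  have h3 : B v.1 (u + ε u) = 0 := hv ⟨u + ε u, by simp [LinearMap.mem_eqLocus, h.involutive, add_comm]⟩
  rw [map_add, h1, ← two_mul] at h3
  exact (mul_eq_zero.1 h3).resolve_left two_ne_zero

/-- If `ξ` anticommutes with `ε` and `ξ² = d` is not a square, then the centralizer of `ξ`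
in `O(V)` is the unitary group of `K(√d) ⊗ V^ε`. -/
noncomputable def SymPair.Iso.toUnitaryOfSq [FiniteDimensional K V]
    -- This says that `d` is not a square, in the form that makes `QuadraticAlgebra K d 0` a field.
    [Fact (∀ r : K, r ^ 2 ≠ d + 0 * r)] (h : InvolutionDatum B ε ξ) (hs : B.IsSymm)
    (hB : B.Nondegenerate) (hsq : ∀ v, ξ (ξ v) = d • v) (hanti : ∀ v, ε (ξ v) = -ξ (ε v))
    (hd : d ≠ 0) :
    Iso (centralizerPair hs hB h) (pairUO (B.restrict (fixedVectors ε)) (QuadraticAlgebra.conj d)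
      (QuadraticAlgebra.conj_conj d)) :=
  toUnitary (l := QuadraticAlgebra.reₗ d 0) (ρ := quadraticAction hsq) (c := ⟨0, 1⟩)
    (i := Subtype.val) (e := quadraticEquiv h.involutive hsq hanti hd) h hs hB _
    (fun h0 => one_ne_zero (LinearMap.congr_fun h0 1))
    (fun a => add_mem (Subalgebra.smul_mem _ (one_mem _) _)
      (Subalgebra.smul_mem _ (Algebra.subset_adjoin (Set.mem_insert _ _)) _))
    (LinearMap.ext fun v => by simp [quadraticAction_apply])
    (quadraticEquiv_tmul h.involutive hsq hanti hd)
    (fun a w => by rw [quadraticAction_conj hsq hanti, show ε w.1 = w.1 from w.2])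
    (fun a b v w => h.form_quadraticAction hsq hanti v.2 w.2 a b)

end Quadratic

/-! ### The split case: `V = W ⊕ ε W` with `W` isotropic. -/

section Lagrangian

variable {K V W : Type u} [Field K] [AddCommGroup V] [Module K V] [AddCommGroup W] [Module K W]
  {B : LinearMap.BilinForm K V} {ε ξ : Module.End K V} {i : W →ₗ[K] V} {π : V →ₗ[K] W}

/-- A decomposition of `V` as `W ⊕ ε W` with `W` totally isotropic, such that `ξ` is
a linear combination of the two projections, and the projections are polynomials in `ξ` and its
adjoint. -/
structure LagrangianRetract (B : LinearMap.BilinForm K V) (ε ξ : Module.End K V) (i : W →ₗ[K] V)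
    (π : V →ₗ[K] W) : Prop where
  retract : ∀ w, π (i w) = w
  sum : ∀ v, i (π v) + ε (i (π (ε v))) = v
  isotropic : ∀ v w, B (i v) (i w) = 0
  mem_adjoin : i ∘ₗ π ∈ Algebra.adjoin K {ξ, ε * ξ * ε}
  eq_smul : ∃ a b : K, ξ = a • (i ∘ₗ π) + b • (ε ∘ₗ i ∘ₗ π ∘ₗ ε)

namespace LagrangianRetract

/-- The form on `W` given by the pairing of `W` with `ε W`. -/
def form (B : LinearMap.BilinForm K V) (ε : Module.End K V) (i : W →ₗ[K] V) :
    LinearMap.BilinForm K W := B.compl₁₂ i (ε ∘ₗ i)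

theorem form_isSymm (h : InvolutionDatum B ε ξ) (hs : B.IsSymm) : (form B ε i).IsSymm :=
  ⟨fun v w => by
    change B (i v) (ε (i w)) = B (i w) (ε (i v))
    rw [← h.isometry, h.involutive, hs.eq]⟩

theorem form_nondegenerate (r : LagrangianRetract B ε ξ i π) (h : InvolutionDatum B ε ξ)
    (hs : B.IsSymm) (hB : B.Nondegenerate) : (form B ε i).Nondegenerate := by
  refine ⟨fun v hv => ?_, fun v hv => ?_⟩
  all_goals
    have hv' : ∀ w, B (i v) (ε (i w)) = 0 := fun w => by
      first | exact hv w | exact ((form_isSymm h hs).eq v w).trans (hv w)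
    have : i v = 0 := hB.1 _ fun u => by rw [← r.sum u, map_add, r.isotropic, hv', add_zero]
    rw [← r.retract v, this, map_zero]

variable (r : LagrangianRetract B ε ξ i π) (R : Type u) [CommRing R] [Algebra K R]
include r

theorem baseChange_retract (x : R ⊗[K] W) : π.baseChange R (i.baseChange R x) = x := by
  rw [← LinearMap.comp_apply, ← LinearMap.baseChange_comp,
    show π ∘ₗ i = LinearMap.id from LinearMap.ext r.retract, LinearMap.baseChange_id]
  rfl

theorem baseChange_sum (z : R ⊗[K] V) :
    i.baseChange R (π.baseChange R z) +
      ε.baseChange R (i.baseChange R (π.baseChange R (ε.baseChange R z))) = z := by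
  have h1 : i ∘ₗ π + ε ∘ₗ i ∘ₗ π ∘ₗ ε = LinearMap.id := LinearMap.ext r.sum
  have h2 := congrArg (LinearMap.baseChange R) h1
  rw [LinearMap.baseChange_add, LinearMap.baseChange_id] at h2
  simp only [LinearMap.baseChange_comp] at h2
  exact LinearMap.congr_fun h2 z

theorem baseChange_isotropic (x y : R ⊗[K] W) :
    B.baseChange R (i.baseChange R x) (i.baseChange R y) = 0 := by
  have := baseChange_form_relation B (0 : LinearMap.BilinForm K W) (X := i) (Y := i)
    (X' := LinearMap.id) (Y' := LinearMap.id) r.isotropic R x y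
  rw [this, LinearMap.BilinForm.baseChange_zero]
  rfl

omit r in
theorem baseChange_form (x y : R ⊗[K] W) :
    (form B ε i).baseChange R x y =
      B.baseChange R (i.baseChange R x) (ε.baseChange R (i.baseChange R y)) := by
  have := baseChange_form_relation (form B ε i) B (X := LinearMap.id) (Y := LinearMap.id)
    (X' := i) (Y' := ε ∘ₗ i) (fun _ _ => rfl) R x y
  rwa [LinearMap.baseChange_id, LinearMap.id_apply, LinearMap.id_apply,
    LinearMap.baseChange_comp] at this

variable [FiniteDimensional K V] (h : InvolutionDatum B ε ξ) (hs : B.IsSymm)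
  (hB : B.Nondegenerate) {R}
include h hs hB

theorem commute {g : LinearMap.GeneralLinearGroup R (R ⊗[K] V)} (hg : g ∈ centralizerPoints B ξ R)
    (z : R ⊗[K] V) :
    i.baseChange R (π.baseChange R (g.1 z)) = g.1 (i.baseChange R (π.baseChange R z)) := by
  have := h.commute_of_mem_adjoin hs hB hg r.mem_adjoin z
  rw [LinearMap.baseChange_comp] at this
  exact this.symm

theorem commute_incl {g : LinearMap.GeneralLinearGroup R (R ⊗[K] V)}
    (hg : g ∈ centralizerPoints B ξ R) (x : R ⊗[K] W) :
    i.baseChange R (π.baseChange R (g.1 (i.baseChange R x))) = g.1 (i.baseChange R x) := by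
  rw [r.commute h hs hB hg, r.baseChange_retract]

end LagrangianRetract

open LagrangianRetract

variable [FiniteDimensional K V] (r : LagrangianRetract B ε ξ i π) (h : InvolutionDatum B ε ξ)
  (hs : B.IsSymm) (hB : B.Nondegenerate) (R : Type u) [CommRing R] [Algebra K R]

/-- The action of the centralizer of `ξ` on `W`. -/
noncomputable def LagrangianRetract.restrictPoint (g : centralizerPoints B ξ R) :
    LinearMap.GeneralLinearGroup R (R ⊗[K] W) where
  val := π.baseChange R ∘ₗ g.1.1 ∘ₗ i.baseChange R
  inv := π.baseChange R ∘ₗ (g⁻¹).1.1 ∘ₗ i.baseChange R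
  val_inv := LinearMap.ext fun x => by
    change π.baseChange R (g.1.1 (i.baseChange R (π.baseChange R ((g.1⁻¹).1 (i.baseChange R x))))) =
      x
    rw [r.commute_incl h hs hB (inv_mem g.2), gl_apply_inv_apply, r.baseChange_retract]
  inv_val := LinearMap.ext fun x => by
    change π.baseChange R ((g.1⁻¹).1 (i.baseChange R (π.baseChange R (g.1.1 (i.baseChange R x))))) =
      x
    rw [r.commute_incl h hs hB g.2, gl_inv_apply_apply, r.baseChange_retract]

/-- The form on `W` is the pairing of `W` with `ε W`, and `g` preserves it. Hence the action of `g`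
on `ε W`, carried back to `W` by `ε`, is contragredient to its action on `W`; this matches `g ↦ ε g
ε` with the inverse transpose. -/
theorem LagrangianRetract.invTranspose_restrictPoint [FiniteDimensional K W]
    (g : centralizerPoints B ξ R) :
    invTranspose (form B ε i) (r.form_nondegenerate h hs hB) R (r.restrictPoint h hs hB R g) =
      r.restrictPoint h hs hB R ⟨h.point R * g.1 * h.point R, h.conj_mem hs hB g.2⟩ := by
  refine invTranspose_unique _ _ _ _ _ fun x y => ?_
  rw [baseChange_form, baseChange_form]
  change B.baseChange R (i.baseChange R (π.baseChange R
      ((h.point R * g.1 * h.point R).1 (i.baseChange R x))))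
    (ε.baseChange R (i.baseChange R (π.baseChange R (g.1.1 (i.baseChange R y))))) = _
  rw [r.commute_incl h hs hB g.2, r.commute_incl h hs hB (h.conj_mem hs hB g.2)]
  change B.baseChange R (ε.baseChange R (g.1.1 (ε.baseChange R (i.baseChange R x))))
    (ε.baseChange R (g.1.1 (i.baseChange R y))) = _
  rw [h.baseChange_isometry, g.2.1, ← h.baseChange_isometry, h.baseChange_involutive]

/-- The endomorphism of `V` that acts on `W` by `γ` and on `ε W` by `γ'`. -/
noncomputable def hyperbolicEnd (ε : Module.End K V) (i : W →ₗ[K] V) (π : V →ₗ[K] W)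
    (γ γ' : Module.End R (R ⊗[K] W)) : Module.End R (R ⊗[K] V) :=
  i.baseChange R ∘ₗ γ ∘ₗ π.baseChange R +
    ε.baseChange R ∘ₗ i.baseChange R ∘ₗ γ' ∘ₗ π.baseChange R ∘ₗ ε.baseChange R

variable {R} in
omit [FiniteDimensional K V] in
theorem hyperbolicEnd_apply (γ γ' : Module.End R (R ⊗[K] W)) (z : R ⊗[K] V) :
    hyperbolicEnd R ε i π γ γ' z = i.baseChange R (γ (π.baseChange R z)) +
      ε.baseChange R (i.baseChange R (γ' (π.baseChange R (ε.baseChange R z)))) := rfl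

namespace LagrangianRetract

variable {R}
include r h

omit [FiniteDimensional K V] in
theorem baseChange_cross (x : R ⊗[K] W) :
    π.baseChange R (ε.baseChange R (i.baseChange R x)) = 0 := by
  have h1 := r.baseChange_sum R (i.baseChange R x)
  rw [r.baseChange_retract, add_eq_left] at h1
  have h2 := congrArg (fun y => π.baseChange R (ε.baseChange R y)) h1
  simpa only [h.baseChange_involutive, r.baseChange_retract, map_zero] using h2

omit [FiniteDimensional K V] in
theorem hyperbolicEnd_mul (α α' β β' : Module.End R (R ⊗[K] W)) :
    hyperbolicEnd R ε i π α α' * hyperbolicEnd R ε i π β β' =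
      hyperbolicEnd R ε i π (α * β) (α' * β') := LinearMap.ext fun z => by
  rw [Module.End.mul_apply, hyperbolicEnd_apply, hyperbolicEnd_apply, hyperbolicEnd_apply]
  simp only [map_add, r.baseChange_retract, r.baseChange_cross h, h.baseChange_involutive, add_zero,
    zero_add, Module.End.mul_apply]

omit [FiniteDimensional K V] in
theorem hyperbolicEnd_one : hyperbolicEnd R ε i π 1 1 = 1 := LinearMap.ext (r.baseChange_sum R)

omit [FiniteDimensional K V] in
theorem hyperbolicEnd_commute (α α' : Module.End R (R ⊗[K] W)) (z : R ⊗[K] V) :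
    hyperbolicEnd R ε i π α α' (ξ.baseChange R z) =
      ξ.baseChange R (hyperbolicEnd R ε i π α α' z) := by
  obtain ⟨a, b, hab⟩ := r.eq_smul
  have hξ : ∀ z, ξ.baseChange R z = a • i.baseChange R (π.baseChange R z) +
      b • ε.baseChange R (i.baseChange R (π.baseChange R (ε.baseChange R z))) := fun z => by
    rw [hab]
    simp only [LinearMap.baseChange_add, LinearMap.baseChange_smul, LinearMap.baseChange_comp]
    rfl
  rw [hξ, hξ, hyperbolicEnd_apply, hyperbolicEnd_apply]
  simp only [map_add, LinearMap.map_smul_of_tower, r.baseChange_retract, r.baseChange_cross h,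
    h.baseChange_involutive, add_zero, zero_add, smul_zero]

-- `W` and `ε W` are both isotropic, so only the two cross terms survive, and each is preserved by
-- the relation between `γ'` and `γ`.
omit [FiniteDimensional K V] in
theorem hyperbolicEnd_form (hs : B.IsSymm) {γ γ' : Module.End R (R ⊗[K] W)}
    (hγ : ∀ x y, (form B ε i).baseChange R (γ' x) (γ y) = (form B ε i).baseChange R x y)
    (z z' : R ⊗[K] V) :
    B.baseChange R (hyperbolicEnd R ε i π γ γ' z) (hyperbolicEnd R ε i π γ γ' z') =
      B.baseChange R z z' := by
  conv_rhs => rw [← r.baseChange_sum R z, ← r.baseChange_sum R z']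
  simp only [hyperbolicEnd_apply, map_add, LinearMap.add_apply, r.baseChange_isotropic,
    h.baseChange_isometry, add_zero, zero_add]
  rw [← baseChange_form, ← baseChange_form, baseChange_comm _ (form_isSymm h hs), hγ,
    baseChange_comm _ (form_isSymm h hs)]
  congr 1
  rw [baseChange_comm _ hs, ← baseChange_form, baseChange_comm _ hs, ← baseChange_form,
    baseChange_comm _ (form_isSymm h hs), hγ, baseChange_comm _ (form_isSymm h hs)]

variable [FiniteDimensional K W]

/-- The automorphism of `V` that acts on `W` by `γ` and on `ε W` by the inverse transpose
of `γ`. -/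
noncomputable def hyperbolicPoint (γ : LinearMap.GeneralLinearGroup R (R ⊗[K] W)) :
    centralizerPoints B ξ R :=
  let γ' := invTranspose (form B ε i) (r.form_nondegenerate h hs hB) R γ
  ⟨⟨hyperbolicEnd R ε i π γ.1 γ'.1, hyperbolicEnd R ε i π (γ⁻¹).1 (γ'⁻¹).1, by
      rw [r.hyperbolicEnd_mul h, Units.mul_inv, Units.mul_inv, r.hyperbolicEnd_one h], by
      rw [r.hyperbolicEnd_mul h, Units.inv_mul, Units.inv_mul, r.hyperbolicEnd_one h]⟩,
    r.hyperbolicEnd_form h hs (invTranspose_spec _ _ R γ), r.hyperbolicEnd_commute h _ _⟩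

end LagrangianRetract

/-- The centralizer of `ξ` in `O(V)` is isomorphic to `GL(W)`. -/
noncomputable def LagrangianRetract.pointsEquiv [FiniteDimensional K W] :
    centralizerPoints B ξ R ≃* LinearMap.GeneralLinearGroup R (R ⊗[K] W) where
  toFun := r.restrictPoint h hs hB R
  invFun := r.hyperbolicPoint h hs hB
  left_inv := fun g => Subtype.ext (Units.ext (LinearMap.ext fun z => by
    change hyperbolicEnd R ε i π _ (invTranspose (form B ε i) _ R
      (r.restrictPoint h hs hB R g)).1 z = _
    rw [r.invTranspose_restrictPoint h hs hB]
    change i.baseChange R (π.baseChange R (g.1.1 (i.baseChange R (π.baseChange R z)))) +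
      ε.baseChange R (i.baseChange R (π.baseChange R ((h.point R * g.1 * h.point R).1
        (i.baseChange R (π.baseChange R (ε.baseChange R z)))))) = _
    rw [r.commute_incl h hs hB g.2, r.commute_incl h hs hB (h.conj_mem hs hB g.2)]
    change _ + ε.baseChange R (ε.baseChange R (g.1.1 (ε.baseChange R
      (i.baseChange R (π.baseChange R (ε.baseChange R z)))))) = _
    rw [h.baseChange_involutive, ← map_add, r.baseChange_sum]))
  right_inv := fun γ => Units.ext (LinearMap.ext fun x => by
    change π.baseChange R (hyperbolicEnd R ε i π _ _ (i.baseChange R x)) = _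
    rw [hyperbolicEnd_apply]
    simp only [map_add, r.baseChange_retract, r.baseChange_cross h, add_zero])
  map_mul' := fun g g' => Units.ext (LinearMap.ext fun x => by
    change π.baseChange R (g.1.1 (g'.1.1 (i.baseChange R x))) = π.baseChange R (g.1.1
      (i.baseChange R (π.baseChange R (g'.1.1 (i.baseChange R x)))))
    rw [r.commute_incl h hs hB g'.2])

/-- If `V = W ⊕ ε W` with `W` totally isotropic, and `ξ` is a linear combination of the projections,
then the centralizer of `ξ` in `O(V)` is `GL(W)`. -/
noncomputable def SymPair.Iso.toGL [FiniteDimensional K W] :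
    Iso (centralizerPair hs hB h)
      (pairGLO (form B ε i) (form_isSymm h hs) (r.form_nondegenerate h hs hB)) where
  toEquiv R _ _ := r.pointsEquiv h hs hB R
  map_comm {R S} _ _ _ _ f g := Units.ext (by
    refine extendEnd_eq_of_rTensor _ _ _ fun x => ?_
    change π.baseChange S (extendEnd f g.1.1 (i.baseChange S _)) =
      f.toLinearMap.rTensor W (π.baseChange R (g.1.1 (i.baseChange R x)))
    rw [baseChange_apply_rTensor, extendEnd_rTensor, baseChange_apply_rTensor])
  θ_comm R _ _ g := (r.invTranspose_restrictPoint h hs hB R g).symm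

end Lagrangian

/-! ### Eigenspaces of `ξ` when `ξ² = δ²`. -/

section Eigenspace

variable {K V : Type u} [Field K] [CharZero K] [AddCommGroup V] [Module K V]
  {B : LinearMap.BilinForm K V} {ε ξ : Module.End K V} {δ : K}

/-- The projection onto the eigenspace of `ξ` for `δ`, if `ξ² = δ²`. -/
noncomputable def eigenProjection (hδ : δ ≠ 0) (hsq : ∀ v, ξ (ξ v) = (δ * δ) • v) :
    V →ₗ[K] LinearMap.eqLocus ξ (δ • LinearMap.id : Module.End K V) :=
  LinearMap.codRestrict _ ((2 : K)⁻¹ • (LinearMap.id + δ⁻¹ • ξ)) fun v => by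
    simp only [LinearMap.mem_eqLocus, LinearMap.smul_apply, LinearMap.add_apply, LinearMap.id_apply,
      map_smul, map_add, hsq]
    match_scalars <;> field_simp

theorem eigenProjection_apply (hδ : δ ≠ 0) (hsq : ∀ v, ξ (ξ v) = (δ * δ) • v) (v : V) :
    (eigenProjection hδ hsq v : V) = (2 : K)⁻¹ • (v + δ⁻¹ • ξ v) := rfl

/-- `ξ` is skew-adjoint, so its `δ`-eigenspace is isotropic; `ε` anticommutes with `ξ` and therefore
carries it onto the `-δ`-eigenspace, which is complementary. -/
theorem InvolutionDatum.lagrangianRetract (h : InvolutionDatum B ε ξ) (hδ : δ ≠ 0)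
    (hsq : ∀ v, ξ (ξ v) = (δ * δ) • v) (hanti : ∀ v, ε (ξ v) = -ξ (ε v)) :
    LagrangianRetract B ε ξ (LinearMap.eqLocus ξ (δ • LinearMap.id : Module.End K V)).subtype
      (eigenProjection hδ hsq) where
  retract w := Subtype.ext (by
    have hw : ξ w.1 = δ • w.1 := w.2
    rw [Submodule.subtype_apply, eigenProjection_apply, hw]
    match_scalars <;> field_simp <;> norm_num)
  sum v := by
    simp only [Submodule.subtype_apply, eigenProjection_apply, map_smul, map_add, hanti,
      h.involutive]
    match_scalars <;> field_simp <;> ring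
  isotropic v w := by
    have hv : ξ v.1 = δ • v.1 := v.2
    have hw : ξ w.1 = δ • w.1 := w.2
    have h1 := h.anti_adjoint hanti v.1 w.1
    rw [hv, hw, map_smul, map_smul, LinearMap.smul_apply, smul_eq_mul, eq_neg_iff_add_eq_zero,
      ← two_mul] at h1
    exact ((mul_eq_zero.1 h1).resolve_left two_ne_zero |> mul_eq_zero.1).resolve_left hδ
  mem_adjoin := Subalgebra.smul_mem _ (add_mem (one_mem _) (Subalgebra.smul_mem _
    (Algebra.subset_adjoin (Set.mem_insert _ _)) _)) _
  eq_smul := ⟨δ, -δ, LinearMap.ext fun v => by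
    simp only [LinearMap.add_apply, LinearMap.smul_apply, LinearMap.comp_apply,
      Submodule.subtype_apply, eigenProjection_apply, map_smul, map_add, hanti,
      h.involutive]
    match_scalars <;> field_simp <;> ring⟩

end Eigenspace

/-- The product of a family of isomorphisms of symmetric pairs. -/
def SymPair.Iso.prodCongr {K : Type u} [Field K] {n : ℕ} {P Q : Fin n → SymPair K}
    (a : ∀ i, Iso (P i) (Q i)) : Iso (prod P) (prod Q) where
  toEquiv R _ _ := MulEquiv.piCongrRight fun i => (a i).toEquiv R
  map_comm f g := funext fun i => (a i).map_comm f (g i)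
  θ_comm R _ _ g := funext fun i => (a i).θ_comm R (g i)

/-! ### Change of generator. -/

section ChangeOfGenerator

variable {K V : Type u} [Field K] [AddCommGroup V] [Module K V] [FiniteDimensional K V]
  {B : LinearMap.BilinForm K V} {ε Y Y' : Module.End K V}

/-- The pair depends only on the algebra generated by `Y` and its adjoint. -/
noncomputable def SymPair.Iso.changeGenerator (h : InvolutionDatum B ε Y) (h' : InvolutionDatum B ε Y')
    (hs : B.IsSymm) (hB : B.Nondegenerate) (hY : Y ∈ Algebra.adjoin K {Y', ε * Y' * ε})
    (hY' : Y' ∈ Algebra.adjoin K {Y, ε * Y * ε}) :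
    Iso (centralizerPair hs hB h) (centralizerPair hs hB h') where
  toEquiv R _ _ := MulEquiv.subgroupCongr (le_antisymm
    (fun _ hg => ⟨hg.1, h.commute_of_mem_adjoin hs hB hg hY'⟩)
    (fun _ hg => ⟨hg.1, h'.commute_of_mem_adjoin hs hB hg hY⟩))
  map_comm _ _ := rfl
  θ_comm _ _ _ _ := rfl

end ChangeOfGenerator

/-! ### Points over the base field, and the orthogonal factors. -/

section BasePoints

variable {F V : Type u} [Field F] [AddCommGroup V] [Module F V] {B : LinearMap.BilinForm F V}

/-- Points over `F` act on `F ⊗ V`; this brings them back to endomorphisms of `V`. -/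
theorem Module.End.exists_eq_baseChange_self (φ : Module.End F (F ⊗[F] V)) :
    ∃ φ₀ : Module.End F V, φ = φ₀.baseChange F := by
  refine ⟨(TensorProduct.lid F V).toLinearMap ∘ₗ φ ∘ₗ (TensorProduct.lid F V).symm.toLinearMap,
    end_ext fun v => ?_⟩
  rw [LinearMap.baseChange_tmul]
  simp [← TensorProduct.lid_symm_apply]

theorem Module.End.baseChange_self_injective {φ ψ : Module.End F V}
    (h : φ.baseChange F = ψ.baseChange F) : φ = ψ := LinearMap.ext fun v => by
  have h1 := congrArg (TensorProduct.lid F V) (LinearMap.congr_fun h ((1 : F) ⊗ₜ v))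
  simpa using h1

theorem map_ofId_eq_baseChange {x : (orthogonalGroup B).pts F} {Y : Module.End F V}
    (hx : (show orthogonalPoints B F from x).1.1 = Y.baseChange F) (R : Type u) [CommRing R]
    [Algebra F R] :
    (show orthogonalPoints B R from (orthogonalGroup B).map (Algebra.ofId F R) x).1.1 =
      Y.baseChange R := by
  change extendEnd (Algebra.ofId F R) (show orthogonalPoints B F from x).1.1 = _
  rw [hx, extendEnd_baseChange]

variable [FiniteDimensional F V] {ε x : (orthogonalGroup B).pts F} {ε₀ Y : Module.End F V}

/-- The centralizer of `x` in the pair `(O(V), O(V)_ε)`, in terms of the endomorphisms of `V`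
given by `ε` and `x`. -/
noncomputable def SymPair.Iso.centralizerOfElement (hs : B.IsSymm) (hB : B.Nondegenerate) (hε : orderOf ε = 2)
    (hx : (ofElement (orthogonalGroup B) ε hε).σ F x = x) (h : InvolutionDatum B ε₀ Y)
    (hε₀ : (show orthogonalPoints B F from ε).1.1 = ε₀.baseChange F)
    (hY : (show orthogonalPoints B F from x).1.1 = Y.baseChange F) :
    Iso ((ofElement (orthogonalGroup B) ε hε).centralizer x hx) (centralizerPair hs hB h) where
  toEquiv R _ _ :=
    { toFun := fun g => ⟨(show orthogonalPoints B R from g.1).1,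
        (show orthogonalPoints B R from g.1).2, fun z => by
        have h1 := Subgroup.mem_centralizer_singleton_iff.1 g.2
        rw [← map_ofId_eq_baseChange hY R]
        exact congrArg (fun a : orthogonalPoints B R => a.1.1 z) h1⟩
      invFun := fun g => ⟨(⟨g.1, g.2.1⟩ : orthogonalPoints B R),
        Subgroup.mem_centralizer_singleton_iff.2 (Subtype.ext (Units.ext (LinearMap.ext fun z => by
          have h1 := g.2.2 z
          rw [← map_ofId_eq_baseChange hY R] at h1
          exact h1)))⟩
      left_inv := fun _ => rfl
      right_inv := fun _ => rfl
      map_mul' := fun _ _ => rfl }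
  map_comm _ _ := rfl
  θ_comm R _ _ g := Subtype.ext (Units.ext (LinearMap.ext fun z => by
    change (show orthogonalPoints B R from (orthogonalGroup B).map (Algebra.ofId F R) ε).1.1
      ((show orthogonalPoints B R from g.1).1.1
        ((show orthogonalPoints B R from (orthogonalGroup B).map (Algebra.ofId F R) ε).1.1 z)) =
      ε₀.baseChange R ((show orthogonalPoints B R from g.1).1.1 (ε₀.baseChange R z))
    rw [map_ofId_eq_baseChange hε₀ R]))

/-- An isometric involution as a point of `O(V)`. -/
noncomputable def InvolutionDatum.orthogonalPoint (h : InvolutionDatum B ε₀ Y) :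
    (orthogonalGroup B).pts F :=
  (⟨h.point F, h.baseChange_isometry F⟩ : orthogonalPoints B F)

theorem InvolutionDatum.orderOf_orthogonalPoint (h : InvolutionDatum B ε₀ Y) (hne : ε₀ ≠ 1) :
    orderOf h.orthogonalPoint = 2 := by
  refine orderOf_eq_prime ?_ fun h1 => hne ?_
  · rw [pow_two]
    exact Subtype.ext (Units.ext (LinearMap.ext (h.baseChange_involutive F)))
  · have h2 := congrArg (fun a : orthogonalPoints B F => a.1.1) h1
    exact Module.End.baseChange_self_injective (h2.trans LinearMap.baseChange_id.symm)

/-- If `Y` is central, then the pair is of the form `(O(V), O(V)_η)`. -/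
noncomputable def SymPair.Iso.toOfElement {η : Module.End F V} (h : InvolutionDatum B ε₀ Y)
    (hs : B.IsSymm) (hB : B.Nondegenerate) {c : F} (hY : ∀ v, Y v = c • v)
    (h' : InvolutionDatum B η Y) (hη : η ≠ 1)
    (hconj : ∀ (R : Type u) [CommRing R] [Algebra F R] (g : Module.End R (R ⊗[F] V)),
      ε₀.baseChange R * g * ε₀.baseChange R = η.baseChange R * g * η.baseChange R) :
    Iso (centralizerPair hs hB h)
      (ofElement (orthogonalGroup B) h'.orthogonalPoint (h'.orderOf_orthogonalPoint hη)) where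
  toEquiv R _ _ :=
    { toFun := fun g => (⟨g.1, g.2.1⟩ : orthogonalPoints B R)
      invFun := fun g => ⟨(show orthogonalPoints B R from g).1,
        (show orthogonalPoints B R from g).2, fun z => by
        have hYR : ∀ z, Y.baseChange R z = algebraMap F R c • z := fun z => by
          rw [show Y = c • (LinearMap.id : Module.End F V) from LinearMap.ext hY,
            LinearMap.baseChange_smul]
          simp
        rw [hYR, hYR, map_smul]⟩
      left_inv := fun _ => rfl
      right_inv := fun _ => rfl
      map_mul' := fun _ _ => rfl }
  map_comm _ _ := rfl
  θ_comm R _ _ g := Subtype.ext (Units.ext ((hconj R g.1.1).trans (by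
    rw [← map_ofId_eq_baseChange (x := h'.orthogonalPoint) (Y := η) rfl R]
    rfl)))

/-- A scalar `Y` is centralized by all of `O(V)`. The involution may restrict to the identity on a
block, which is not of order `2`; then `-1` replaces it, since it induces the same trivial
conjugation and differs from `1` on a nonzero space. -/
theorem InvolutionDatum.exists_iso_ofElement [CharZero F] [Nontrivial V] (h : InvolutionDatum B ε₀ Y)
    (hs : B.IsSymm) (hB : B.Nondegenerate) {c : F} (hY : ∀ v, Y v = c • v) :
    ∃ P, IsFactor F P ∧ Nonempty (SymPair.Iso (centralizerPair hs hB h) P) := by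
  by_cases h1 : ε₀ = 1
  · subst h1
    have hη : (-1 : Module.End F V) ≠ 1 := fun h0 => by
      obtain ⟨v, hv⟩ := exists_ne (0 : V)
      have := LinearMap.congr_fun h0 v
      rw [LinearMap.neg_apply, Module.End.one_apply] at this
      rw [neg_eq_iff_add_eq_zero, ← two_smul F] at this
      exact hv ((smul_eq_zero.1 this).resolve_left two_ne_zero)
    have h' : InvolutionDatum B (-1) Y :=
      ⟨fun v => by simp, fun v w => by simp, fun v w => by
        rw [h.adjoint]; simp⟩
    refine ⟨_, IsFactor.oO V B hs hB _ (h'.orderOf_orthogonalPoint hη),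
      ⟨SymPair.Iso.toOfElement h hs hB hY h' hη fun R _ _ g => LinearMap.ext fun z => ?_⟩⟩
    have h2 : ∀ z, (-1 : Module.End F V).baseChange R z = -z := fun z => by
      rw [LinearMap.baseChange_neg, Module.End.one_eq_id, LinearMap.baseChange_id]
      rfl
    simp only [Module.End.mul_apply, h2, map_neg, neg_neg]
    rw [Module.End.one_eq_id, LinearMap.baseChange_id]
    rfl
  · exact ⟨_, IsFactor.oO V B hs hB _ (h.orderOf_orthogonalPoint h1),
      ⟨SymPair.Iso.toOfElement h hs hB hY h h1 fun R _ _ g => rfl⟩⟩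

end BasePoints

/-! ### Lifting bilinear forms along a finite extension. -/

section FieldAction

variable {F K V : Type u} [Field F] [Field K] [Algebra F K] [AddCommGroup V] [Module F V]
  [Module K V] [IsScalarTower F K V]

theorem eq_zero_of_functional_mul_eq_zero {l : K →ₗ[F] F} (hl : l ≠ 0) {x : K}
    (h : ∀ a, l (a * x) = 0) : x = 0 := by
  by_contra h0
  refine hl (LinearMap.ext fun b => ?_)
  have := h (b * x⁻¹)
  rwa [inv_mul_cancel_right₀ h0] at this

/-- A form for which the multiplications by elements of `K` are self-adjoint comes
from a `K`-bilinear form. -/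
theorem exists_bilinForm_lift [FiniteDimensional F K] {l : K →ₗ[F] F} (hl : l ≠ 0)
    (B : LinearMap.BilinForm F V) (hB : ∀ (a : K) v w, B (a • v) w = B v (a • w)) :
    ∃ B' : LinearMap.BilinForm K V, ∀ v w, B v w = l (B' v w) := by
  let T : LinearMap.BilinForm F K := (LinearMap.mul F K).compr₂ l
  have hT : T.Nondegenerate := ⟨fun x hx => eq_zero_of_functional_mul_eq_zero hl fun a => by
      rw [mul_comm]; exact hx a, fun x hx => eq_zero_of_functional_mul_eq_zero hl hx⟩
  -- The value of the lifted form at `(v, w)` is the element of `K` that represents the functional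
  -- `a ↦ B (a • v) w`.
  have hex : ∀ v w, ∃ x : K, ∀ a, l (a * x) = B (a • v) w := fun v w => by
    refine ⟨(T.toDual hT).symm ((B.flip w) ∘ₗ (LinearMap.toSpanSingleton K V v).restrictScalars F),
      fun a => ?_⟩
    rw [mul_comm]
    exact LinearMap.BilinForm.apply_toDual_symm_apply (hB := hT) _ a
  choose b hb using hex
  have hext : ∀ x y : K, (∀ a, l (a * x) = l (a * y)) → x = y := fun x y h =>
    sub_eq_zero.1 (eq_zero_of_functional_mul_eq_zero hl fun a => by
      rw [mul_sub, map_sub, h, sub_self])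
  refine ⟨LinearMap.mk₂ K b (fun v v' w => hext _ _ fun a => ?_)
    (fun c v w => hext _ _ fun a => ?_) (fun v w w' => hext _ _ fun a => ?_)
    (fun c v w => hext _ _ fun a => ?_), fun v w => ?_⟩
  · rw [mul_add, map_add, hb, hb, hb, smul_add, map_add, LinearMap.add_apply]
  · rw [hb, smul_eq_mul, ← mul_assoc, hb, mul_smul]
  · rw [mul_add, map_add, hb, hb, hb, map_add]
  · rw [hb, smul_eq_mul, ← mul_assoc, hb, ← hB, smul_smul, mul_comm]
  · have := hb v w 1
    rw [one_mul, one_smul] at this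
    exact this.symm

variable {B : LinearMap.BilinForm F V} {B' : LinearMap.BilinForm K V} {l : K →ₗ[F] F}

/-- Transfers symmetry, invariance and adjointness from `B` to its lift: an identity for `B` on all
multiples `a • v` is one for `B'`. -/
theorem bilinForm_lift_eq (hl : l ≠ 0) (hBl : ∀ v w, B v w = l (B' v w)) {v w v' w' : V}
    (h : ∀ a : K, B (a • v) w = B (a • v') w') : B' v w = B' v' w' :=
  sub_eq_zero.1 (eq_zero_of_functional_mul_eq_zero hl fun a => by
    have h1 : ∀ v w, a * B' v w = B' (a • v) w := fun v w => by
      rw [map_smul, LinearMap.smul_apply, smul_eq_mul]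
    rw [mul_sub, map_sub, sub_eq_zero, h1, h1, ← hBl, ← hBl, h])

end FieldAction

/-! ### Passage from `Y` to the anticommuting element `Y - ε Y ε`. -/

section Antisymmetrization

variable {K V : Type u} [Field K] [AddCommGroup V] [Module K V]
  {B : LinearMap.BilinForm K V} {ε Y : Module.End K V}

theorem InvolutionDatum.adjoint_adjoint (h : InvolutionDatum B ε Y) (v w : V) :
    B (ε (Y (ε v))) w = B v (Y w) := by
  rw [← h.isometry, h.involutive, h.adjoint, h.involutive, ← h.isometry, h.involutive, h.involutive]

theorem InvolutionDatum.antisymmetrization (h : InvolutionDatum B ε Y) :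
    InvolutionDatum B ε (Y - ε * Y * ε) where
  involutive := h.involutive
  isometry := h.isometry
  adjoint v w := by
    simp only [LinearMap.sub_apply, Module.End.mul_apply, map_sub, h.involutive,
      h.adjoint_adjoint]
    rw [h.adjoint]

theorem InvolutionDatum.antisymmetrization_anti (h : InvolutionDatum B ε Y) (v : V) :
    ε ((Y - ε * Y * ε) v) = -(Y - ε * Y * ε) (ε v) := by
  simp [h.involutive]

/-- With `ε Y ε = Y⁻¹` this is `(Y - Y⁻¹)² = (Y + Y⁻¹)² - 4`. -/
theorem InvolutionDatum.antisymmetrization_sq (h : InvolutionDatum B ε Y) {t : K}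
    (ht : ∀ v, Y v + ε (Y (ε v)) = t • v) (hinv : ∀ v, Y (ε (Y (ε v))) = v) (v : V) :
    (Y - ε * Y * ε) ((Y - ε * Y * ε) v) = (t ^ 2 - 4) • v := by
  have hY : ∀ v, ε (Y (ε v)) = t • v - Y v := fun v => eq_sub_of_add_eq' (ht v)
  have h2 : Y (Y v) = t • Y v - v := by
    have := hinv v
    rw [hY, map_sub, map_smul] at this
    exact (sub_eq_of_eq_add' (sub_eq_iff_eq_add.1 this)).symm
  have h1 : ∀ v, (Y - ε * Y * ε) v = (2 : K) • Y v - t • v := fun v => by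
    change Y v - ε (Y (ε v)) = _
    rw [hY, two_smul]; abel
  rw [h1, h1]
  simp only [map_sub, map_smul, h2]
  module

variable [CharZero K] [FiniteDimensional K V]

/-- If `Y + εYε` is a scalar `t`, then `Y` may be replaced by `Y - εYε`. -/
noncomputable def SymPair.Iso.antisymmetrize (h : InvolutionDatum B ε Y) (hs : B.IsSymm)
    (hB : B.Nondegenerate) {t : K} (ht : ∀ v, Y v + ε (Y (ε v)) = t • v) :
    Iso (centralizerPair hs hB h) (centralizerPair hs hB h.antisymmetrization) :=
  changeGenerator h h.antisymmetrization hs hB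
    (by
      have h1 : Y = (2 : K)⁻¹ • (algebraMap K (Module.End K V) t + (Y - ε * Y * ε)) :=
        LinearMap.ext fun v => by
          change Y v = (2 : K)⁻¹ • (t • v + (Y v - ε (Y (ε v))))
          rw [← ht]
          match_scalars <;> norm_num
      have h2 : (2 : K)⁻¹ • (algebraMap K (Module.End K V) t + (Y - ε * Y * ε)) ∈
          Algebra.adjoin K {Y - ε * Y * ε, ε * (Y - ε * Y * ε) * ε} :=
        Subalgebra.smul_mem _ (add_mem (Subalgebra.algebraMap_mem _ _)
          (Algebra.subset_adjoin (Set.mem_insert _ _))) _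
      rwa [← h1] at h2)
    (sub_mem (Algebra.subset_adjoin (Set.mem_insert _ _))
      (Algebra.subset_adjoin (Set.mem_insert_of_mem _ rfl)))

end Antisymmetrization

/-! ### One block: the linear and unitary factors. -/

section FieldFactor

variable {F K V : Type u} [Field F] [CharZero F] [Field K] [Algebra F K] [AddCommGroup V]
  [Module F V] [Module K V] [IsScalarTower F K V] [FiniteDimensional F V] [FiniteDimensional F K]
  {B : LinearMap.BilinForm F V}

/-- If the algebra generated by `Y + εYε` is a field `K` and `Y ≠ ±1`, then the pair is of the
form `(GL(W), O(W))` or `(U(W_E), O(W))`. -/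
theorem InvolutionDatum.exists_iso_of_field {ε Y : Module.End K V}
    (h : InvolutionDatum B (ε.restrictScalars F) (Y.restrictScalars F)) (hs : B.IsSymm)
    (hB : B.Nondegenerate) (hself : ∀ (a : K) v w, B (a • v) w = B v (a • w))
    (hK : ∀ a : K, (Algebra.lsmul F F V a : Module.End F V) ∈ Algebra.adjoin F
      {Y.restrictScalars F, ε.restrictScalars F * Y.restrictScalars F * ε.restrictScalars F})
    {t : K} (ht : ∀ v, Y v + ε (Y (ε v)) = t • v) (hinv : ∀ v, Y (ε (Y (ε v))) = v)
    (ht4 : t ^ 2 - 4 ≠ 0) :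
    ∃ P, IsFactor F P ∧ Nonempty (SymPair.Iso (centralizerPair hs hB h) P) := by
  have : CharZero K := charZero_of_injective_algebraMap (algebraMap F K).injective
  have : FiniteDimensional K V := FiniteDimensional.right F K V
  -- Any nonzero functional would do; the trace is nonzero because `K / F` is separable in
  -- characteristic zero.
  have hl : Algebra.trace F K ≠ 0 := Algebra.trace_ne_zero F K
  obtain ⟨B', hBl⟩ := exists_bilinForm_lift hl B hself
  have hs' : B'.IsSymm := ⟨fun v w => bilinForm_lift_eq hl hBl fun a => by
    rw [hself, hs.eq]⟩
  have hB' : B'.Nondegenerate := hs'.nondegenerate_of_left fun v hv => hB.1 v fun w => by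
    rw [hBl, hv, map_zero]
  have h' : InvolutionDatum B' ε Y :=
    ⟨h.involutive, fun v w => bilinForm_lift_eq hl hBl fun a => by
        rw [← map_smul]; exact h.isometry _ _,
      fun v w => bilinForm_lift_eq hl hBl fun a => by
        rw [← map_smul]; exact h.adjoint _ _⟩
  let i₁ := SymPair.Iso.restrictScalars h hs hB h' hs' hB' hl hBl hK
  let i₂ := SymPair.Iso.antisymmetrize h' hs' hB' ht
  have hsq := h'.antisymmetrization_sq ht hinv
  -- `ξ = Y - Y⁻¹` has square `t² - 4`: either it is diagonalizable with eigenvalues `±δ` in `K`, or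
  -- it generates a quadratic extension of `K`.
  by_cases hd : IsSquare (t ^ 2 - 4)
  · obtain ⟨δ, hδ⟩ := hd
    have hδ0 : δ ≠ 0 := by rintro rfl; exact ht4 (by rw [hδ, mul_zero])
    rw [hδ] at hsq
    let r := h'.antisymmetrization.lagrangianRetract hδ0 hsq h'.antisymmetrization_anti
    exact ⟨_, IsFactor.glO K _ _ (LagrangianRetract.form_isSymm h'.antisymmetrization hs')
      (r.form_nondegenerate h'.antisymmetrization hs' hB'),
      ⟨i₁.trans (SymPair.Iso.res F (i₂.trans (SymPair.Iso.toGL r h'.antisymmetrization hs' hB')))⟩⟩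
  · have : Fact (∀ r : K, r ^ 2 ≠ (t ^ 2 - 4) + 0 * r) := ⟨fun r hr => hd ⟨r, by
      rw [zero_mul, add_zero] at hr
      rw [← hr, pow_two]⟩⟩
    exact ⟨_, IsFactor.uO K (QuadraticAlgebra K (t ^ 2 - 4) 0)
      (QuadraticAlgebra.finrank_eq_two _ _) _ (QuadraticAlgebra.conj_ne_refl _)
      (QuadraticAlgebra.conj_conj _) _ _ (hs'.restrict _)
      (h'.antisymmetrization.nondegenerate_fixedVectors hs' hB'),
      ⟨i₁.trans (SymPair.Iso.res F (i₂.trans (SymPair.Iso.toUnitaryOfSq h'.antisymmetrization hs' hB'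
        hsq h'.antisymmetrization_anti ht4)))⟩⟩

end FieldFactor

open Polynomial in
/-- The module structure over `F[X]/(p)` defined by an endomorphism that `p` annihilates. -/
noncomputable def adjoinRootHom {F V : Type u} [Field F] [AddCommGroup V] [Module F V] {p : F[X]}
    {T : Module.End F V} (hT : aeval T p = 0) : AdjoinRoot p →ₐ[F] Module.End F V :=
  Ideal.Quotient.liftₐ (Ideal.span {p}) (aeval T) fun f hf => by
    obtain ⟨q, rfl⟩ := Ideal.mem_span_singleton.1 hf
    rw [map_mul, hT, zero_mul]

open Polynomial in
theorem adjoinRootHom_mk {F V : Type u} [Field F] [AddCommGroup V] [Module F V] {p : F[X]}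
    {T : Module.End F V} (hT : aeval T p = 0) (f : F[X]) :
    adjoinRootHom hT (AdjoinRoot.mk p f) = aeval T f := rfl

/-! ### Polynomials in `T = Y + ε Y ε` and the splitting of `V`. -/

section Symmetrization

variable {F V : Type u} [Field F] [AddCommGroup V] [Module F V]
  {B : LinearMap.BilinForm F V} {ε Y : Module.End F V}

open Polynomial

theorem aeval_symmetrization_mem (ε Y : Module.End F V) (f : F[X]) :
    aeval (Y + ε * Y * ε) f ∈ Algebra.adjoin F {Y, ε * Y * ε} := by
  have h1 : Y + ε * Y * ε ∈ Algebra.adjoin F {Y, ε * Y * ε} := add_mem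
    (Algebra.subset_adjoin (Set.mem_insert _ _))
    (Algebra.subset_adjoin (Set.mem_insert_of_mem _ rfl))
  have h2 : Algebra.adjoin F {Y + ε * Y * ε} ≤ Algebra.adjoin F {Y, ε * Y * ε} :=
    Algebra.adjoin_le (Set.singleton_subset_iff.2 h1)
  exact h2 (aeval_mem_adjoin_singleton F _)

section Compression

variable {W : Type u} [AddCommGroup W] [Module F W] {i : W →ₗ[F] V} {π : V →ₗ[F] W}
  {X : Module.End F V}

theorem aeval_compression (hπ : ∀ w, π (i w) = w) (hX : ∀ v, X (i (π v)) = i (π (X v))) (f : F[X])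
    (w : W) : aeval (π ∘ₗ X ∘ₗ i : Module.End F W) f w = π (aeval X f (i w)) := by
  induction f using Polynomial.induction_on' generalizing w with
  | add f g hf hg => simp only [map_add, LinearMap.add_apply, hf, hg]
  | monomial n a =>
    have hn : ((π ∘ₗ X ∘ₗ i : Module.End F W) ^ n) w = π ((X ^ n) (i w)) := by
      induction n with
      | zero => exact (hπ w).symm
      | succ n ih =>
        rw [pow_succ', Module.End.mul_apply, ih, pow_succ', Module.End.mul_apply,
          LinearMap.comp_apply, LinearMap.comp_apply, hX, hπ]
    rw [aeval_monomial, Module.End.mul_apply, aeval_monomial, Module.End.mul_apply,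
      Module.algebraMap_end_apply, Module.algebraMap_end_apply, hn, map_smul]

/-- The compression is annihilated by the minimal polynomial of `X`, which is squarefree. -/
theorem Module.End.IsSemisimple.compression [FiniteDimensional F V] (hπ : ∀ w, π (i w) = w)
    (hX : ∀ v, X (i (π v)) = i (π (X v))) (h : X.IsSemisimple) :
    Module.End.IsSemisimple (π ∘ₗ X ∘ₗ i : Module.End F W) :=
  Module.End.isSemisimple_of_squarefree_aeval_eq_zero h.minpoly_squarefree
    (LinearMap.ext fun w => by rw [aeval_compression hπ hX, minpoly.aeval]; exact map_zero π)

end Compression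

namespace InvolutionDatum

variable (h : InvolutionDatum B ε Y)
include h

theorem commute_aeval_involution (f : F[X]) : Commute ε (aeval (Y + ε * Y * ε) f) := by
  refine Commute.aeval_right ?_ f
  refine LinearMap.ext fun v => ?_
  change ε (Y v + ε (Y (ε v))) = Y (ε v) + ε (Y (ε (ε v)))
  rw [map_add, h.involutive, h.involutive, add_comm]

theorem conj_mul (hinv : ∀ v, Y (ε (Y (ε v))) = v) : ε * Y * ε * Y = 1 := by
  refine LinearMap.ext fun v => ?_
  have h1 := congrArg ε (hinv (ε v))
  rwa [h.involutive] at h1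

theorem commute_aeval (hinv : ∀ v, Y (ε (Y (ε v))) = v) (f : F[X]) :
    Commute Y (aeval (Y + ε * Y * ε) f) := by
  refine Commute.aeval_right ((Commute.refl Y).add_right ?_) f
  exact (show Y * (ε * Y * ε) = 1 from LinearMap.ext hinv).trans (h.conj_mul hinv).symm

theorem aeval_selfAdjoint (f : F[X]) (v w : V) :
    B (aeval (Y + ε * Y * ε) f v) w = B v (aeval (Y + ε * Y * ε) f w) := by
  induction f using Polynomial.induction_on' generalizing v w with
  | add f g hf hg => simp only [map_add, LinearMap.add_apply, hf, hg]
  | monomial n a =>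
    have hT : ∀ v w, B ((Y + ε * Y * ε) v) w = B v ((Y + ε * Y * ε) w) := fun v w => by
      change B (Y v + ε (Y (ε v))) w = B v (Y w + ε (Y (ε w)))
      rw [map_add, LinearMap.add_apply, h.adjoint_adjoint, h.adjoint, map_add, add_comm]
    have hTn : ∀ v w, B (((Y + ε * Y * ε) ^ n) v) w = B v (((Y + ε * Y * ε) ^ n) w) := by
      induction n with
      | zero => intro v w; rfl
      | succ n ih =>
        intro v w
        rw [pow_succ, Module.End.mul_apply, ih, hT, ← Module.End.mul_apply, ← pow_succ', pow_succ]
    rw [aeval_monomial, Module.End.mul_apply, Module.End.mul_apply, Module.algebraMap_end_apply,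
      Module.algebraMap_end_apply, map_smul, LinearMap.smul_apply, hTn, map_smul]

/-- Polynomials in `T` are self-adjoint and commute with `ε` and `Y`, so an idempotent one is an
orthogonal projection onto a summand stable under both. -/
theorem orthogonalRetract (hinv : ∀ v, Y (ε (Y (ε v))) = v) (f : F[X])
    (hf : IsIdempotentElem (aeval (Y + ε * Y * ε) f)) :
    OrthogonalRetract B ε Y (LinearMap.range (aeval (Y + ε * Y * ε) f)).subtype
      (LinearMap.rangeRestrict (aeval (Y + ε * Y * ε) f)) where
  retract := by
    rintro ⟨_, v, rfl⟩
    exact Subtype.ext (LinearMap.congr_fun hf v)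
  mem_adjoin := aeval_symmetrization_mem ε Y f
  comm_involution v := LinearMap.congr_fun (h.commute_aeval_involution f) v
  comm v := LinearMap.congr_fun (h.commute_aeval hinv f) v
  selfAdjoint := h.aeval_selfAdjoint f

omit h in
theorem _root_.OrthogonalRetract.datum_inv {W : Type u} [AddCommGroup W] [Module F W]
    {i : W →ₗ[F] V} {π : V →ₗ[F] W} (r : OrthogonalRetract B ε Y i π)
    (hinv : ∀ v, Y (ε (Y (ε v))) = v) (w : W) :
    (π ∘ₗ Y ∘ₗ i) ((π ∘ₗ ε ∘ₗ i) ((π ∘ₗ Y ∘ₗ i) ((π ∘ₗ ε ∘ₗ i) w))) = w := by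
  simp only [LinearMap.comp_apply, ← r.comm, ← r.comm_involution, r.retract]
  rw [hinv, r.retract]

omit h in
theorem _root_.OrthogonalRetract.aeval_symmetrization {W : Type u} [AddCommGroup W] [Module F W]
    {i : W →ₗ[F] V} {π : V →ₗ[F] W} (r : OrthogonalRetract B ε Y i π) (f : F[X]) (w : W) :
    aeval ((π ∘ₗ Y ∘ₗ i : Module.End F W) + (π ∘ₗ ε ∘ₗ i : Module.End F W) *
      (π ∘ₗ Y ∘ₗ i : Module.End F W) * (π ∘ₗ ε ∘ₗ i : Module.End F W)) f w =
      π (aeval (Y + ε * Y * ε) f (i w)) := by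
  have h1 : (π ∘ₗ Y ∘ₗ i : Module.End F W) + (π ∘ₗ ε ∘ₗ i : Module.End F W) *
      (π ∘ₗ Y ∘ₗ i : Module.End F W) * (π ∘ₗ ε ∘ₗ i : Module.End F W) =
      π ∘ₗ (Y + ε * Y * ε) ∘ₗ i := LinearMap.ext fun w => by
    change π (Y (i w)) + π (ε (i (π (Y (i (π (ε (i w)))))))) = π (Y (i w) + ε (Y (ε (i w))))
    simp only [← r.comm, ← r.comm_involution, r.retract, map_add]
  rw [h1]
  refine aeval_compression r.retract (fun v => ?_) f w
  change Y _ + ε (Y (ε _)) = i (π (Y v + ε (Y (ε v))))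
  rw [r.comm, r.comm_involution, r.comm, r.comm_involution, map_add, map_add]

variable [CharZero F] [FiniteDimensional F V]

/-- `Y + Y⁻¹ = 2 c` with `c² = 1` gives `(Y - c)² = 0`, and a semisimple `Y` leaves no room for a
nilpotent part. Semisimplicity is essential for the orthogonal factors here. -/
theorem eq_smul_of_symmetrization_eq (hinv : ∀ v, Y (ε (Y (ε v))) = v) (hss : Y.IsSemisimple)
    {c : F} (hc : c * c = 1) (hT : Y + ε * Y * ε = algebraMap F _ (2 * c)) (v : V) :
    Y v = c • v := by
  have hY : Y * Y = algebraMap F _ (2 * c) * Y - 1 := by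
    rw [← hT, add_mul, h.conj_mul hinv, add_sub_cancel_right]
  have hN : IsNilpotent (Y - algebraMap F (Module.End F V) c) := by
    refine ⟨2, LinearMap.ext fun v => ?_⟩
    have h1 := LinearMap.congr_fun hY v
    change Y (Y v) = (2 * c) • Y v - v at h1
    change Y (Y v - c • v) - c • (Y v - c • v) = 0
    rw [map_sub, map_smul, h1, smul_sub, smul_smul, hc]
    module
  have := Module.End.eq_zero_of_isNilpotent_isSemisimple hN
    (Module.End.isSemisimple_sub_algebraMap_iff.2 hss)
  exact sub_eq_zero.1 (LinearMap.congr_fun this v)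

/-- The field `F[X]/(p)` acts on `V` with the root acting as `T`. The exceptional values `T = ±2`,
where `Y = ±1`, give orthogonal factors; away from them `t² - 4` is nonzero and
`exists_iso_of_field` applies. -/
theorem exists_iso_of_irreducible [Nontrivial V] (hs : B.IsSymm) (hB : B.Nondegenerate)
    (hinv : ∀ v, Y (ε (Y (ε v))) = v) (hss : Y.IsSemisimple) {p : F[X]} (hp : Irreducible p)
    (hT : aeval (Y + ε * Y * ε) p = 0) :
    ∃ P, IsFactor F P ∧ Nonempty (SymPair.Iso (centralizerPair hs hB h) P) := by
  by_cases h1 : Y + ε * Y * ε = algebraMap F _ (2 * 1)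
  · exact h.exists_iso_ofElement hs hB
      (h.eq_smul_of_symmetrization_eq hinv hss (one_mul 1) h1)
  by_cases h2 : Y + ε * Y * ε = algebraMap F _ (2 * -1)
  · exact h.exists_iso_ofElement hs hB
      (h.eq_smul_of_symmetrization_eq hinv hss (by ring) h2)
  have : Fact (Irreducible p) := ⟨hp⟩
  have : FiniteDimensional F (AdjoinRoot p) := (AdjoinRoot.powerBasis hp.ne_zero).finite
  letI : Module (AdjoinRoot p) V := Module.compHom V (adjoinRootHom hT).toRingHom
  have hsmul : ∀ (a : AdjoinRoot p) (v : V), a • v = adjoinRootHom hT a v := fun _ _ => rfl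
  have hmk : ∀ (f : F[X]) (v : V), AdjoinRoot.mk p f • v = aeval (Y + ε * Y * ε) f v :=
    fun _ _ => rfl
  have : IsScalarTower F (AdjoinRoot p) V := ⟨fun c a v => by
    rw [hsmul, hsmul, map_smul, LinearMap.smul_apply]⟩
  let ε' : Module.End (AdjoinRoot p) V :=
    { toFun := ε
      map_add' := map_add ε
      map_smul' := fun a v => by
        obtain ⟨f, rfl⟩ := AdjoinRoot.mk_surjective a
        exact LinearMap.congr_fun (h.commute_aeval_involution f) v }
  let Y' : Module.End (AdjoinRoot p) V :=
    { toFun := Y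
      map_add' := map_add Y
      map_smul' := fun a v => by
        obtain ⟨f, rfl⟩ := AdjoinRoot.mk_surjective a
        exact LinearMap.congr_fun (h.commute_aeval hinv f) v }
  have h' : InvolutionDatum B (ε'.restrictScalars F) (Y'.restrictScalars F) := h
  refine h'.exists_iso_of_field hs hB (t := AdjoinRoot.root p) (fun a v w => ?_) (fun a => ?_)
    (fun v => ?_) hinv (fun h4 => ?_)
  · obtain ⟨f, rfl⟩ := AdjoinRoot.mk_surjective a
    exact h.aeval_selfAdjoint f v w
  · obtain ⟨f, rfl⟩ := AdjoinRoot.mk_surjective a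
    exact aeval_symmetrization_mem ε Y f
  · rw [← AdjoinRoot.mk_X, hmk, aeval_X]
    rfl
  -- In a field `t² = 4` forces `t = ±2`, and then `T` is one of the scalars already excluded.
  · have h5 : (AdjoinRoot.root p - 2 * 1) * (AdjoinRoot.root p - 2 * -1) = 0 := by
      rw [← h4]; ring
    have h6 : ∀ c : F, AdjoinRoot.root p - 2 * algebraMap F _ c = 0 →
        Y + ε * Y * ε = algebraMap F _ (2 * c) := fun c hc => by
      have h7 := congrArg (adjoinRootHom hT) hc
      rw [← AdjoinRoot.mk_X, map_sub, map_mul, adjoinRootHom_mk, aeval_X, map_zero, AlgHom.commutes,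
        map_ofNat, sub_eq_zero] at h7
      rw [h7, map_mul, map_ofNat]
    rcases mul_eq_zero.1 h5 with h5 | h5
    · exact h1 (h6 1 (by rw [map_one]; exact h5))
    · exact h2 (h6 (-1) (by rw [map_neg, map_one]; exact h5))

end InvolutionDatum

end Symmetrization

open Polynomial in
/-- If `Y` is semisimple and orthogonal, then the pair formed by the centralizer of `Y` and the
involution `g ↦ ε g ε` is a product of pairs of the three types. -/
theorem InvolutionDatum.exists_iso_prod {F : Type u} [Field F] [CharZero F] (n : ℕ) {V : Type u} [AddCommGroup V]
    [Module F V] [FiniteDimensional F V] (hn : Module.finrank F V = n)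
    {B : LinearMap.BilinForm F V} {ε Y : Module.End F V} (h : InvolutionDatum B ε Y)
    (hs : B.IsSymm) (hB : B.Nondegenerate) (hinv : ∀ v, Y (ε (Y (ε v))) = v)
    (hss : Y.IsSemisimple) :
    ∃ (m : ℕ) (P : Fin m → SymPair F),
      (∀ i, ∃ Q, IsFactor F Q ∧ Nonempty (SymPair.Iso (P i) Q)) ∧
        Nonempty (SymPair.Iso (centralizerPair hs hB h) (SymPair.prod P)) := by
  induction n using Nat.strong_induction_on generalizing V with
  | _ n ih =>
    rcases subsingleton_or_nontrivial V with hV | hV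
    · refine ⟨0, Fin.elim0, fun i => i.elim0, ⟨SymPair.Iso.ofSubsingleton _ (fun R _ _ =>
        ⟨fun a b => Subtype.ext (Units.ext (end_ext fun w => ?_))⟩) _⟩⟩
      rw [Subsingleton.elim w 0, TensorProduct.tmul_zero, map_zero, map_zero]
    · set T := Y + ε * Y * ε with hTdef
      -- `ε Y ε` is semisimple as a conjugate of `Y`, and it commutes with `Y`, being its inverse.
      have hTss : T.IsSemisimple := by
        refine Module.End.IsSemisimple.add_of_commute
          ((show Y * (ε * Y * ε) = 1 from LinearMap.ext hinv).trans (h.conj_mul hinv).symm) hss ?_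
        exact hss.compression h.involutive fun v => by rw [h.involutive, h.involutive]
      have hint : IsIntegral F T := Algebra.IsIntegral.isIntegral T
      obtain ⟨p, hp, q, hq⟩ := WfDvdMonoid.exists_irreducible_factor (minpoly.not_isUnit F T)
        (minpoly.ne_zero hint)
      -- Squarefreeness of the minimal polynomial `p q` gives `u p + v q = 1`. The idempotent `(v
      -- q)(T)` projects onto the part of `V` killed by `p(T)`, and `(u p)(T)` onto its orthogonal
      -- complement.
      obtain ⟨u, v, huv⟩ : IsCoprime p q := by
        have := hTss.minpoly_squarefree
        rw [hq] at this
        exact (IsRelPrime.of_squarefree_mul this).isCoprime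
      have hpq : aeval T (p * q) = 0 := by rw [← hq, minpoly.aeval]
      have hsum : aeval T (v * q) + aeval T (u * p) = 1 := by
        rw [← map_add, add_comm, huv, map_one]
      have h12 : aeval T (v * q) * aeval T (u * p) = 0 := by
        rw [← map_mul, show v * q * (u * p) = v * u * (p * q) by ring, map_mul, hpq, mul_zero]
      have h21 : aeval T (u * p) * aeval T (v * q) = 0 := by
        rw [← map_mul, mul_comm, map_mul, h12]
      have he₁ : IsIdempotentElem (aeval T (v * q)) := by
        have := congrArg (aeval T (v * q) * ·) hsum
        change _ * _ = _
        simpa only [mul_add, h12, add_zero, mul_one] using this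
      have he₂ : IsIdempotentElem (aeval T (u * p)) := by
        have := congrArg (aeval T (u * p) * ·) hsum
        change _ * _ = _
        simpa only [mul_add, h21, zero_add, mul_one] using this
      -- Otherwise `q(T) = 0`, although `q` is a proper divisor of the minimal polynomial. So the
      -- first block is nonzero and the second has smaller dimension, as the induction requires.
      have hne : aeval T (v * q) ≠ 0 := fun h0 => by
        rw [h0, zero_add] at hsum
        have h1 : aeval T q = 0 := by
          rw [← mul_one (aeval T q), ← hsum, ← map_mul, show q * (u * p) = u * (p * q) by ring,
            map_mul, hpq, mul_zero]
        have h2 := minpoly.dvd F T h1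
        have hq0 : q ≠ 0 := fun h0 => minpoly.ne_zero hint (by rw [hq, h0, mul_zero])
        rw [hq] at h2
        exact hp.not_isUnit (isUnit_of_dvd_one ((mul_dvd_mul_iff_right hq0).1
          (by rwa [one_mul])))
      have r₁ := h.orthogonalRetract hinv (v * q) he₁
      have r₂ := h.orthogonalRetract hinv (u * p) he₂
      have : Nontrivial (LinearMap.range (aeval T (v * q))) := by
        rw [Submodule.nontrivial_iff_ne_bot]
        exact fun h0 => hne (LinearMap.range_eq_bot.1 h0)
      have hlt : Module.finrank F (LinearMap.range (aeval T (u * p))) < n := by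
        rw [← hn]
        refine Submodule.finrank_lt fun htop => hne (LinearMap.ext fun x => ?_)
        obtain ⟨y, rfl⟩ := LinearMap.range_eq_top.1 htop x
        exact LinearMap.congr_fun h12 y
      obtain ⟨m, P, hP, ⟨b⟩⟩ := ih _ hlt rfl (r₂.datum h) (OrthogonalRetract.isSymm hs)
        (r₂.nondegenerate hs hB) (r₂.datum_inv hinv) (hss.compression r₂.retract r₂.comm)
      have hP₁ := (r₁.datum h).exists_iso_of_irreducible (OrthogonalRetract.isSymm hs)
        (r₁.nondegenerate hs hB) (r₁.datum_inv hinv) (hss.compression r₁.retract r₁.comm) hp (by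
          refine LinearMap.ext fun w => ?_
          obtain ⟨x, hx⟩ := w.2
          have h0 : aeval T p w.1 = 0 := by
            rw [← hx, ← Module.End.mul_apply, ← map_mul, show p * (v * q) = v * (p * q) by ring,
              map_mul, hpq, mul_zero]
            rfl
          rw [r₁.aeval_symmetrization]
          exact (congrArg _ h0).trans (map_zero _))
      exact ⟨m + 1, _, fun i => Fin.cases hP₁ hP i,
        ⟨SymPair.Iso.ofDecomposition r₁ r₂ (LinearMap.congr_fun hsum) h hs hB b⟩⟩

/-! ### Conclusion: from a semisimple point of `O(V)` to the product. -/

section BasePoints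

variable {F V : Type u} [Field F] [AddCommGroup V] [Module F V]

theorem Module.End.IsSemisimple.of_baseChange_self [FiniteDimensional F V] {Y : Module.End F V}
    (h : Module.End.IsSemisimple (Y.baseChange F : Module.End F (F ⊗[F] V))) : Y.IsSemisimple := by
  have h1 := h.compression (i := (TensorProduct.lid F V).symm.toLinearMap)
    (π := (TensorProduct.lid F V).toLinearMap) (fun w => LinearEquiv.apply_symm_apply _ w)
    (fun v => by
      rw [LinearEquiv.coe_coe, LinearEquiv.coe_coe, LinearEquiv.symm_apply_apply,
        LinearEquiv.symm_apply_apply])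
  rwa [show (TensorProduct.lid F V).toLinearMap ∘ₗ Y.baseChange F ∘ₗ
    (TensorProduct.lid F V).symm.toLinearMap = Y from LinearMap.ext fun v => by simp] at h1

variable {B : LinearMap.BilinForm F V}

theorem isometry_of_eq_baseChange {g : (orthogonalGroup B).pts F} {g₀ : Module.End F V}
    (h : (show orthogonalPoints B F from g).1.1 = g₀.baseChange F) (v w : V) :
    B (g₀ v) (g₀ w) = B v w := by
  have h1 := (show orthogonalPoints B F from g).2 (1 ⊗ₜ v) (1 ⊗ₜ w)
  rw [h] at h1
  simpa using h1

theorem mul_eq_one_of_eq_baseChange {g g' : (orthogonalGroup B).pts F} {g₀ g₀' : Module.End F V}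
    (h : (show orthogonalPoints B F from g).1.1 = g₀.baseChange F)
    (h' : (show orthogonalPoints B F from g').1.1 = g₀'.baseChange F) (hgg' : g * g' = 1) (v : V) :
    g₀ (g₀' v) = v := by
  have h1 : g₀ * g₀' = 1 := by
    refine Module.End.baseChange_self_injective ?_
    rw [Module.End.mul_eq_comp, LinearMap.baseChange_comp, ← h, ← h', Module.End.one_eq_id,
      LinearMap.baseChange_id]
    exact congrArg (fun a : orthogonalPoints B F => a.1.1) hgg'
  exact LinearMap.congr_fun h1 v

end BasePoints

/-- The centralizer of a semisimple element in the pair `(O(V), O(V)_ε)` is a product of pairs of the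
three types. -/
theorem exists_iso_prod_of_isSemisimple {F : Type u} [Field F] [CharZero F]
    {V : Type u} [AddCommGroup V] [Module F V] [FiniteDimensional F V]
    {B : LinearMap.BilinForm F V} (hs : B.IsSymm) (hB : B.Nondegenerate)
    {ε x : (orthogonalGroup B).pts F} (hε : orderOf ε = 2)
    (hσ : (SymPair.ofElement (orthogonalGroup B) ε hε).σ F x = x)
    (hss : Module.End.IsSemisimple (show orthogonalPoints B F from x).1.1) :
    ∃ (n : ℕ) (P : Fin n → SymPair F), (∀ i, IsFactor F (P i)) ∧ Nonempty (SymPair.Iso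
      ((SymPair.ofElement (orthogonalGroup B) ε hε).centralizer x hσ) (SymPair.prod P)) := by
  have hεε : ε * ε = 1 := by rw [← pow_two, ← hε, pow_orderOf_eq_one]
  obtain ⟨ε₀, hε₀⟩ :=
    Module.End.exists_eq_baseChange_self (show orthogonalPoints B F from ε).1.1
  obtain ⟨Y, hY⟩ := Module.End.exists_eq_baseChange_self (show orthogonalPoints B F from x).1.1
  have hof : (orthogonalGroup B).map (Algebra.ofId F F) ε = ε := (orthogonalGroup B).map_id F ε
  have hx : ε * x⁻¹ * ε = x := by
    have h1 : (orthogonalGroup B).map (Algebra.ofId F F) ε * x⁻¹ *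
      (orthogonalGroup B).map (Algebra.ofId F F) ε = x := hσ
    rwa [hof] at h1
  have hxε : x * (ε * x * ε) = 1 := by
    calc x * (ε * x * ε) = ε * x⁻¹ * (ε * ε) * x * ε := by
          nth_rw 1 [← hx]; simp only [mul_assoc]
      _ = 1 := by rw [hεε, mul_one, inv_mul_cancel_right, hεε]
  have hinvol := mul_eq_one_of_eq_baseChange hε₀ hε₀ hεε
  have hconj : (show orthogonalPoints B F from ε * x * ε).1.1 = (ε₀ * Y * ε₀).baseChange F := by
    rw [Module.End.mul_eq_comp, Module.End.mul_eq_comp, LinearMap.baseChange_comp,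
      LinearMap.baseChange_comp, ← hε₀, ← hY]
    rfl
  have hinv : ∀ v, Y (ε₀ (Y (ε₀ v))) = v := mul_eq_one_of_eq_baseChange hY hconj hxε
  -- The adjoint of the isometry `Y` is `Y⁻¹`, which is `ε₀ Y ε₀` because `σ(x) = x`.
  have h : InvolutionDatum B ε₀ Y := ⟨hinvol, isometry_of_eq_baseChange hε₀, fun v w => by
    rw [← isometry_of_eq_baseChange hY v, hinv]⟩
  rw [hY] at hss
  obtain ⟨n, P, hP, ⟨a⟩⟩ := h.exists_iso_prod _ rfl hs hB hinv hss.of_baseChange_self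
  -- The blocks are so far only isomorphic to pairs of the three types; a product of isomorphisms
  -- replaces them by such pairs.
  choose Q hQ b using hP
  exact ⟨n, Q, hQ, ⟨(SymPair.Iso.centralizerOfElement hs hB hε hσ h hε₀ hY).trans
    (a.trans (SymPair.Iso.prodCongr fun i => (b i).some))⟩⟩

theorem mainTheorem10 {F : Type u} [Field F] [CharZero F]
    {V : Type u} [AddCommGroup V] [Module F V] [FiniteDimensional F V]
    (B : LinearMap.BilinForm F V) (hs : B.IsSymm) (hB : B.Nondegenerate)
    (ε : (orthogonalGroup B).pts F) (hε : orderOf ε = 2)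
    (D : SymPair F) (hD : (SymPair.ofElement (orthogonalGroup B) ε hε).IsDescendant D) :
    ∃ (n : ℕ) (P : Fin n → SymPair F),
      (∀ i, IsFactor F (P i)) ∧ Nonempty (SymPair.Iso D (SymPair.prod P)) := by
  obtain ⟨g, hcl, rfl⟩ := hD
  exact exists_iso_prod_of_isSemisimple hs hB hε _
    (isSemisimple_s_of_isZariskiClosed B hs hB ε hε g hcl)
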